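/- Let $F$ be a non-archimedean local field of residual characteristic $\neq 2$, with ring of integers $R$, uniformizer $\varpi$, residue field of $q$ elements, and absolute value normalized by $|\varpi|=q^{-1}$. Let $J$ be the $5\times5$ matrix with $1$'s on the antidiagonal and $0$'s elsewhere, $G=SO(3,2;F)=\{g\in SL(5,F): {}^tgJg=J\}$, $K=SO(3,2;R)=\{g\in G:\ \text{all entries of } g \text{ lie in } R\}$, and let $dg$ be the Haar measure on $G$ giving $K$ volume $1$. Put $Q(v,v)={}^tvJv=2v_1v_5+2v_2v_4+v_3^2$ for columns $v\in F^5$. Consider two cases: * split case: $S=\{v\in F^5: Q(v,v)=1\}$ and $v_1={}^t(\tfrac12,0,0,0,1)$; * non-split case: $\theta\in R^\times$ is a unit that is not a square in $F$, $S=\{v\in F^5: Q(v,v)=4\theta\}$ and $v_1={}^t(2\theta,0,0,1,1)$. $G$ acts on $S$ by multiplication; the action is transitive, so that $S\simeq G/C_\theta$, where $C_\theta$ is the stabilizer of a point (isomorphic to $SO(2,2)$ resp. $SO(3,1)$). For $r\ge 0$ let $d_r=\mathrm{diag}(\varpi^r,1,1,1,\varpi^{-r})$. Let $B=A_0N_0$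 be the upper triangular Borel subgroup of $G$, with diagonal torus $A_0$ and unipotent radical $N_0$, and let $\delta_B$ be its modulus, $\delta_B(a)=|\alpha|^3|\beta|$ for $a=\mathrm{diag}(\alpha,\beta,1,\beta^{-1},\alpha^{-1})$. For $\zeta,\zeta'\in\mathbb C$ let $I_G(\zeta,\zeta')$ be the representation of $G$ by right translation on the space of locally constant $\phi:G\to\mathbb C$ with $$\phi(nag)=\delta_B(a)^{1/2}\,|\alpha/\beta|^{\zeta}\,|\beta|^{\zeta'}\,\phi(g)\qquad(n\in N_0,\ a\in A_0,\ g\in G).$$ Put $\pi_\zeta=I_G(\zeta,\tfrac12+\zeta)$. For $f\in C_c(K\backslash G/K)$ let $f^\vee(\pi)=\mathrm{tr}\,\pi(f)$, where $\pi(f)=\int_G f(g)\pi(g)\,dg$. **Proposition 2.2.** For every $\zeta\in\mathbb C$ there is a unique $K$-invariant function $T_\zeta:S\to\mathbb C$ with $T_\zeta(v_1)=1$ such that $$\int_G f(g)\,T_\zeta(gs)\,dg=f^\vee(\pi_\zeta)\,T_\zeta(s)\qquad\text{for all } f\in C_c(K\backslash G/K),\ s\in S.$$ For $r\geq1$ its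 values are $$T_\zeta(d_rv_1)=\sum_{\xi\in\{\zeta,-\zeta\}}\frac{(q^{\frac32+\xi}-1)(1\mp q^{-\frac12-\xi})}{(q^{\xi}-q^{-\xi})(q^{\frac32}\mp q^{-\frac12})}\,q^{-r(\frac32-\xi)},$$ where the upper sign "$-$" occurs in the split case and the lower sign "$+$" in the non-split case. Here $q^\zeta\neq q^{-\zeta}$; if $q^\zeta=q^{-\zeta}$, then $T_\zeta(d_rv_1)$ is the limit, as $z\to\zeta$ with $z\ne\zeta$, of the right-hand side with $\zeta$ replaced by $z$. -/

import Mathlib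

open scoped NormedField Valued Matrix
open MeasureTheory

/-!
Throughout, `F` is a non-archimedean local field, given as a nontrivially normed field whose norm is
ultrametric and whose topology is locally compact. The norm plays the role of `|·|`; the theorem
assumes that it is normalized (`‖ϖ‖ = q⁻¹`). The ring of integers is `𝒪[F]` (the closed unit ball),
its maximal ideal `𝓂[F]` and its residue field `𝓀[F]`.
-/

namespace SO5

noncomputable section

/-- The number `q` of elements of the residue field. -/
def q (F : Type*) [NontriviallyNormedField F] [IsUltrametricDist F] : ℕ := Nat.card 𝓀[F]

/-- `ϖ` is a generator of the maximal ideal of the ring of integers. -/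
def IsUniformizer {F : Type*} [NontriviallyNormedField F] [IsUltrametricDist F] (ϖ : Fˣ) : Prop :=
  ∃ p : 𝒪[F], (p : F) = (ϖ : F) ∧ 𝓂[F] = Ideal.span {p}

/-! ### The group `G = SO(3,2;F)` and its subgroups -/

/-- The matrix with `1` on the antidiagonal and `0` elsewhere. -/
def J (F : Type*) [NontriviallyNormedField F] : Matrix (Fin 5) (Fin 5) F :=
  Matrix.of fun i j => if j = i.rev then 1 else 0

lemma J_mul_apply {F : Type*} [NontriviallyNormedField F] (A : Matrix (Fin 5) (Fin 5) F)
    (i j : Fin 5) : (J F * A) i j = A i.rev j := by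
  simp [Matrix.mul_apply, J]

lemma mul_J_apply {F : Type*} [NontriviallyNormedField F] (A : Matrix (Fin 5) (Fin 5) F)
    (i j : Fin 5) : (A * J F) i j = A i j.rev := by
  rw [Matrix.mul_apply, Finset.sum_eq_single j.rev]
  · simp [J]
  · intro b _ hb
    have : ¬ j = b.rev := by
      rintro rfl
      simp at hb
    simp [J, this]
  · simp

lemma J_mul_J (F : Type*) [NontriviallyNormedField F] : J F * J F = 1 := by
  ext i j
  rw [J_mul_apply]
  simp [J, Matrix.one_apply, eq_comm]

/-- `G = SO(3,2;F)`: the matrices `g ∈ SL(5,F)` with `ᵗg J g = J`. -/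
def SO32 (F : Type*) [NontriviallyNormedField F] :
    Subgroup (Matrix.SpecialLinearGroup (Fin 5) F) where
  carrier := {g | (g : Matrix (Fin 5) (Fin 5) F)ᵀ * J F * (g : Matrix (Fin 5) (Fin 5) F) = J F}
  one_mem' := by simp
  mul_mem' := by
    intro a b ha hb
    simp only [Set.mem_ofPred_eq, Matrix.SpecialLinearGroup.coe_mul, Matrix.transpose_mul] at *
    calc _ = (b : Matrix (Fin 5) (Fin 5) F)ᵀ * ((a : Matrix (Fin 5) (Fin 5) F)ᵀ * J F *
          (a : Matrix (Fin 5) (Fin 5) F)) * (b : Matrix (Fin 5) (Fin 5) F) := by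
          simp only [Matrix.mul_assoc]
      _ = J F := by rw [ha, hb]
  inv_mem' := by
    intro a ha
    simp only [Set.mem_ofPred_eq] at *
    have h1 : (a : Matrix (Fin 5) (Fin 5) F) * ((a⁻¹ : Matrix.SpecialLinearGroup (Fin 5) F) :
        Matrix (Fin 5) (Fin 5) F) = 1 := by
      rw [← Matrix.SpecialLinearGroup.coe_mul, mul_inv_cancel, Matrix.SpecialLinearGroup.coe_one]
    have h2 := congrArg Matrix.transpose h1
    rw [Matrix.transpose_mul, Matrix.transpose_one] at h2
    set b := ((a⁻¹ : Matrix.SpecialLinearGroup (Fin 5) F) : Matrix (Fin 5) (Fin 5) F)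
    calc bᵀ * J F * b = bᵀ * ((a : Matrix (Fin 5) (Fin 5) F)ᵀ * J F *
          (a : Matrix (Fin 5) (Fin 5) F)) * b := by rw [ha]
      _ = (bᵀ * (a : Matrix (Fin 5) (Fin 5) F)ᵀ) * J F *
          ((a : Matrix (Fin 5) (Fin 5) F) * b) := by simp only [Matrix.mul_assoc]
      _ = J F := by rw [h1, h2]; simp

/-- The `(i,j)` entry of `g ∈ G`. -/
def entry {F : Type*} [NontriviallyNormedField F] (g : SO32 F) (i j : Fin 5) : F :=
  (g : Matrix.SpecialLinearGroup (Fin 5) F).1 i j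

lemma entry_mul {F : Type*} [NontriviallyNormedField F] (g h : SO32 F) (i j : Fin 5) :
    entry (g * h) i j = ∑ k, entry g i k * entry h k j := by
  simp [entry, Matrix.mul_apply]

lemma entry_one {F : Type*} [NontriviallyNormedField F] (i j : Fin 5) :
    entry (1 : SO32 F) i j = if i = j then 1 else 0 := by
  simp [entry, Matrix.one_apply]

lemma entry_inv {F : Type*} [NontriviallyNormedField F] (g : SO32 F) (i j : Fin 5) :
    entry g⁻¹ i j = entry g j.rev i.rev := by
  have hg : (g.1.1)ᵀ * J F * g.1.1 = J F := g.2
  have h1 : g.1.1 * (g⁻¹).1.1 = 1 := by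
    change (g * g⁻¹ : SO32 F).1.1 = 1
    rw [mul_inv_cancel]
    rfl
  have h2 : (g⁻¹).1.1 = J F * (g.1.1)ᵀ * J F := by
    calc (g⁻¹).1.1 = (J F * J F) * (g⁻¹).1.1 := by rw [J_mul_J, Matrix.one_mul]
      _ = J F * ((g.1.1)ᵀ * J F * g.1.1) * (g⁻¹).1.1 := by rw [hg]
      _ = J F * (g.1.1)ᵀ * J F * (g.1.1 * (g⁻¹).1.1) := by simp only [Matrix.mul_assoc]
      _ = _ := by rw [h1, Matrix.mul_one]
  have h3 : entry g⁻¹ i j = (J F * (g.1.1)ᵀ * J F) i j := by rw [← h2]; rfl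
  rw [h3, mul_J_apply, J_mul_apply]
  rfl

instance (F : Type*) [NontriviallyNormedField F] : MeasurableSpace (SO32 F) := borel _
instance (F : Type*) [NontriviallyNormedField F] : BorelSpace (SO32 F) := ⟨rfl⟩

/-- `K = SO(3,2;R)`: the elements of `G` with all entries in the ring of integers. -/
def K (F : Type*) [NontriviallyNormedField F] [IsUltrametricDist F] : Subgroup (SO32 F) where
  carrier := {g | ∀ i j, entry g i j ∈ 𝒪[F]}
  one_mem' := by
    intro i j
    rw [entry_one]
    split_ifs
    · exact one_mem _
    · exact zero_mem _
  mul_mem' := by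
    intro a b ha hb i j
    rw [entry_mul]
    exact sum_mem fun k _ => mul_mem (ha i k) (hb k j)
  inv_mem' := by
    intro a ha i j
    rw [entry_inv]
    exact ha _ _

/-- `N₀`: the upper triangular unipotent elements of `G`. -/
def N₀ (F : Type*) [NontriviallyNormedField F] : Set (SO32 F) :=
  {g | (∀ i, entry g i i = 1) ∧ ∀ i j, j < i → entry g i j = 0}

/-- The element `diag(α, β, 1, β⁻¹, α⁻¹)` of the diagonal torus `A₀` of `G`. -/
def torus {F : Type*} [NontriviallyNormedField F] (α β : Fˣ) : SO32 F :=
  ⟨⟨Matrix.diagonal ![(α : F), (β : F), 1, (β : F)⁻¹, (α : F)⁻¹], by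
      simp [Matrix.det_diagonal, Fin.prod_univ_five]⟩, by
    change (Matrix.diagonal ![(α : F), (β : F), 1, (β : F)⁻¹, (α : F)⁻¹])ᵀ * J F *
      Matrix.diagonal ![(α : F), (β : F), 1, (β : F)⁻¹, (α : F)⁻¹] = J F
    ext i j
    rw [Matrix.diagonal_transpose, Matrix.mul_diagonal, Matrix.diagonal_mul]
    fin_cases i <;> fin_cases j <;> simp [J, Fin.rev, Fin.ext_iff]⟩

/-! ### The spherical Hecke algebra -/

/-- The space `C_c(K\G/K)` of `K`-biinvariant compactly supported functions on `G`. -/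
def sphericalHecke (F : Type*) [NontriviallyNormedField F] [IsUltrametricDist F] :
    Submodule ℂ (SO32 F → ℂ) where
  carrier := {f | (∀ k₁ ∈ K F, ∀ k₂ ∈ K F, ∀ g, f (k₁ * g * k₂) = f g) ∧ HasCompactSupport f}
  zero_mem' := ⟨fun _ _ _ _ _ => rfl, HasCompactSupport.zero⟩
  add_mem' := by
    intro a b ha hb
    refine ⟨fun k₁ h₁ k₂ h₂ g => ?_, ha.2.add hb.2⟩
    simp only [Pi.add_apply, ha.1 k₁ h₁ k₂ h₂ g, hb.1 k₁ h₁ k₂ h₂ g]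
  smul_mem' := by
    intro c a ha
    refine ⟨fun k₁ h₁ k₂ h₂ g => ?_, ?_⟩
    · simp only [Pi.smul_apply, ha.1 k₁ h₁ k₂ h₂ g]
    · exact ha.2.mono (Function.support_const_smul_subset c a)

lemma isOpen_K (F : Type*) [NontriviallyNormedField F] [IsUltrametricDist F] :
    IsOpen (K F : Set (SO32 F)) := by
  have h : (K F : Set (SO32 F)) = ⋂ i, ⋂ j, {g | entry g i j ∈ 𝒪[F]} := by
    ext g
    simp only [Set.mem_iInter, Set.mem_ofPred_eq]
    rfl
  rw [h]
  refine isOpen_iInter_of_finite fun i => isOpen_iInter_of_finite fun j => ?_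
  have hc : Continuous fun g : SO32 F => entry g i j :=
    (Continuous.matrix_elem continuous_subtype_val i j).comp continuous_subtype_val
  exact (Valued.isOpen_integer F).preimage hc

lemma isLocallyConstant_of_right_invariant {F : Type*} [NontriviallyNormedField F]
    [IsUltrametricDist F] {f : SO32 F → ℂ} (hf : ∀ k ∈ K F, ∀ g, f (g * k) = f g) :
    IsLocallyConstant f := by
  rw [IsLocallyConstant.iff_exists_open]
  intro x
  refine ⟨(fun g => x⁻¹ * g) ⁻¹' (K F : Set (SO32 F)),
    (isOpen_K F).preimage (continuous_const_mul x⁻¹), ?_, ?_⟩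
  · simp [one_mem]
  · intro y hy
    have := hf _ hy x
    simpa using this

/-! ### Unramified principal series and the Satake transform -/

/-- The modulus `δ_B(diag(α, β, 1, β⁻¹, α⁻¹))` of the Borel subgroup: the product of the absolute
values of the positive roots `α/β`, `β`, `α`, `αβ`, that is `|α|³|β|`. -/
def deltaB {F : Type*} [NontriviallyNormedField F] (α β : Fˣ) : ℝ :=
  ‖(α : F) / (β : F)‖ * ‖(β : F)‖ * ‖(α : F)‖ * ‖(α : F) * (β : F)‖

/-- The factor `δ_B(a)^{1/2} |α₁(a)|^ζ |α₂(a)|^ζ'` at `a = diag(α, β, 1, β⁻¹, α⁻¹)`, with the simple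
roots `α₁(a) = α/β` and `α₂(a) = β`. -/
def inducingFactor {F : Type*} [NontriviallyNormedField F] (ζ ζ' : ℂ) (α β : Fˣ) : ℂ :=
  (Real.sqrt (deltaB α β) : ℂ) * (‖(α : F) / (β : F)‖ : ℂ) ^ ζ * (‖(β : F)‖ : ℂ) ^ ζ'

/-- The space of `I_G(ζ,ζ')`, the representation of `G` normalizedly induced from the character
`|α₁|^ζ |α₂|^ζ'` of the Borel subgroup `B = N₀A₀`: locally constant functions `φ` with
`φ(nag) = δ_B(a)^{1/2} |α₁(a)|^ζ |α₂(a)|^ζ' φ(g)`. The group acts by right translation. -/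
def inducedRep (F : Type*) [NontriviallyNormedField F] (ζ ζ' : ℂ) :
    Submodule ℂ (SO32 F → ℂ) where
  carrier := {φ | IsLocallyConstant φ ∧ ∀ n ∈ N₀ F, ∀ α β : Fˣ, ∀ g,
    φ (n * torus α β * g) = inducingFactor ζ ζ' α β * φ g}
  zero_mem' := ⟨IsLocallyConstant.const 0, by simp⟩
  add_mem' := by
    intro a b ha hb
    refine ⟨ha.1.add hb.1, fun n hn α β g => ?_⟩
    simp only [Pi.add_apply, ha.2 n hn α β g, hb.2 n hn α β g, mul_add]
  smul_mem' := by
    intro c a ha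
    refine ⟨ha.1.comp (fun z => c • z), fun n hn α β g => ?_⟩
    simp only [Pi.smul_apply, ha.2 n hn α β g, smul_eq_mul]
    ring

lemma integrable_hecke_mul {F : Type*} [NontriviallyNormedField F] [IsUltrametricDist F]
    (μ : Measure (SO32 F)) [μ.IsHaarMeasure] (f : sphericalHecke F) {φ : SO32 F → ℂ}
    (hφ : IsLocallyConstant φ) (h : SO32 F) :
    Integrable (fun g => f.1 g * φ (h * g)) μ := by
  have hf : Continuous f.1 := (isLocallyConstant_of_right_invariant fun k hk g => by
    simpa using f.2.1 1 (one_mem _) k hk g).continuous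
  have hφ' : Continuous fun g => φ (h * g) := hφ.continuous.comp (continuous_const_mul h)
  exact (hf.mul hφ').integrable_of_hasCompactSupport f.2.2.mul_right

/-- The operator `π(f)` on the space of `π = I_G(ζ,ζ')`:
`(π(f)φ)(h) = ∫_G f(g) φ(hg) dg`. -/
def heckeOp {F : Type*} [NontriviallyNormedField F] [IsUltrametricDist F]
    (μ : Measure (SO32 F)) [μ.IsHaarMeasure] (ζ ζ' : ℂ) (f : sphericalHecke F) :
    inducedRep F ζ ζ' →ₗ[ℂ] inducedRep F ζ ζ' where
  toFun φ := ⟨fun h => ∫ g, f.1 g * φ.1 (h * g) ∂μ, by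
    refine ⟨isLocallyConstant_of_right_invariant fun k hk h => ?_, fun n hn α β h => ?_⟩
    · rw [← integral_mul_left_eq_self (μ := μ) (fun g => f.1 g * φ.1 (h * g)) k]
      refine integral_congr_ae (Filter.Eventually.of_forall fun g => ?_)
      have hk' : f.1 (k * g) = f.1 g := by simpa using f.2.1 k hk 1 (one_mem _) g
      simp only [hk', mul_assoc]
    · simp only [mul_assoc]
      rw [← integral_const_mul]
      refine integral_congr_ae (Filter.Eventually.of_forall fun g => ?_)
      have := φ.2.2 n hn α β (h * g)
      simp only [mul_assoc] at this
      simp only [this]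
      ring⟩
  map_add' φ ψ := by
    ext h
    change ∫ g, f.1 g * (φ.1 (h * g) + ψ.1 (h * g)) ∂μ =
      (∫ g, f.1 g * φ.1 (h * g) ∂μ) + ∫ g, f.1 g * ψ.1 (h * g) ∂μ
    simp only [mul_add]
    exact integral_add (integrable_hecke_mul μ f φ.2.1 h) (integrable_hecke_mul μ f ψ.2.1 h)
  map_smul' c φ := by
    ext h
    change ∫ g, f.1 g * (c * φ.1 (h * g)) ∂μ = c * ∫ g, f.1 g * φ.1 (h * g) ∂μ
    rw [← integral_const_mul]
    refine integral_congr_ae (Filter.Eventually.of_forall fun g => ?_)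
    ring

/-- The trace of a finite rank endomorphism `T` of a (possibly infinite-dimensional) vector space:
the trace of the restriction of `T` to its range. -/
def finiteRankTrace {V : Type*} [AddCommGroup V] [Module ℂ V] (T : V →ₗ[ℂ] V) : ℂ :=
  LinearMap.trace ℂ (LinearMap.range T) (T.rangeRestrict ∘ₗ (LinearMap.range T).subtype)

/-- The Satake transform `f^∨(π) = tr π(f)` of `f ∈ C_c(K\G/K)` at `π = I_G(ζ,ζ')`. The operator
`π(f)` has finite rank, as its image consists of right `K`-invariant functions. -/
def satake {F : Type*} [NontriviallyNormedField F] [IsUltrametricDist F]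
    (μ : Measure (SO32 F)) [μ.IsHaarMeasure] (ζ ζ' : ℂ) (f : sphericalHecke F) : ℂ :=
  finiteRankTrace (heckeOp μ ζ ζ' f)

/-! ### The sphere `S` -/

/-- The bilinear form `Q(v,w) = ᵗv J w`. -/
def Q {F : Type*} [NontriviallyNormedField F] (v w : Fin 5 → F) : F := v ⬝ᵥ (J F *ᵥ w)

lemma Q_self {F : Type*} [NontriviallyNormedField F] (v : Fin 5 → F) :
    Q v v = 2 * v 0 * v 4 + 2 * v 1 * v 3 + v 2 ^ 2 := by
  have h : ∀ i, (J F *ᵥ v) i = v i.rev := by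
    intro i
    simp [Matrix.mulVec, dotProduct, J]
  simp only [Q, dotProduct, h, Fin.sum_univ_five]
  change v 0 * v 4 + v 1 * v 3 + v 2 * v 2 + v 3 * v 1 + v 4 * v 0 = _
  ring

/-- The two cases: split, and non-split with parameter a non-square unit `θ`. -/
inductive QuadricCase (F : Type*) [NontriviallyNormedField F] : Type _
  | split : QuadricCase F
  | nonsplit (θ : F) (norm_eq_one : ‖θ‖ = 1) (not_isSquare : ¬ IsSquare θ) : QuadricCase F

/-- The value of the quadratic form on `S`: `1` in the split case, `4θ` in the non-split case. -/
def QuadricCase.value {F : Type*} [NontriviallyNormedField F] : QuadricCase F → F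
  | .split => 1
  | .nonsplit θ _ _ => 4 * θ

/-- The sign in the formula (`-1` in the split case, `+1` in the non-split case). -/
def QuadricCase.sign {F : Type*} [NontriviallyNormedField F] : QuadricCase F → ℂ
  | .split => -1
  | .nonsplit _ _ _ => 1

/-- The sphere `S = {v ∈ F⁵ | Q(v,v) = 1}` (split case), `{v ∈ F⁵ | Q(v,v) = 4θ}` (non-split case),
which is identified with `G/C_θ`. -/
def Sphere {F : Type*} [NontriviallyNormedField F] (c : QuadricCase F) : Type _ :=
  {v : Fin 5 → F // Q v v = c.value}

lemma Q_mulVec {F : Type*} [NontriviallyNormedField F] (g : SO32 F) (v w : Fin 5 → F) :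
    Q (g.1.1 *ᵥ v) (g.1.1 *ᵥ w) = Q v w := by
  have hg : (g.1.1)ᵀ * J F * g.1.1 = J F := g.2
  generalize g.1.1 = A at hg
  unfold Q
  rw [← Matrix.vecMul_transpose, ← Matrix.dotProduct_mulVec, Matrix.mulVec_mulVec,
    Matrix.mulVec_mulVec, hg]

/-- `G` acts on `S` by matrix multiplication on columns. -/
instance {F : Type*} [NontriviallyNormedField F] (c : QuadricCase F) :
    MulAction (SO32 F) (Sphere c) where
  smul g s := ⟨g.1.1 *ᵥ s.1, (Q_mulVec g s.1 s.1).trans s.2⟩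
  one_smul s := Subtype.ext (Matrix.one_mulVec s.1)
  mul_smul g h s := Subtype.ext (Matrix.mulVec_mulVec s.1 g.1.1 h.1.1).symm

lemma two_ne_zero_of_ringChar {F : Type*} [NontriviallyNormedField F] [IsUltrametricDist F]
    (h2 : ringChar 𝓀[F] ≠ 2) : (2 : F) ≠ 0 := by
  intro h
  have h' : (2 : 𝒪[F]) = 0 := Subtype.ext h
  have h'' : (2 : 𝓀[F]) = 0 := by
    have := congrArg (IsLocalRing.residue 𝒪[F]) h'
    rwa [map_ofNat, map_zero] at this
  exact Ring.two_ne_zero h2 h''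

/-- The base point `v₁` of `S`: `ᵗ(1/2,0,0,0,1)` in the split case and `ᵗ(2θ,0,0,1,1)` in the
non-split case. -/
def basePoint {F : Type*} [NontriviallyNormedField F] [IsUltrametricDist F]
    (h2 : ringChar 𝓀[F] ≠ 2) : (c : QuadricCase F) → Sphere c
  | .split => ⟨![1 / 2, 0, 0, 0, 1], by
      have := two_ne_zero_of_ringChar h2
      rw [Q_self]
      simp [QuadricCase.value, this]⟩
  | .nonsplit θ _ _ => ⟨![2 * θ, 0, 0, 1, 1], by
      rw [Q_self]
      simp [QuadricCase.value]
      ring⟩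

/-- `T` is a `K`-invariant function on `S` with `T(v₁) = 1` such that, for every spherical function
`f` and every `s ∈ S`, `∫_G f(g) T(gs) dg = f^∨(π_ζ) T(s)`, where `π_ζ = I_G(ζ, 1/2 + ζ)`.
(The integrand is locally constant with compact support in `g`.) -/
structure IsNormalizedEigenfunction {F : Type*} [NontriviallyNormedField F] [IsUltrametricDist F]
    (h2 : ringChar 𝓀[F] ≠ 2) (μ : Measure (SO32 F)) [μ.IsHaarMeasure] (c : QuadricCase F) (ζ : ℂ)
    (T : Sphere c → ℂ) : Prop where
  invariant : ∀ k ∈ K F, ∀ s, T (k • s) = T s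
  normalized : T (basePoint h2 c) = 1
  eigen : ∀ (f : sphericalHecke F) (s : Sphere c),
    ∫ g, f.1 g * T (g • s) ∂μ = satake μ ζ (1 / 2 + ζ) f * T s

/-- The summand of the explicit formula, as a function of `ξ`:
`(q^{3/2+ξ} - 1)(1 + ε q^{-1/2-ξ}) / ((q^ξ - q^{-ξ})(q^{3/2} + ε q^{-1/2})) · q^{-r(3/2-ξ)}`,
where `ε` is the sign (`-1` split, `+1` non-split). -/
def term (q : ℕ) (ε ξ : ℂ) (r : ℕ) : ℂ :=
  (((q : ℂ) ^ (3 / 2 + ξ) - 1) * (1 + ε * (q : ℂ) ^ (-1 / 2 - ξ))) /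
    (((q : ℂ) ^ ξ - (q : ℂ) ^ (-ξ)) * ((q : ℂ) ^ (3 / 2 : ℂ) + ε * (q : ℂ) ^ (-1 / 2 : ℂ))) *
    (q : ℂ) ^ (-(r : ℂ) * (3 / 2 - ξ))

end

end SO5

/-! The Satake transform at `π_ζ` reduces to an integral involving only the last row of `g`, and a
single Hecke operator already determines a radial function. The theorem follows from these two facts
and a density argument.

Satake side. By the Iwasawa decomposition (`exists_iwasawa`) the `K`-fixed line of `π_ζ` is spanned
by `phiB`, and the trace is the integral of `f` against it (`satake_eq`). Since `ζ' = 1/2 + ζ`, the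
inducing factor depends on `β` only through `|β|`. Along the middle `SO(2,1)`, `phiB` is then a
multiple of `wedgeNorm⁻¹`, which is harmonic on the tree of that group. Radial harmonic functions on
a tree are constant, so averaging over the compact group `KM` replaces `wedgeNorm⁻¹` by `rowNorm⁻¹`
(`rowNorm_mul_middleAverage`). Hence `f^∨(π_ζ)` is the integral of `f` against `rowNorm ^ (-(3/2 +
ζ))` (`satake_eq_integral_phiP`), as if `π_ζ` were induced from a character of the stabilizer of an
isotropic line.

Uniqueness and values. The `K`-orbits on `S` are separated by the norm and represented by the `d_r
v₁`. Applying the operator of `K d_1 K` at such a point averages over the reductions of the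
`K`-translates of a primitive vector, and these are equidistributed on a quadric over the residue
field. Counting points gives a three-term recurrence with nonvanishing leading coefficients, so an
eigenfunction has the values `radial`. The sign of the case enters only at `r = 0`, through the
number of square roots of the value of the form. The two summands of the formula are geometric
sequences whose ratios are the characteristic roots of the recurrence (`term_add_term_eq_radial`);
the exceptional `ζ` follow by continuity of `radial` in `ζ`.

Existence. For `ζ = -3/2 - m` with `m` a natural number, the `K`-average of the `m`-th power of the
absolute value of the last coordinate is an eigenfunction of the whole Hecke algebra
(`integral_mul_poisson`), and by the previous step its normalization is `radial`. For fixed `f` and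
`s`, both sides of the eigenvalue equation for `radial` are Laurent polynomials in `q^ζ`. They agree
at infinitely many values of `q^ζ`, hence for every `ζ` (`exists_isNormalizedEigenfunction`). -/

namespace SO5

noncomputable section

/-! ### Norms and residues -/

section Residue

variable {F : Type*} [NontriviallyNormedField F] [IsUltrametricDist F]

lemma mem_integers_iff {a : F} : a ∈ 𝒪[F] ↔ ‖a‖ ≤ 1 := Valued.integer.mem_iff

/-- The reduction of an integral element of `F` modulo the maximal ideal (`0` on other elements). -/
def res (a : F) : 𝓀[F] :=
  open scoped Classical in if h : a ∈ 𝒪[F] then IsLocalRing.residue 𝒪[F] ⟨a, h⟩ else 0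

lemma res_of_mem {a : F} (h : a ∈ 𝒪[F]) : res a = IsLocalRing.residue 𝒪[F] ⟨a, h⟩ := dif_pos h

lemma res_coe (a : 𝒪[F]) : res (a : F) = IsLocalRing.residue 𝒪[F] a := res_of_mem a.2

lemma res_eq_zero_iff {a : F} (ha : ‖a‖ ≤ 1) : res a = 0 ↔ ‖a‖ < 1 := by
  rw [res_of_mem (mem_integers_iff.2 ha), IsLocalRing.residue_eq_zero_iff,
    IsLocalRing.mem_maximalIdeal, mem_nonunits_iff, Valued.integer.isUnit_iff_norm_eq_one]
  exact ⟨fun h => lt_of_le_of_ne ha h, fun h => h.ne⟩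

lemma res_ne_zero_iff {a : F} (ha : ‖a‖ ≤ 1) : res a ≠ 0 ↔ ‖a‖ = 1 := by
  rw [Ne, res_eq_zero_iff ha, not_lt]
  exact ⟨fun h => le_antisymm ha h, fun h => h.ge⟩

lemma res_add {a b : F} (ha : ‖a‖ ≤ 1) (hb : ‖b‖ ≤ 1) : res (a + b) = res a + res b := by
  lift a to 𝒪[F] using mem_integers_iff.2 ha
  lift b to 𝒪[F] using mem_integers_iff.2 hb
  have : (a : F) + b = ((a + b : 𝒪[F]) : F) := rfl
  rw [this, res_coe, res_coe, res_coe, map_add]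

lemma res_mul {a b : F} (ha : ‖a‖ ≤ 1) (hb : ‖b‖ ≤ 1) : res (a * b) = res a * res b := by
  lift a to 𝒪[F] using mem_integers_iff.2 ha
  lift b to 𝒪[F] using mem_integers_iff.2 hb
  have : (a : F) * b = ((a * b : 𝒪[F]) : F) := rfl
  rw [this, res_coe, res_coe, res_coe, map_mul]

lemma res_zero : res (0 : F) = 0 := by
  rw [res_eq_zero_iff (by simp)]; simp

lemma res_one : res (1 : F) = 1 := by
  have : (1 : F) = ((1 : 𝒪[F]) : F) := rfl
  rw [this, res_coe, map_one]

lemma res_neg {a : F} (ha : ‖a‖ ≤ 1) : res (-a) = -res a := by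
  have h := res_add ha (b := -a) (by rwa [norm_neg])
  rw [add_neg_cancel, res_zero] at h
  exact (neg_eq_of_add_eq_zero_right h.symm).symm

lemma res_sub {a b : F} (ha : ‖a‖ ≤ 1) (hb : ‖b‖ ≤ 1) : res (a - b) = res a - res b := by
  rw [sub_eq_add_neg, res_add ha (by rwa [norm_neg]), res_neg hb, sub_eq_add_neg]

lemma norm_two_le_one : ‖(2 : F)‖ ≤ 1 := by
  have := IsUltrametricDist.norm_natCast_le_one F 2
  simpa using this

lemma res_two : res (2 : F) = 2 := by
  have : (2 : F) = 1 + 1 := by norm_num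
  rw [this, res_add (by simp) (by simp), res_one]; norm_num

lemma exists_res_eq (x : 𝓀[F]) : ∃ a : F, ‖a‖ ≤ 1 ∧ res a = x := by
  obtain ⟨a, rfl⟩ := IsLocalRing.residue_surjective x
  exact ⟨a, mem_integers_iff.1 a.2, res_coe a⟩

lemma norm_sum_le_of_forall {ι : Type*} (s : Finset ι) (f : ι → F) {C : ℝ} (hC : 0 ≤ C)
    (h : ∀ i ∈ s, ‖f i‖ ≤ C) : ‖∑ i ∈ s, f i‖ ≤ C :=
  IsUltrametricDist.norm_sum_le_of_forall_le_of_nonneg hC h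

lemma norm_add_le_of {a b : F} {C : ℝ} (ha : ‖a‖ ≤ C) (hb : ‖b‖ ≤ C) : ‖a + b‖ ≤ C :=
  (IsUltrametricDist.norm_add_le_max a b).trans (max_le ha hb)

lemma norm_sub_le_of {a b : F} {C : ℝ} (ha : ‖a‖ ≤ C) (hb : ‖b‖ ≤ C) : ‖a - b‖ ≤ C := by
  rw [sub_eq_add_neg]; exact norm_add_le_of ha (by rwa [norm_neg])

lemma norm_add_lt_of {a b : F} {C : ℝ} (ha : ‖a‖ < C) (hb : ‖b‖ < C) : ‖a + b‖ < C :=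
  (IsUltrametricDist.norm_add_le_max a b).trans_lt (max_lt ha hb)

lemma res_sum {ι : Type*} (s : Finset ι) (f : ι → F) (h : ∀ i ∈ s, ‖f i‖ ≤ 1) :
    res (∑ i ∈ s, f i) = ∑ i ∈ s, res (f i) := by
  classical
  induction s using Finset.induction_on with
  | empty => simp [res_zero]
  | insert a s ha ih =>
    rw [Finset.sum_insert ha, Finset.sum_insert ha, res_add (h a (by simp)), ih]
    · exact fun i hi => h i (by simp [hi])
    · exact norm_sum_le_of_forall _ _ zero_le_one fun i hi => h i (by simp [hi])

lemma norm_two_eq_one (h2 : ringChar 𝓀[F] ≠ 2) : ‖(2 : F)‖ = 1 := by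
  rw [← res_ne_zero_iff norm_two_le_one, res_two]
  exact Ring.two_ne_zero h2

lemma norm_half_eq_one (h2 : ringChar 𝓀[F] ≠ 2) : ‖(1 / 2 : F)‖ = 1 := by
  rw [norm_div, norm_one, norm_two_eq_one h2, div_one]

/-- Discreteness of the norm: an element of the maximal ideal is an integral multiple of `ϖ`, so no
norm lies strictly between `‖ϖ‖` and `1`. -/
lemma norm_le_of_lt_one {ϖ : Fˣ} (hϖ : IsUniformizer ϖ) {x : F} (hx : ‖x‖ < 1) :
    ‖x‖ ≤ ‖(ϖ : F)‖ := by
  obtain ⟨p, hp, hm⟩ := hϖ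
  have hx' : (⟨x, mem_integers_iff.2 hx.le⟩ : 𝒪[F]) ∈ 𝓂[F] := by
    rw [← IsLocalRing.residue_eq_zero_iff, ← res_of_mem, res_eq_zero_iff hx.le]
    exact hx
  rw [hm, Ideal.mem_span_singleton] at hx'
  obtain ⟨c, hc⟩ := hx'
  have hc' : x = p * c := congrArg Subtype.val hc
  rw [hc', norm_mul, hp]
  exact mul_le_of_le_one_right (norm_nonneg _) (mem_integers_iff.1 c.2)

/-- `Nat.card` of an infinite type is `0`, and then the normalization would read `‖ϖ‖ = 0⁻¹ = 0`. -/
lemma finite_residueField (ϖ : Fˣ) (hnorm : ‖(ϖ : F)‖ = (q F : ℝ)⁻¹) : Finite 𝓀[F] := by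
  apply Nat.finite_of_card_ne_zero
  intro h
  have : q F = 0 := h
  rw [this] at hnorm
  simp at hnorm

lemma one_lt_q (ϖ : Fˣ) (hnorm : ‖(ϖ : F)‖ = (q F : ℝ)⁻¹) : 1 < q F := by
  have := finite_residueField ϖ hnorm
  exact Finite.one_lt_card

/-- Every nonzero element of `F` has norm an integral power of `q`. -/
lemma exists_norm_eq_zpow {ϖ : Fˣ} (hϖ : IsUniformizer ϖ) (hnorm : ‖(ϖ : F)‖ = (q F : ℝ)⁻¹)
    {x : F} (hx : x ≠ 0) : ∃ n : ℤ, ‖x‖ = (q F : ℝ) ^ n := by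
  have hq : (1 : ℝ) < q F := by exact_mod_cast one_lt_q ϖ hnorm
  have hq0 : (0 : ℝ) < q F := by linarith
  -- If `‖x‖` lay strictly between `q^n` and `q^(n+1)`, then `ϖ^(n+1) x` would have norm strictly
  -- between `q⁻¹` and `1`, in the gap excluded by `norm_le_of_lt_one`.
  obtain ⟨n, hn1, hn2⟩ := exists_mem_Ioc_zpow (norm_pos_iff.2 hx) hq
  refine ⟨n + 1, le_antisymm hn2 ?_⟩
  by_contra hlt
  push Not at hlt
  have hy : ‖(ϖ : F) ^ (n + 1) * x‖ = (q F : ℝ) ^ (-(n + 1)) * ‖x‖ := by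
    rw [norm_mul, norm_zpow, hnorm, inv_zpow, zpow_neg]
  have h1 : ‖(ϖ : F) ^ (n + 1) * x‖ < 1 := by
    rw [hy, zpow_neg, inv_mul_lt_iff₀ (zpow_pos hq0 _), mul_one]; exact hlt
  have h3 := norm_le_of_lt_one hϖ h1
  rw [hy, hnorm, zpow_neg, inv_mul_le_iff₀ (zpow_pos hq0 _), zpow_add_one₀ hq0.ne',
    mul_assoc, mul_inv_cancel₀ hq0.ne', mul_one] at h3
  linarith

end Residue

/-! ### Vectors -/

section Vectors

variable {F : Type*} [NontriviallyNormedField F]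

/-- The action of `G` on column vectors. -/
def mv (g : SO32 F) (v : Fin 5 → F) : Fin 5 → F := g.1.1 *ᵥ v

lemma mv_apply (g : SO32 F) (v : Fin 5 → F) (i : Fin 5) : mv g v i = ∑ j, entry g i j * v j := rfl

lemma mv_mul (g h : SO32 F) (v : Fin 5 → F) : mv (g * h) v = mv g (mv h v) :=
  (Matrix.mulVec_mulVec v g.1.1 h.1.1).symm

lemma mv_one (v : Fin 5 → F) : mv 1 v = v := Matrix.one_mulVec v

lemma mv_smul (g : SO32 F) (a : F) (v : Fin 5 → F) : mv g (a • v) = a • mv g v :=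
  Matrix.mulVec_smul _ _ _

lemma mv_inv_mv (g : SO32 F) (v : Fin 5 → F) : mv g⁻¹ (mv g v) = v := by
  rw [← mv_mul, inv_mul_cancel, mv_one]

lemma mv_mv_inv (g : SO32 F) (v : Fin 5 → F) : mv g (mv g⁻¹ v) = v := by
  rw [← mv_mul, mul_inv_cancel, mv_one]

lemma Q_mv (g : SO32 F) (v : Fin 5 → F) : Q (mv g v) (mv g v) = Q v v := Q_mulVec g v v

lemma smul_val {c : QuadricCase F} (g : SO32 F) (s : Sphere c) : (g • s).1 = mv g s.1 := rfl

lemma Q_smul (a : F) (v : Fin 5 → F) : Q (a • v) (a • v) = a ^ 2 * Q v v := by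
  simp only [Q_self, Pi.smul_apply, smul_eq_mul]; ring

lemma mv_torus (α β : Fˣ) (v : Fin 5 → F) :
    mv (torus α β) v = ![α * v 0, β * v 1, v 2, (β : F)⁻¹ * v 3, (α : F)⁻¹ * v 4] := by
  ext i
  rw [mv_apply]
  fin_cases i <;> simp [entry, torus, Matrix.diagonal]

lemma entry_torus (α β : Fˣ) (i j : Fin 5) : entry (torus α β) i j =
    if i = j then ![(α : F), β, 1, (β : F)⁻¹, (α : F)⁻¹] i else 0 := by
  change Matrix.diagonal _ i j = _
  rw [Matrix.diagonal_apply]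

variable [IsUltrametricDist F]

lemma norm_entry_le {k : SO32 F} (hk : k ∈ K F) (i j : Fin 5) : ‖entry k i j‖ ≤ 1 :=
  mem_integers_iff.1 (hk i j)

lemma mem_K_iff {k : SO32 F} : k ∈ K F ↔ ∀ i j, ‖entry k i j‖ ≤ 1 :=
  ⟨fun h => norm_entry_le h, fun h i j => mem_integers_iff.2 (h i j)⟩

lemma norm_mv_le {k : SO32 F} (hk : k ∈ K F) (v : Fin 5 → F) : ‖mv k v‖ ≤ ‖v‖ := by
  rw [pi_norm_le_iff_of_nonneg (norm_nonneg _)]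
  intro i
  rw [mv_apply]
  refine norm_sum_le_of_forall _ _ (norm_nonneg _) fun j _ => ?_
  rw [norm_mul]
  exact (mul_le_of_le_one_left (norm_nonneg _) (norm_entry_le hk i j)).trans (norm_le_pi_norm v j)

lemma norm_mv {k : SO32 F} (hk : k ∈ K F) (v : Fin 5 → F) : ‖mv k v‖ = ‖v‖ := by
  refine le_antisymm (norm_mv_le hk v) ?_
  have := norm_mv_le (inv_mem hk) (mv k v)
  rwa [mv_inv_mv] at this

lemma norm_Q_le (v : Fin 5 → F) {C : ℝ} (hC : ∀ i, ‖v i‖ ≤ C) : ‖Q v v‖ ≤ C ^ 2 := by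
  have hC0 : 0 ≤ C := (norm_nonneg _).trans (hC 0)
  have key : ∀ i j, ‖v i * v j‖ ≤ C ^ 2 := fun i j => by
    rw [norm_mul, sq]; exact mul_le_mul (hC i) (hC j) (norm_nonneg _) hC0
  have h2 : ∀ i j, ‖2 * v i * v j‖ ≤ C ^ 2 := fun i j => by
    rw [mul_assoc, norm_mul]
    exact (mul_le_of_le_one_left (norm_nonneg _) norm_two_le_one).trans (key i j)
  rw [Q_self]
  refine norm_add_le_of (norm_add_le_of (h2 _ _) (h2 _ _)) ?_
  rw [sq]; exact key 2 2

lemma exists_norm_eq (v : Fin 5 → F) : ∃ i, ‖v i‖ = ‖v‖ :=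
  (IsGreatest.pi_norm v).1

end Vectors

end

end SO5

namespace SO5

noncomputable section

/-! ### Some elements of `G` -/

section Elements

variable {F : Type*} [NontriviallyNormedField F]

/-- The unipotent radical of the stabilizer of the isotropic line through the first basis vector. -/
def nU (a b c : F) : SO32 F :=
  ⟨⟨!![1, -c, -2 * b, -a, -(a * c + 2 * b ^ 2); 0, 1, 0, 0, a; 0, 0, 1, 0, 2 * b; 0, 0, 0, 1, c;
      0, 0, 0, 0, 1], by
      simp [Matrix.det_succ_row_zero, Fin.sum_univ_succ]⟩, by
    change Matrix.transpose _ * J F * _ = J F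
    ext i j
    rw [Matrix.mul_assoc, Matrix.mul_apply]
    simp only [J_mul_apply, Fin.sum_univ_five]
    fin_cases i <;> fin_cases j <;> simp [J, Fin.rev, Fin.ext_iff, -neg_add_rev]; ring⟩

/-- The unipotent elements of the middle `SO(2,1)`. -/
def nM (x : F) : SO32 F :=
  ⟨⟨!![1, 0, 0, 0, 0; 0, 1, -2 * x, -2 * x ^ 2, 0; 0, 0, 1, 2 * x, 0; 0, 0, 0, 1, 0;
      0, 0, 0, 0, 1], by
      simp [Matrix.det_succ_row_zero, Fin.sum_univ_succ]⟩, by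
    change Matrix.transpose _ * J F * _ = J F
    ext i j
    rw [Matrix.mul_assoc, Matrix.mul_apply]
    simp only [J_mul_apply, Fin.sum_univ_five]
    fin_cases i <;> fin_cases j <;> simp [J, Fin.rev, Fin.ext_iff, -neg_add_rev]; ring⟩

variable (F) in
/-- The Weyl element exchanging the outer basis vectors. -/
def wU : SO32 F :=
  ⟨⟨!![0, 0, 0, 0, 1; 0, 1, 0, 0, 0; 0, 0, -1, 0, 0; 0, 0, 0, 1, 0; 1, 0, 0, 0, 0], by
      simp [Matrix.det_succ_row_zero, Fin.sum_univ_succ, Fin.succAbove]; norm_num⟩, by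
    change Matrix.transpose _ * J F * _ = J F
    ext i j
    rw [Matrix.mul_assoc, Matrix.mul_apply]
    simp only [J_mul_apply, Fin.sum_univ_five]
    fin_cases i <;> fin_cases j <;> simp [J, Fin.rev, Fin.ext_iff]⟩

variable (F) in
/-- The Weyl element of the middle `SO(2,1)`. -/
def wM : SO32 F :=
  ⟨⟨!![1, 0, 0, 0, 0; 0, 0, 0, 1, 0; 0, 0, -1, 0, 0; 0, 1, 0, 0, 0; 0, 0, 0, 0, 1], by
      simp [Matrix.det_succ_row_zero, Fin.sum_univ_succ, Fin.succAbove]⟩, by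
    change Matrix.transpose _ * J F * _ = J F
    ext i j
    rw [Matrix.mul_assoc, Matrix.mul_apply]
    simp only [J_mul_apply, Fin.sum_univ_five]
    fin_cases i <;> fin_cases j <;> simp [J, Fin.rev, Fin.ext_iff]⟩

variable (F) in
/-- The Weyl element exchanging the first two and the last two basis vectors. -/
def wS : SO32 F :=
  ⟨⟨!![0, 1, 0, 0, 0; 1, 0, 0, 0, 0; 0, 0, 1, 0, 0; 0, 0, 0, 0, 1; 0, 0, 0, 1, 0], by
      simp [Matrix.det_succ_row_zero, Fin.sum_univ_succ, Fin.succAbove]⟩, by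
    change Matrix.transpose _ * J F * _ = J F
    ext i j
    rw [Matrix.mul_assoc, Matrix.mul_apply]
    simp only [J_mul_apply, Fin.sum_univ_five]
    fin_cases i <;> fin_cases j <;> simp [J, Fin.rev, Fin.ext_iff]⟩

lemma mv_nU (a b c : F) (v : Fin 5 → F) : mv (nU a b c) v =
    ![v 0 - c * v 1 - 2 * b * v 2 - a * v 3 - (a * c + 2 * b ^ 2) * v 4, v 1 + a * v 4,
      v 2 + 2 * b * v 4, v 3 + c * v 4, v 4] := by
  ext i
  rw [mv_apply]
  fin_cases i <;> simp [entry, nU, Fin.sum_univ_five]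
  ring

lemma mv_nM (x : F) (v : Fin 5 → F) : mv (nM x) v =
    ![v 0, v 1 - 2 * x * v 2 - 2 * x ^ 2 * v 3, v 2 + 2 * x * v 3, v 3, v 4] := by
  ext i
  rw [mv_apply]
  fin_cases i <;> simp [entry, nM, Fin.sum_univ_five]
  ring

lemma mv_wU (v : Fin 5 → F) : mv (wU F) v = ![v 4, v 1, -v 2, v 3, v 0] := by
  ext i
  rw [mv_apply]
  fin_cases i <;> simp [entry, wU, Fin.sum_univ_five]

lemma mv_wM (v : Fin 5 → F) : mv (wM F) v = ![v 0, v 3, -v 2, v 1, v 4] := by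
  ext i
  rw [mv_apply]
  fin_cases i <;> simp [entry, wM, Fin.sum_univ_five]

lemma mv_wS (v : Fin 5 → F) : mv (wS F) v = ![v 1, v 0, v 2, v 4, v 3] := by
  ext i
  rw [mv_apply]
  fin_cases i <;> simp [entry, wS, Fin.sum_univ_five]

lemma ext_mv {g h : SO32 F} (H : ∀ v, mv g v = mv h v) : g = h := by
  apply Subtype.ext
  apply Subtype.ext
  exact Matrix.mulVec_injective (funext H)

lemma mv_single (g : SO32 F) (i j : Fin 5) : mv g (Pi.single j 1) i = entry g i j := by
  rw [mv_apply, Finset.sum_eq_single j]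
  · simp
  · intro b _ hb; simp [hb]
  · simp

variable [IsUltrametricDist F]

lemma wU_mem : wU F ∈ K F := by
  rw [mem_K_iff]
  intro i j
  fin_cases i <;> fin_cases j <;> simp [entry, wU]

lemma wM_mem : wM F ∈ K F := by
  rw [mem_K_iff]
  intro i j
  fin_cases i <;> fin_cases j <;> simp [entry, wM]

lemma wS_mem : wS F ∈ K F := by
  rw [mem_K_iff]
  intro i j
  fin_cases i <;> fin_cases j <;> simp [entry, wS]

lemma norm_mul_le_one {a b : F} (ha : ‖a‖ ≤ 1) (hb : ‖b‖ ≤ 1) : ‖a * b‖ ≤ 1 := by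
  rw [norm_mul]; exact mul_le_one₀ ha (norm_nonneg _) hb

lemma norm_sq_le_one {a : F} (ha : ‖a‖ ≤ 1) : ‖a ^ 2‖ ≤ 1 := by
  rw [sq]; exact norm_mul_le_one ha ha

lemma nU_mem {a b c : F} (ha : ‖a‖ ≤ 1) (hb : ‖b‖ ≤ 1) (hc : ‖c‖ ≤ 1) : nU a b c ∈ K F := by
  have h2 := norm_mul_le_one norm_two_le_one hb
  have h3 : ‖a * c + 2 * b ^ 2‖ ≤ 1 :=
    norm_add_le_of (norm_mul_le_one ha hc) (norm_mul_le_one norm_two_le_one (norm_sq_le_one hb))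
  rw [norm_mul] at h2
  rw [mem_K_iff]
  intro i j
  fin_cases i <;> fin_cases j <;> simp [entry, nU, ha, hc, h2, -neg_add_rev]
  exact h3

lemma nM_mem {x : F} (hx : ‖x‖ ≤ 1) : nM x ∈ K F := by
  have h2 := norm_mul_le_one norm_two_le_one hx
  have h3 := norm_mul_le_one norm_two_le_one (norm_sq_le_one hx)
  rw [norm_mul] at h2 h3
  rw [norm_pow] at h3
  rw [mem_K_iff]
  intro i j
  fin_cases i <;> fin_cases j <;> simp [entry, nM, h2, h3]

lemma torus_mem {α β : Fˣ} (hα : ‖(α : F)‖ = 1) (hβ : ‖(β : F)‖ = 1) : torus α β ∈ K F := by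
  rw [mem_K_iff]
  intro i j
  rw [entry_torus]
  split_ifs
  · fin_cases i <;> simp [hα, hβ]
  · simp

/-! ### Orbits of `K` on primitive vectors -/

/-- With a unit in the last place, an integral `nU` clears the three middle coordinates and a unit
torus element scales the last one to `1`. The first coordinate is then forced by invariance of `Q`.
-/
lemma exists_mv_eq_of_norm_last (h2 : ringChar 𝓀[F] ≠ 2) {v : Fin 5 → F} (hv : ‖v‖ = 1)
    (h4 : ‖v 4‖ = 1) : ∃ k ∈ K F, mv k v = ![Q v v / 2, 0, 0, 0, 1] := by
  have h40 : v 4 ≠ 0 := by rw [← norm_pos_iff, h4]; exact one_pos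
  have h20 := two_ne_zero_of_ringChar h2
  have hle : ∀ i, ‖v i‖ ≤ 1 := fun i => hv ▸ norm_le_pi_norm v i
  have hle' : ∀ i, ‖-v i / v 4‖ ≤ 1 := fun i => by rw [norm_div, h4, div_one, norm_neg]; exact hle i
  set k := torus (Units.mk0 _ h40) 1 * nU (-v 1 / v 4) (-v 2 / v 4 / 2) (-v 3 / v 4)
  have hk : k ∈ K F := by
    refine mul_mem (torus_mem h4 (by simp)) (nU_mem (hle' 1) ?_ (hle' 3))
    rw [norm_div, norm_two_eq_one h2, div_one]; exact hle' 2
  have hkv : ∀ i, i ≠ 0 → mv k v i = (![0, 0, 0, 0, 1] : Fin 5 → F) i := by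
    intro i hi
    rw [mv_mul, mv_torus, mv_nU]
    fin_cases i
    · exact absurd rfl hi
    all_goals simp
    all_goals field_simp
    all_goals simp
  have hQ := Q_mv k v
  rw [Q_self, hkv 1 (by decide), hkv 2 (by decide), hkv 3 (by decide), hkv 4 (by decide)] at hQ
  refine ⟨k, hk, funext fun i => ?_⟩
  by_cases hi : i = 0
  · subst hi
    rw [← hQ]
    simp
    field_simp
  · rw [hkv i hi]
    fin_cases i
    · exact absurd rfl hi
    all_goals rfl

/-- Every primitive vector `v` is equivalent under `K` to `ᵗ(Q(v,v)/2, 0, 0, 0, 1)`. -/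
lemma exists_mv_eq_normalForm (h2 : ringChar 𝓀[F] ≠ 2) {v : Fin 5 → F} (hv : ‖v‖ = 1) :
    ∃ k ∈ K F, mv k v = ![Q v v / 2, 0, 0, 0, 1] := by
  -- The normal form depends only on `Q`, so the vector may first be moved by any element of `K`.
  -- Weyl elements bring a unit coordinate other than the middle one to the last place.
  have red : ∀ (w : Fin 5 → F), ‖w‖ = 1 → ∀ κ ∈ K F, (‖mv κ w‖ = 1 →
      ∃ k ∈ K F, mv k (mv κ w) = ![Q (mv κ w) (mv κ w) / 2, 0, 0, 0, 1]) →
      ∃ k ∈ K F, mv k w = ![Q w w / 2, 0, 0, 0, 1] := by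
    intro w hw κ hκ h
    obtain ⟨k, hk, e⟩ := h (by rw [norm_mv hκ, hw])
    refine ⟨k * κ, mul_mem hk hκ, ?_⟩
    rw [mv_mul, e, Q_mv]
  have h4 : ∀ w : Fin 5 → F, ‖w‖ = 1 → ‖w 4‖ = 1 →
    ∃ k ∈ K F, mv k w = ![Q w w / 2, 0, 0, 0, 1] := fun w hw => exists_mv_eq_of_norm_last h2 hw
  have h0 : ∀ w : Fin 5 → F, ‖w‖ = 1 → ‖w 0‖ = 1 →
      ∃ k ∈ K F, mv k w = ![Q w w / 2, 0, 0, 0, 1] := fun w hw hw0 =>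
    red w hw _ wU_mem fun h => h4 _ h (by rw [mv_wU]; exact hw0)
  have h3 : ∀ w : Fin 5 → F, ‖w‖ = 1 → ‖w 3‖ = 1 →
      ∃ k ∈ K F, mv k w = ![Q w w / 2, 0, 0, 0, 1] := fun w hw hw0 =>
    red w hw _ wS_mem fun h => h4 _ h (by rw [mv_wS]; exact hw0)
  have h1 : ∀ w : Fin 5 → F, ‖w‖ = 1 → ‖w 1‖ = 1 →
      ∃ k ∈ K F, mv k w = ![Q w w / 2, 0, 0, 0, 1] := fun w hw hw0 =>
    red w hw _ wM_mem fun h => h3 _ h (by rw [mv_wM]; exact hw0)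
  have hle : ∀ i, ‖v i‖ ≤ 1 := fun i => hv ▸ norm_le_pi_norm v i
  by_cases hv0 : ‖v 0‖ = 1
  · exact h0 v hv hv0
  by_cases hv4 : ‖v 4‖ = 1
  · exact h4 v hv hv4
  obtain ⟨i, hi⟩ := exists_norm_eq v
  rw [hv] at hi
  fin_cases i
  · exact h0 v hv hi
  · exact h1 v hv hi
  -- Here `v 0` and `v 4` are not units. The new first coordinate is `v 0 - 2 * v 4 - 2 * v 2`, a
  -- unit because `2` and `v 2` are units.
  · refine red v hv (nU 0 1 0) (nU_mem (by simp) (by simp) (by simp)) fun h => h0 _ h ?_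
    have hi' : ‖v 2‖ = 1 := hi
    have hv0' := lt_of_le_of_ne (hle 0) hv0
    have hv4' := lt_of_le_of_ne (hle 4) hv4
    rw [mv_nU]
    have e : v 0 - 0 * v 1 - 2 * 1 * v 2 - 0 * v 3 - (0 * 0 + 2 * 1 ^ 2) * v 4 =
      (v 0 + (-2) * v 4) + (-2) * v 2 := by ring
    change ‖v 0 - 0 * v 1 - 2 * 1 * v 2 - 0 * v 3 - (0 * 0 + 2 * 1 ^ 2) * v 4‖ = 1
    have e1 : ‖(-2) * v 2‖ = 1 := by rw [norm_mul, norm_neg, norm_two_eq_one h2, hi', one_mul]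
    have e2 : ‖v 0 + (-2) * v 4‖ < 1 := by
      refine norm_add_lt_of hv0' ?_
      rwa [norm_mul, norm_neg, norm_two_eq_one h2, one_mul]
    rw [e, IsUltrametricDist.norm_add_eq_max_of_norm_ne_norm (by rw [e1]; exact e2.ne), e1]
    exact max_eq_right e2.le
  · exact h3 v hv hi
  · exact h4 v hv hi

end Elements

end

end SO5

namespace SO5

/-! ### The Iwasawa decomposition -/

section Iwasawa

variable {F : Type*} [NontriviallyNormedField F]

/-- The condition of being upper triangular. -/
def IsUpper (g : SO32 F) : Prop := ∀ i j, j < i → entry g i j = 0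

lemma IsUpper.inv {g : SO32 F} (h : IsUpper g) : IsUpper g⁻¹ := fun i j hij => by
  rw [entry_inv]; exact h _ _ (Fin.rev_lt_rev.2 hij)

/-- The relation `h⁻¹ * h = 1`, in which `entry_inv` turns the entries of `h⁻¹` into entries of `h`.
-/
lemma orthogonality (h : SO32 F) (i j : Fin 5) :
    ∑ k, entry h k.rev i.rev * entry h k j = if i = j then 1 else 0 := by
  rw [← entry_one, ← inv_mul_cancel h, entry_mul]
  simp only [entry_inv]

lemma orthogonality_zero {h : SO32 F} (h0 : ∀ i, i ≠ 0 → entry h i 0 = 0) (i : Fin 5) :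
    entry h 4 i.rev * entry h 0 0 = if i = 0 then 1 else 0 := by
  rw [← orthogonality h, Fin.sum_univ_five, h0 1 (by decide), h0 2 (by decide), h0 3 (by decide),
    h0 4 (by decide)]
  simp

/-- The first column has a single nonzero entry, so pairing it with the other columns under `J`
leaves one term, which contains an entry of the last row. -/
lemma entry_four_eq_zero {h : SO32 F} (h0 : ∀ i, i ≠ 0 → entry h i 0 = 0) {i : Fin 5}
    (hi : i ≠ 4) : entry h 4 i = 0 := by
  have e0 := orthogonality_zero h0 0
  have e := orthogonality_zero h0 i.rev
  have hi' : i.rev ≠ 0 := by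
    intro hh; apply hi; rw [← Fin.rev_rev i, hh]; rfl
  rw [if_neg hi', Fin.rev_rev] at e
  refine (mul_eq_zero.1 e).resolve_right fun hh => ?_
  rw [hh] at e0
  simp at e0

lemma orthogonality_one {h : SO32 F} (h0 : ∀ i, i ≠ 0 → entry h i 0 = 0) {i : Fin 5} (hi : i ≠ 0) :
    entry h 3 i.rev * entry h 1 1 + entry h 2 i.rev * entry h 2 1 + entry h 1 i.rev * entry h 3 1 =
      if i = 1 then 1 else 0 := by
  rw [← orthogonality h, Fin.sum_univ_five]
  have h1 : entry h 4 i.rev = 0 := entry_four_eq_zero h0 (by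
    intro hh; apply hi; rw [← Fin.rev_rev i, hh]; rfl)
  have h2 : entry h 4 1 = 0 := entry_four_eq_zero h0 (by decide)
  change _ = entry h 4 i.rev * entry h 0 1 + entry h 3 i.rev * entry h 1 1 +
    entry h 2 i.rev * entry h 2 1 + entry h 1 i.rev * entry h 3 1 + entry h 0 i.rev * entry h 4 1
  rw [h1, h2]; ring

/-- An isometry preserving the isotropic flag spanned by the first one and first two basis vectors
also preserves the orthogonal complements, hence the full standard flag. -/
lemma isUpper_of_columns {h : SO32 F} (h0 : ∀ i, i ≠ 0 → entry h i 0 = 0)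
    (h21 : entry h 2 1 = 0) (h31 : entry h 3 1 = 0) : IsUpper h := by
  have e1 := orthogonality_one h0 (i := 1) (by decide)
  have e2 := orthogonality_one h0 (i := 2) (by decide)
  rw [h21, h31] at e1 e2
  have h11 : entry h 1 1 ≠ 0 := by
    intro hh; rw [hh] at e1; simp at e1
  have h32 : entry h 3 2 = 0 := by
    simpa [h11] using e2
  intro i j hij
  fin_cases i <;> fin_cases j <;> first
    | exact absurd hij (by decide)
    | exact h0 _ (by decide)
    | exact entry_four_eq_zero h0 (by decide)
    | assumption

/-- Orthogonality makes opposite diagonal entries reciprocal. It would leave a sign for the middle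
entry, which is fixed by the determinant. -/
lemma IsUpper.diag {h : SO32 F} (hu : IsUpper h) : entry h 0 0 * entry h 4 4 = 1 ∧
    entry h 1 1 * entry h 3 3 = 1 ∧ entry h 2 2 = 1 := by
  have h0 : ∀ i, i ≠ 0 → entry h i 0 = 0 := fun i hi => hu i 0 (Fin.pos_iff_ne_zero.2 hi)
  have e0 : entry h 4 4 * entry h 0 0 = 1 := orthogonality_zero h0 0
  have e1 := orthogonality_one h0 (i := 1) (by decide)
  rw [hu 2 1 (by decide), hu 3 1 (by decide)] at e1
  have e1' : entry h 3 3 * entry h 1 1 = 1 := by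
    simpa using e1
  refine ⟨by rw [mul_comm, e0], by rw [mul_comm, e1'], ?_⟩
  have hdet : h.1.1.det = 1 := h.1.2
  rw [Matrix.det_of_isUpperTriangular (M := h.1.1) (fun i j hij => hu i j hij),
    Fin.prod_univ_five] at hdet
  change entry h 0 0 * entry h 1 1 * entry h 2 2 * entry h 3 3 * entry h 4 4 = 1 at hdet
  calc entry h 2 2 = (entry h 4 4 * entry h 0 0) * (entry h 3 3 * entry h 1 1) * entry h 2 2 := by
        rw [e0, e1']; ring
    _ = 1 := by rw [← hdet]; ring

lemma IsUpper.exists_eq_mul_torus {h : SO32 F} (hu : IsUpper h) :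
    ∃ n ∈ N₀ F, ∃ α β : Fˣ, h = n * torus α β := by
  obtain ⟨e0, e1, e2⟩ := hu.diag
  set α : Fˣ := Units.mk0 _ (left_ne_zero_of_mul_eq_one e0) with hα
  set β : Fˣ := Units.mk0 _ (left_ne_zero_of_mul_eq_one e1) with hβ
  have hn : ∀ i j, entry (h * (torus α β)⁻¹) i j =
      entry h i j * (![(α : F)⁻¹, (β : F)⁻¹, 1, β, α] : Fin 5 → F) j := by
    intro i j
    rw [entry_mul, Finset.sum_eq_single j]
    · rw [entry_inv, entry_torus, if_pos rfl]
      fin_cases j <;> simp [Fin.rev]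
    · intro b _ hb
      rw [entry_inv, entry_torus, if_neg, mul_zero]
      exact fun hh => hb (Fin.rev_injective hh).symm
    · simp
  refine ⟨h * (torus α β)⁻¹, ⟨fun i => ?_, fun i j hij => ?_⟩, α, β, by simp⟩
  · rw [hn]
    fin_cases i
    · simp [hα, left_ne_zero_of_mul_eq_one e0]
    · simp [hβ, left_ne_zero_of_mul_eq_one e1]
    · simp [e2]
    · simpa [hβ, mul_comm] using e1
    · simpa [hα, mul_comm] using e0
  · rw [hn, hu i j hij, zero_mul]

variable [IsUltrametricDist F]

/-- Triangularization of isotropic vectors of the middle three-dimensional space. -/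
lemma exists_mv_middle (h2 : ringChar 𝓀[F] ≠ 2) {v : Fin 5 → F}
    (hQ : 2 * v 1 * v 3 + v 2 ^ 2 = 0) :
    ∃ k ∈ K F, (∀ u : Fin 5 → F, mv k u 0 = u 0 ∧ mv k u 4 = u 4) ∧
      (∀ u : Fin 5 → F, u 1 = 0 → u 2 = 0 → u 3 = 0 → mv k u = u) ∧
      mv k v 2 = 0 ∧ mv k v 3 = 0 := by
  have h20 := two_ne_zero_of_ringChar h2
  -- The parameter `-w 2 / (2 * w 3)` of `nM` kills coordinate `2`, and isotropy then kills
  -- coordinate `1`. The Weyl element moves the remaining coordinate from place `3` to place `1`.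
  have main : ∀ w : Fin 5 → F, 2 * w 1 * w 3 + w 2 ^ 2 = 0 → w 3 ≠ 0 → ‖w 2‖ ≤ ‖w 3‖ →
      ∃ k ∈ K F, (∀ u : Fin 5 → F, mv k u 0 = u 0 ∧ mv k u 4 = u 4) ∧
      (∀ u : Fin 5 → F, u 1 = 0 → u 2 = 0 → u 3 = 0 → mv k u = u) ∧
      mv k w 2 = 0 ∧ mv k w 3 = 0 := by
    intro w hw h3 hle
    have ht : ‖-w 2 / w 3 / 2‖ ≤ 1 := by
      rw [norm_div, norm_two_eq_one h2, div_one, norm_div, norm_neg]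
      exact div_le_one_of_le₀ hle (norm_nonneg _)
    refine ⟨wM F * nM (-w 2 / w 3 / 2), mul_mem wM_mem (nM_mem ht), fun u => ?_, fun u h1 h2 h3 => ?_,
      ?_, ?_⟩
    · rw [mv_mul, mv_wM, mv_nM]; exact ⟨rfl, rfl⟩
    · rw [mv_mul, mv_wM, mv_nM]
      ext i
      fin_cases i <;> simp [h1, h2, h3]
    · rw [mv_mul, mv_wM, mv_nM]
      simp
      field_simp
      ring
    · rw [mv_mul, mv_wM, mv_nM]
      simp
      field_simp
      linear_combination hw
  by_cases h0 : v 2 = 0 ∧ v 3 = 0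
  · exact ⟨1, one_mem _, fun u => by simp [mv_one], fun u _ _ _ => mv_one u, by rw [mv_one]; exact h0⟩
  by_cases hle : ‖v 2‖ ≤ ‖v 3‖
  · refine main v hQ (fun h3 => h0 ⟨?_, h3⟩) hle
    rw [h3, norm_zero] at hle
    exact norm_le_zero_iff.1 hle
  · push Not at hle
    -- Isotropy makes `‖v 2‖` the geometric mean of `‖v 1‖` and `‖v 3‖`. If it exceeds the second it
    -- is at most the first, and exchanging the two reduces to `main`.
    have hn : ‖v 2‖ ^ 2 = ‖v 1‖ * ‖v 3‖ := by
      have : v 2 ^ 2 = -(2 * v 1 * v 3) := by linear_combination hQ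
      rw [← norm_pow, this, norm_neg, norm_mul, norm_mul, norm_two_eq_one h2, one_mul]
    have h20' : 0 < ‖v 2‖ := (norm_nonneg _).trans_lt hle
    have h12 : ‖v 2‖ ≤ ‖v 1‖ := by
      by_contra hh
      push Not at hh
      have : ‖v 1‖ * ‖v 3‖ ≤ ‖v 2‖ * ‖v 3‖ := by gcongr
      nlinarith
    obtain ⟨k, hk, ha, hb, hc, hd⟩ := main (mv (wM F) v) (by
        rw [mv_wM]
        change 2 * v 3 * v 1 + (-v 2) ^ 2 = 0
        linear_combination hQ) (by
        rw [mv_wM]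
        exact norm_pos_iff.1 (h20'.trans_le h12)) (by
        rw [mv_wM]
        change ‖-v 2‖ ≤ ‖v 1‖
        rwa [norm_neg])
    refine ⟨k * wM F, mul_mem hk wM_mem, fun u => ?_, fun u h1 h2 h3 => ?_, ?_, ?_⟩
    · rw [mv_mul, (ha _).1, (ha _).2, mv_wM]; exact ⟨rfl, rfl⟩
    · have : mv (wM F) u = u := by
        rw [mv_wM]; ext i
        fin_cases i <;> simp [h1, h2, h3]
      rw [mv_mul, this, hb u h1 h2 h3]
    · rwa [mv_mul]
    · rwa [mv_mul]

/-- The Iwasawa decomposition `G = N₀ A₀ K`. -/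
lemma exists_iwasawa (h2 : ringChar 𝓀[F] ≠ 2) (g : SO32 F) :
    ∃ n ∈ N₀ F, ∃ α β : Fˣ, ∃ k ∈ K F, g = n * torus α β * k := by
  obtain ⟨i, hi⟩ := exists_norm_eq (mv g⁻¹ (Pi.single 0 1))
  -- The vector `g⁻¹ e₀` is isotropic, so after scaling, its normal form under `K` is the last basis
  -- vector, and `wU` sends this to `e₀`. Thus `h = wU * k * g⁻¹` preserves the line of `e₀`.
  set x := mv g⁻¹ (Pi.single 0 1) with hx
  have hx0 : x i ≠ 0 := by
    intro h0
    rw [h0, norm_zero, eq_comm, norm_eq_zero] at hi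
    have := mv_mv_inv g (Pi.single 0 1)
    rw [← hx, hi] at this
    have := congrFun this 0
    simp [mv_apply] at this
  obtain ⟨k, hk, hkx⟩ := exists_mv_eq_normalForm h2 (v := (x i)⁻¹ • x) (by
    rw [norm_smul, norm_inv, hi, inv_mul_cancel₀]
    rw [← hi]; exact norm_ne_zero_iff.2 hx0)
  have hQx : Q x x = 0 := by rw [hx, Q_mv, Q_self]; simp
  rw [Q_smul, hQx, mv_smul] at hkx
  have hkx' : mv (wU F * k * g⁻¹) (Pi.single 0 1) = x i • ![1, 0, 0, 0, 0] := by
    rw [mv_mul, mv_mul, ← hx]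
    have : mv k x = x i • ((x i)⁻¹ • mv k x) := by rw [smul_smul, mul_inv_cancel₀ hx0, one_smul]
    rw [this, hkx, mv_smul, mv_wU]
    congr 1
    ext j
    fin_cases j <;> simp
  set h := wU F * k * g⁻¹ with hh
  have h0 : ∀ j, j ≠ 0 → entry h j 0 = 0 := by
    intro j hj
    rw [← mv_single, hkx']
    fin_cases j
    · exact absurd rfl hj
    all_goals simp
  have h41 : entry h 4 1 = 0 := entry_four_eq_zero h0 (by decide)
  -- Since `entry h 4 1 = 0`, isotropy of the second column is isotropy of its middle part. The
  -- element `κ` triangularizes that part and fixes `e₀`, so the first column is not disturbed.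
  obtain ⟨κ, hκ, -, hfix, h2', h3'⟩ := exists_mv_middle h2 (v := mv h (Pi.single 1 1)) (by
    have := Q_mv h (Pi.single 1 1)
    rw [Q_self, Q_self, mv_single h 4 1, h41] at this
    simpa using this)
  have hu : IsUpper (κ * h) := by
    refine isUpper_of_columns (fun j hj => ?_) ?_ ?_
    · rw [← mv_single, mv_mul, hfix]
      · rw [mv_single, h0 j hj]
      · rw [mv_single, h0 1 (by decide)]
      · rw [mv_single, h0 2 (by decide)]
      · rw [mv_single, h0 3 (by decide)]
    · rw [← mv_single, mv_mul, h2']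
    · rw [← mv_single, mv_mul, h3']
  obtain ⟨n, hn, α, β, e⟩ := hu.inv.exists_eq_mul_torus
  refine ⟨n, hn, α, β, κ * (wU F * k), mul_mem hκ (mul_mem wU_mem hk), ?_⟩
  rw [← e, hh]
  group

end Iwasawa

end SO5

namespace SO5

noncomputable section

/-! ### Topology of `G` and Haar measures of compact subgroups -/

section Topology

variable {F : Type*} [NontriviallyNormedField F]

lemma continuous_entry (i j : Fin 5) : Continuous fun g : SO32 F => entry g i j :=
  (Continuous.matrix_elem continuous_subtype_val i j).comp continuous_subtype_val

lemma continuous_mv (v : Fin 5 → F) : Continuous fun g : SO32 F => mv g v :=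
  continuous_pi fun i => by
    simp only [mv_apply]
    exact continuous_finsetSum _ fun j _ => (continuous_entry i j).mul continuous_const

lemma isClosedEmbedding_val :
    Topology.IsClosedEmbedding fun g : SO32 F => (g.1.1 : Matrix (Fin 5) (Fin 5) F) := by
  refine ⟨Topology.IsEmbedding.subtypeVal.comp Topology.IsEmbedding.subtypeVal, ?_⟩
  have : Set.range (fun g : SO32 F => (g.1.1 : Matrix (Fin 5) (Fin 5) F)) =
      {A | A.det = 1} ∩ {A | Aᵀ * J F * A = J F} := by
    ext A
    constructor
    · rintro ⟨g, rfl⟩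
      exact ⟨g.1.2, g.2⟩
    · rintro ⟨h1, h2⟩
      exact ⟨⟨⟨A, h1⟩, h2⟩, rfl⟩
  rw [this]
  refine (isClosed_singleton.preimage continuous_id.matrix_det).inter
    (isClosed_eq ?_ continuous_const)
  fun_prop

variable [IsUltrametricDist F]

lemma isCompact_K [LocallyCompactSpace F] : IsCompact (K F : Set (SO32 F)) := by
  have : ProperSpace F := .of_locallyCompactSpace F
  have h : (K F : Set (SO32 F)) = (fun g : SO32 F => (g.1.1 : Matrix (Fin 5) (Fin 5) F)) ⁻¹'
      (Set.pi Set.univ fun _ => Set.pi Set.univ fun _ => Metric.closedBall (0 : F) 1) := by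
    ext g
    exact ⟨fun hg i _ j _ => mem_closedBall_zero_iff.2 (norm_entry_le hg i j),
      fun hg => mem_K_iff.2 fun i j => mem_closedBall_zero_iff.1 (hg i trivial j trivial)⟩
  rw [h]
  exact isClosedEmbedding_val.isCompact_preimage
    (isCompact_univ_pi fun _ => isCompact_univ_pi fun _ => isCompact_closedBall _ _)

instance [LocallyCompactSpace F] : CompactSpace (K F) := isCompact_iff_compactSpace.1 isCompact_K

lemma K_mem_nhds_one : (K F : Set (SO32 F)) ∈ nhds 1 := (isOpen_K F).mem_nhds (one_mem _)

instance [LocallyCompactSpace F] : LocallyCompactSpace (SO32 F) :=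
  isCompact_K.locallyCompactSpace_of_mem_nhds_of_group K_mem_nhds_one

instance [LocallyCompactSpace F] : SecondCountableTopology (SO32 F) := by
  have : ProperSpace F := .of_locallyCompactSpace F
  have : SecondCountableTopology (Matrix (Fin 5) (Fin 5) F) :=
    inferInstanceAs (SecondCountableTopology (Fin 5 → Fin 5 → F))
  exact isClosedEmbedding_val.isEmbedding.secondCountableTopology

/-- Right translation by `k` gives another left Haar measure with the same mass on `K`, because `K k
= K`. Uniqueness identifies the two, so unimodularity of `G` is not needed. -/
lemma integral_mul_right_of_mem_K [LocallyCompactSpace F] (μ : Measure (SO32 F))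
    [μ.IsHaarMeasure] {k : SO32 F} (hk : k ∈ K F) (φ : SO32 F → ℂ) :
    ∫ g, φ (g * k) ∂μ = ∫ g, φ g ∂μ := by
  set K₀ : TopologicalSpace.PositiveCompacts (SO32 F) :=
    ⟨⟨(K F : Set (SO32 F)), isCompact_K⟩, by
      rw [(isOpen_K F).interior_eq]; exact ⟨1, one_mem _⟩⟩ with hK₀
  have hK : (fun g => g * k) ⁻¹' (K F : Set (SO32 F)) = K F := by
    ext g
    exact Subgroup.mul_mem_cancel_right _ hk
  have hmap : μ.map (· * k) = μ := by
    rw [Measure.haarMeasure_unique (μ.map (· * k)) K₀]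
    conv_rhs => rw [Measure.haarMeasure_unique μ K₀]
    congr 1
    change μ.map (· * k) (K F) = μ (K F)
    rw [Measure.map_apply (measurable_mul_const k) (isOpen_K F).measurableSet, hK]
  conv_rhs => rw [← hmap]
  exact ((Homeomorph.mulRight k).measurableEmbedding.integral_map φ).symm

/-- The Haar probability measure of a compact subgroup. -/
def haarC (C : Subgroup (SO32 F)) [CompactSpace C] : Measure C :=
  Measure.haarMeasure ⊤

variable (C : Subgroup (SO32 F)) [CompactSpace C]

instance : (haarC C).IsHaarMeasure := by unfold haarC; infer_instance

instance : IsProbabilityMeasure (haarC C) := ⟨by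
  have := Measure.haarMeasure_self (K₀ := (⊤ : TopologicalSpace.PositiveCompacts C))
  exact this⟩

instance : (haarC C).IsMulRightInvariant := ⟨fun c => by
  have : IsProbabilityMeasure ((haarC C).map (· * c)) :=
    Measure.isProbabilityMeasure_map (measurable_mul_const c).aemeasurable
  exact Measure.isHaarMeasure_eq_of_isProbabilityMeasure _ _⟩

instance : (haarC C).IsInvInvariant := ⟨by
  have : IsProbabilityMeasure (haarC C).inv :=
    Measure.isProbabilityMeasure_map measurable_inv.aemeasurable
  have h := Measure.isMulInvariant_eq_smul_of_compactSpace (haarC C).inv (haarC C)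
  have h1 : Measure.haarScalarFactor (haarC C).inv (haarC C) = 1 := by
    have := congrArg (fun ν : Measure C => ν Set.univ) h
    simpa [measure_univ, eq_comm] using this
  rw [h, h1, one_smul]⟩

end Topology

/-! ### Averages over compact subgroups -/

section Average

variable {F : Type*} [NontriviallyNormedField F] [IsUltrametricDist F]

lemma hecke_continuous (f : sphericalHecke F) : Continuous f.1 :=
  (isLocallyConstant_of_right_invariant fun k hk g => by
    simpa using f.2.1 1 (one_mem _) k hk g).continuous

lemma hecke_left (f : sphericalHecke F) {k : SO32 F} (hk : k ∈ K F) (g : SO32 F) :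
    f.1 (k * g) = f.1 g := by
  simpa using f.2.1 k hk 1 (one_mem _) g

lemma hecke_right (f : sphericalHecke F) {k : SO32 F} (hk : k ∈ K F) (g : SO32 F) :
    f.1 (g * k) = f.1 g := by
  simpa using f.2.1 1 (one_mem _) k hk g

lemma isLocallyConstant_of_left_invariant {f : SO32 F → ℂ} (hf : ∀ k ∈ K F, ∀ g, f (k * g) = f g) :
    IsLocallyConstant f := by
  have h : IsLocallyConstant fun g => f g⁻¹ :=
    isLocallyConstant_of_right_invariant fun k hk g => by
      rw [mul_inv_rev, hf _ (inv_mem hk)]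
  have h2 := h.comp_continuous (continuous_inv (G := SO32 F))
  simpa [Function.comp_def] using h2

variable {C : Subgroup (SO32 F)} [CompactSpace C]

lemma integral_hecke_swap (μ : Measure (SO32 F)) [μ.IsHaarMeasure] (f : sphericalHecke F)
    {Φ : SO32 F → C → ℂ} (hΦ : Continuous fun p : SO32 F × C => Φ p.1 p.2) :
    ∫ g, f.1 g * ∫ c, Φ g c ∂(haarC C) ∂μ = ∫ c, ∫ g, f.1 g * Φ g c ∂μ ∂(haarC C) := by
  simp only [← integral_const_mul]
  refine integral_integral_swap_of_hasCompactSupport (f := fun g c => f.1 g * Φ g c)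
    (((hecke_continuous f).comp continuous_fst).mul hΦ) ?_
  refine HasCompactSupport.intro (f.2.2.isCompact.prod (isCompact_univ (X := C))) ?_
  rintro ⟨g, c⟩ hg
  have : g ∉ tsupport f.1 := fun h => hg ⟨h, Set.mem_univ _⟩
  simp [image_eq_zero_of_notMem_tsupport this]

/-- Translating by `c ∈ C ≤ K` changes neither the measure nor `f`, so `φ` may be replaced by its
mean over `C`. -/
lemma integral_hecke_average_left (hC : C ≤ K F) (μ : Measure (SO32 F)) [μ.IsHaarMeasure]
    (f : sphericalHecke F) {φ : SO32 F → ℂ} (hφ : Continuous φ) :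
    ∫ g, f.1 g * φ g ∂μ = ∫ g, f.1 g * ∫ c : C, φ (c * g) ∂(haarC C) ∂μ := by
  rw [integral_hecke_swap μ f (Φ := fun g c => φ (c * g)) (by fun_prop)]
  have : ∀ c : C, ∫ g, f.1 g * φ (c * g) ∂μ = ∫ g, f.1 g * φ g ∂μ := by
    intro c
    rw [← integral_mul_left_eq_self (μ := μ) (fun g => f.1 g * φ g) (c : SO32 F)]
    simp only [hecke_left f (hC c.2)]
  simp [this]

lemma integral_hecke_average_right [LocallyCompactSpace F] (hC : C ≤ K F) (μ : Measure (SO32 F))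
    [μ.IsHaarMeasure] (f : sphericalHecke F) {φ : SO32 F → ℂ} (hφ : Continuous φ) :
    ∫ g, f.1 g * φ g ∂μ = ∫ g, f.1 g * ∫ c : C, φ (g * c) ∂(haarC C) ∂μ := by
  rw [integral_hecke_swap μ f (Φ := fun g c => φ (g * c)) (by fun_prop)]
  have : ∀ c : C, ∫ g, f.1 g * φ (g * c) ∂μ = ∫ g, f.1 g * φ g ∂μ := by
    intro c
    rw [← integral_mul_right_of_mem_K μ (hC c.2) (fun g => f.1 g * φ g)]
    simp only [hecke_right f (hC c.2)]
  simp [this]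

end Average

end

end SO5

namespace SO5

noncomputable section

/-! ### The spherical vector of `π_ζ` and the Satake transform -/

/-- The range lies in the line of `v`, and `T` acts on it as the scalar `c`. If `c ≠ 0` the range is
the whole line; if `c = 0` the restriction to the range is zero, whatever its dimension. -/
lemma finiteRankTrace_eq {V : Type*} [AddCommGroup V] [Module ℂ V] (T : V →ₗ[ℂ] V) {v : V}
    (hv : v ≠ 0) {c : ℂ} (hT : ∀ w, ∃ a : ℂ, T w = a • v) (hc : T v = c • v) :
    finiteRankTrace T = c := by
  have key : T.rangeRestrict ∘ₗ (LinearMap.range T).subtype = c • LinearMap.id := by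
    ext ⟨w, hw⟩
    obtain ⟨w', rfl⟩ := hw
    obtain ⟨a, ha⟩ := hT w'
    simp [ha, hc, smul_comm a c]
  rw [finiteRankTrace, key]
  by_cases h0 : c = 0
  · rw [h0, zero_smul, map_zero]
  · have : LinearMap.range T = Submodule.span ℂ {v} := by
      apply le_antisymm
      · rintro _ ⟨w, rfl⟩
        obtain ⟨a, ha⟩ := hT w
        rw [ha]
        exact Submodule.smul_mem _ _ (Submodule.mem_span_singleton_self v)
      · rw [Submodule.span_singleton_le_iff_mem]
        exact ⟨c⁻¹ • v, by rw [map_smul, hc, smul_smul, inv_mul_cancel₀ h0, one_smul]⟩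
    have : Module.Finite ℂ (LinearMap.range T) := by rw [this]; infer_instance
    rw [map_smul, LinearMap.trace_id, smul_eq_mul, ‹LinearMap.range T = _›,
      finrank_span_singleton hv, Nat.cast_one, mul_one]

section Spherical

variable {F : Type*} [NontriviallyNormedField F]

/-- The norm of the last row. -/
def rowNorm (g : SO32 F) : ℝ := ‖fun j => entry g 4 j‖

/-- The norm of the exterior product of the last two rows. -/
def wedgeNorm (g : SO32 F) : ℝ :=
  ‖fun p : Fin 5 × Fin 5 => entry g 3 p.1 * entry g 4 p.2 - entry g 3 p.2 * entry g 4 p.1‖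

lemma entry_unipotent_torus_mul_four {n : SO32 F} (hn : n ∈ N₀ F) (α β : Fˣ) (g : SO32 F)
    (j : Fin 5) : entry (n * torus α β * g) 4 j = (α : F)⁻¹ * entry g 4 j := by
  rw [mul_assoc, entry_mul, Finset.sum_eq_single 4]
  · rw [hn.1, one_mul, entry_mul, Finset.sum_eq_single 4]
    · rw [entry_torus, if_pos rfl]; simp
    · intro b _ hb; rw [entry_torus, if_neg hb.symm, zero_mul]
    · simp
  · intro b _ hb
    rw [hn.2 4 b (lt_of_le_of_ne (Fin.le_last b) hb), zero_mul]
  · simp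

lemma entry_unipotent_torus_mul_three {n : SO32 F} (hn : n ∈ N₀ F) (α β : Fˣ) (g : SO32 F)
    (j : Fin 5) : entry (n * torus α β * g) 3 j =
      (β : F)⁻¹ * entry g 3 j + entry n 3 4 * (α : F)⁻¹ * entry g 4 j := by
  rw [mul_assoc, entry_mul, Fin.sum_univ_five, hn.2 3 0 (by decide), hn.2 3 1 (by decide),
    hn.2 3 2 (by decide), hn.1]
  have h : ∀ i, entry (torus α β * g) i j =
      (![(α : F), β, 1, (β : F)⁻¹, (α : F)⁻¹] : Fin 5 → F) i * entry g i j := by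
    intro i
    rw [entry_mul, Finset.sum_eq_single i]
    · rw [entry_torus, if_pos rfl]
    · intro b _ hb; rw [entry_torus, if_neg hb.symm, zero_mul]
    · simp
  rw [h 3, h 4]
  simp [mul_assoc]

lemma rowNorm_unipotent_torus_mul {n : SO32 F} (hn : n ∈ N₀ F) (α β : Fˣ) (g : SO32 F) :
    rowNorm (n * torus α β * g) = ‖(α : F)‖⁻¹ * rowNorm g := by
  simp only [rowNorm, entry_unipotent_torus_mul_four hn]
  rw [← norm_inv, ← norm_smul]
  rfl

/-- The unipotent factor adds to the fourth row a multiple of the last one, which the `2 × 2` minors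
do not see. -/
lemma wedgeNorm_unipotent_torus_mul {n : SO32 F} (hn : n ∈ N₀ F) (α β : Fˣ) (g : SO32 F) :
    wedgeNorm (n * torus α β * g) = ‖(α : F)‖⁻¹ * ‖(β : F)‖⁻¹ * wedgeNorm g := by
  simp only [wedgeNorm, entry_unipotent_torus_mul_four hn, entry_unipotent_torus_mul_three hn]
  rw [← norm_inv, ← norm_inv, ← norm_mul, ← norm_smul]
  congr 1
  ext p
  simp only [Pi.smul_apply, smul_eq_mul]
  ring

lemma rowNorm_pos (g : SO32 F) : 0 < rowNorm g := by
  rw [rowNorm, norm_pos_iff]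
  intro h
  have := entry_one (F := F) 4 4
  rw [← mul_inv_cancel g, entry_mul] at this
  simp only [fun j => show entry g 4 j = 0 from congrFun h j] at this
  simp at this

lemma rowNorm_one : rowNorm (1 : SO32 F) = 1 := by
  apply le_antisymm
  · rw [rowNorm, pi_norm_le_iff_of_nonneg zero_le_one]
    intro j
    rw [entry_one]; split_ifs <;> simp
  · refine le_trans (le_of_eq ?_) (norm_le_pi_norm _ 4)
    rw [entry_one]; simp

lemma wedgeNorm_one : wedgeNorm (1 : SO32 F) = 1 := by
  apply le_antisymm
  · rw [wedgeNorm, pi_norm_le_iff_of_nonneg zero_le_one]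
    rintro ⟨i, j⟩
    simp only [entry_one]
    fin_cases i <;> fin_cases j <;> simp
  · refine le_trans (le_of_eq ?_) (norm_le_pi_norm _ (3, 4))
    simp [entry_one]

variable [IsUltrametricDist F]

lemma rowNorm_mul_le {k : SO32 F} (hk : k ∈ K F) (g : SO32 F) : rowNorm (g * k) ≤ rowNorm g := by
  rw [rowNorm, pi_norm_le_iff_of_nonneg (rowNorm_pos g).le]
  intro j
  rw [entry_mul]
  refine norm_sum_le_of_forall _ _ (rowNorm_pos g).le fun l _ => ?_
  rw [norm_mul]
  exact (mul_le_of_le_one_right (norm_nonneg _) (norm_entry_le hk l j)).trans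
    (norm_le_pi_norm (fun j => entry g 4 j) l)

lemma rowNorm_mul {k : SO32 F} (hk : k ∈ K F) (g : SO32 F) : rowNorm (g * k) = rowNorm g := by
  refine le_antisymm (rowNorm_mul_le hk g) ?_
  have := rowNorm_mul_le (inv_mem hk) (g * k)
  rwa [mul_inv_cancel_right] at this

lemma wedgeNorm_mul_le {k : SO32 F} (hk : k ∈ K F) (g : SO32 F) :
    wedgeNorm (g * k) ≤ wedgeNorm g := by
  have h0 : 0 ≤ wedgeNorm g := norm_nonneg _
  rw [wedgeNorm, pi_norm_le_iff_of_nonneg h0]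
  rintro ⟨i, j⟩
  -- Cauchy–Binet, summed over all ordered pairs of columns: the minors of `g * k` are integral
  -- combinations of those of `g`.
  have : entry (g * k) 3 i * entry (g * k) 4 j - entry (g * k) 3 j * entry (g * k) 4 i =
      ∑ a, ∑ b, (entry g 3 a * entry g 4 b - entry g 3 b * entry g 4 a) *
        (entry k a i * entry k b j) := by
    simp only [entry_mul, Finset.sum_mul_sum, sub_mul, Finset.sum_sub_distrib]
    congr 1
    · refine Finset.sum_congr rfl fun a _ => Finset.sum_congr rfl fun b _ => by ring
    · rw [Finset.sum_comm]
      refine Finset.sum_congr rfl fun a _ => Finset.sum_congr rfl fun b _ => by ring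
  simp only [this]
  refine norm_sum_le_of_forall _ _ (norm_nonneg _) fun a _ =>
    norm_sum_le_of_forall _ _ (norm_nonneg _) fun b _ => ?_
  rw [norm_mul]
  exact (mul_le_of_le_one_right (norm_nonneg _)
    (norm_mul_le_one (norm_entry_le hk a i) (norm_entry_le hk b j))).trans
    (norm_le_pi_norm (fun p : Fin 5 × Fin 5 =>
      entry g 3 p.1 * entry g 4 p.2 - entry g 3 p.2 * entry g 4 p.1) (a, b))

lemma wedgeNorm_mul {k : SO32 F} (hk : k ∈ K F) (g : SO32 F) :
    wedgeNorm (g * k) = wedgeNorm g := by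
  refine le_antisymm (wedgeNorm_mul_le hk g) ?_
  have := wedgeNorm_mul_le (inv_mem hk) (g * k)
  rwa [mul_inv_cancel_right] at this

lemma rowNorm_of_mem {k : SO32 F} (hk : k ∈ K F) : rowNorm k = 1 := by
  rw [← one_mul k, rowNorm_mul hk, rowNorm_one]

lemma wedgeNorm_of_mem {k : SO32 F} (hk : k ∈ K F) : wedgeNorm k = 1 := by
  rw [← one_mul k, wedgeNorm_mul hk, wedgeNorm_one]

lemma cpow_ofReal_exp (A : ℝ) (z : ℂ) : ((Real.exp A : ℝ) : ℂ) ^ z = Complex.exp (A * z) := by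
  rw [Complex.cpow_def_of_ne_zero (by exact_mod_cast (Real.exp_pos A).ne'), ← Complex.ofReal_log
    (Real.exp_pos A).le, Real.log_exp]

/-- The spherical vector of `π_ζ = I_G(ζ, 1/2 + ζ)`, normalized by the value `1` on `K`. -/
def phiB (ζ : ℂ) (g : SO32 F) : ℂ := (rowNorm g : ℂ) ^ (-(1 / 2 + ζ)) / wedgeNorm g

/-- The `K`-invariant function of the last row that transforms by `|α|^{3/2+ζ}` under `B`. -/
def phiP (ζ : ℂ) (g : SO32 F) : ℂ := (rowNorm g : ℂ) ^ (-(3 / 2 + ζ))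

/-- With `ζ' = 1/2 + ζ` the two occurrences of `ζ` in the exponent of `|β|` cancel. Writing absolute
values as real exponentials makes the complex powers additive. -/
lemma inducingFactor_eq (ζ : ℂ) (α β : Fˣ) : inducingFactor ζ (1 / 2 + ζ) α β =
    (‖(α : F)‖ : ℂ) ^ (3 / 2 + ζ) * ‖(β : F)‖ := by
  have ha : 0 < ‖(α : F)‖ := norm_pos_iff.2 α.ne_zero
  have hb : 0 < ‖(β : F)‖ := norm_pos_iff.2 β.ne_zero
  rw [inducingFactor, deltaB, norm_div, norm_mul]
  obtain ⟨A, hA⟩ : ∃ A, Real.exp A = ‖(α : F)‖ := ⟨_, Real.exp_log ha⟩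
  obtain ⟨B, hB⟩ : ∃ B, Real.exp B = ‖(β : F)‖ := ⟨_, Real.exp_log hb⟩
  rw [← hA, ← hB]
  have h1 : Real.sqrt (Real.exp A / Real.exp B * Real.exp B * Real.exp A *
      (Real.exp A * Real.exp B)) = Real.exp ((3 * A + B) / 2) := by
    rw [Real.sqrt_eq_iff_mul_self_eq (by positivity) (by positivity), ← Real.exp_sub]
    simp only [← Real.exp_add]
    congr 1; ring
  rw [h1, ← Real.exp_sub, cpow_ofReal_exp, cpow_ofReal_exp, cpow_ofReal_exp,
    Complex.ofReal_exp, Complex.ofReal_exp]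
  simp only [← Complex.exp_add]
  congr 1
  push_cast
  ring

lemma phiB_equivariant (ζ : ℂ) {n : SO32 F} (hn : n ∈ N₀ F) (α β : Fˣ) (g : SO32 F) :
    phiB ζ (n * torus α β * g) = inducingFactor ζ (1 / 2 + ζ) α β * phiB ζ g := by
  have ha : 0 < ‖(α : F)‖ := norm_pos_iff.2 α.ne_zero
  have hb : 0 < ‖(β : F)‖ := norm_pos_iff.2 β.ne_zero
  rw [inducingFactor_eq, phiB, rowNorm_unipotent_torus_mul hn, wedgeNorm_unipotent_torus_mul hn, phiB]
  obtain ⟨A, hA⟩ : ∃ A, Real.exp A = ‖(α : F)‖ := ⟨_, Real.exp_log ha⟩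
  have e : ((‖(α : F)‖⁻¹ : ℝ) : ℂ) ^ (-(1 / 2 + ζ)) = (‖(α : F)‖ : ℂ) ^ (3 / 2 + ζ) / ‖(α : F)‖ := by
    rw [← hA, ← Real.exp_neg, cpow_ofReal_exp, cpow_ofReal_exp, Complex.ofReal_exp,
      ← Complex.exp_sub]
    congr 1
    push_cast
    ring
  rw [Complex.ofReal_mul, Complex.mul_cpow_ofReal_nonneg (inv_nonneg.2 ha.le) (rowNorm_pos g).le, e]
  have ha' : (‖(α : F)‖ : ℂ) ≠ 0 := by exact_mod_cast ha.ne'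
  have hb' : (‖(β : F)‖ : ℂ) ≠ 0 := by exact_mod_cast hb.ne'
  push_cast
  field_simp

lemma phiB_right (ζ : ℂ) {k : SO32 F} (hk : k ∈ K F) (g : SO32 F) :
    phiB ζ (g * k) = phiB ζ g := by
  rw [phiB, rowNorm_mul hk, wedgeNorm_mul hk, phiB]

lemma phiP_right (ζ : ℂ) {k : SO32 F} (hk : k ∈ K F) (g : SO32 F) :
    phiP ζ (g * k) = phiP ζ g := by
  rw [phiP, rowNorm_mul hk, phiP]

lemma phiB_one (ζ : ℂ) : phiB ζ (1 : SO32 F) = 1 := by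
  rw [phiB, rowNorm_one, wedgeNorm_one]; simp

lemma isLocallyConstant_phiB (ζ : ℂ) : IsLocallyConstant (phiB ζ : SO32 F → ℂ) :=
  isLocallyConstant_of_right_invariant fun _ hk g => phiB_right ζ hk g

/-- The Satake transform at `π_ζ` is the integral against the spherical vector. -/
lemma satake_eq (h2 : ringChar 𝓀[F] ≠ 2) (μ : Measure (SO32 F)) [μ.IsHaarMeasure] (ζ : ℂ)
    (f : sphericalHecke F) : satake μ ζ (1 / 2 + ζ) f = ∫ g, f.1 g * phiB ζ g ∂μ := by
  set v : inducedRep F ζ (1 / 2 + ζ) := ⟨phiB ζ, isLocallyConstant_phiB ζ,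
    fun n hn α β g => phiB_equivariant ζ hn α β g⟩ with hv
  -- Left invariance of `f` makes the image right `K`-invariant. By the Iwasawa decomposition it is
  -- determined by its value at `1`, so the operator has rank at most one.
  have hinv : ∀ w : inducedRep F ζ (1 / 2 + ζ),
      heckeOp μ ζ (1 / 2 + ζ) f w = (heckeOp μ ζ (1 / 2 + ζ) f w).1 1 • v := by
    intro w
    set w' := heckeOp μ ζ (1 / 2 + ζ) f w with hw'
    have hK : ∀ k ∈ K F, ∀ h, w'.1 (h * k) = w'.1 h := by
      intro k hk h
      change ∫ g, f.1 g * w.1 (h * k * g) ∂μ = ∫ g, f.1 g * w.1 (h * g) ∂μ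
      rw [← integral_mul_left_eq_self (μ := μ) (fun g => f.1 g * w.1 (h * g)) k]
      simp only [hecke_left f hk, mul_assoc]
    ext g
    obtain ⟨n, hn, α, β, k, hk, rfl⟩ := exists_iwasawa h2 g
    change w'.1 _ = w'.1 1 * phiB ζ _
    rw [hK k hk, phiB_right ζ hk, ← mul_one (n * torus α β), w'.2.2 n hn, phiB_equivariant ζ hn,
      phiB_one]
    ring
  refine finiteRankTrace_eq _ (v := v) ?_ (fun w => ⟨_, hinv w⟩) ?_
  · intro h0
    have h1 : phiB ζ (1 : SO32 F) = 0 := congrFun (congrArg Subtype.val h0) 1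
    rw [phiB_one] at h1
    exact one_ne_zero h1
  · rw [hinv v]
    congr 1
    change ∫ g, f.1 g * phiB ζ (1 * g) ∂μ = _
    simp only [one_mul]

end Spherical

end

end SO5

namespace SO5

noncomputable section

/-! ### Invariance of the Satake transform under the short simple reflection -/

section Middle

variable {F : Type*} [NontriviallyNormedField F]

lemma torus_mul (α β α' β' : Fˣ) : torus α β * torus α' β' = torus (α * α') (β * β') := by
  apply ext_mv
  intro v
  rw [mv_mul, mv_torus, mv_torus, mv_torus]
  ext i
  fin_cases i <;> simp <;> ring

lemma nM_mul_torus (x : F) (β : Fˣ) : nM x * torus 1 β = torus 1 β * nM (x / β) := by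
  apply ext_mv
  intro v
  rw [mv_mul, mv_mul, mv_torus, mv_nM, mv_nM, mv_torus]
  ext i
  fin_cases i <;> simp <;> field_simp

lemma wM_mul_torus (β : Fˣ) : wM F * torus 1 β = torus 1 β⁻¹ * wM F := by
  apply ext_mv
  intro v
  rw [mv_mul, mv_mul, mv_torus, mv_wM, mv_wM, mv_torus]
  ext i
  fin_cases i <;> simp

/-- A rank-one Bruhat identity. In odd residual characteristic the parameters `1 / (2x)` are
integral for `‖x‖ ≥ 1`, so a large unipotent becomes a torus element between elements of `KM`. -/
lemma nM_eq (h20 : (2 : F) ≠ 0) (x : Fˣ) (τ : Fˣ) (hτ : (τ : F) = -(2 * (x : F) ^ 2)) :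
    nM (x : F) = wM F * nM (1 / (2 * (x : F))) * torus 1 τ⁻¹ * wM F *
      nM (1 / (2 * (x : F))) * wM F := by
  apply ext_mv
  intro v
  simp only [mv_mul, mv_torus, mv_wM, mv_nM]
  ext i
  fin_cases i <;> simp [hτ] <;> field_simp <;> ring

/-- When the last row is supported in the last place, the only nonzero minors involve the last
column. They see the fourth row only outside that column. -/
lemma wedgeNorm_congr {g h : SO32 F} {a : F} (hg : ∀ j, j ≠ 4 → entry g 4 j = 0)
    (hh : ∀ j, j ≠ 4 → entry h 4 j = 0) (h3 : ∀ j, j ≠ 4 → entry g 3 j = entry h 3 j)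
    (h4 : entry g 4 4 = a * entry h 4 4) : wedgeNorm g = ‖a‖ * wedgeNorm h := by
  rw [wedgeNorm, wedgeNorm, ← norm_smul]
  congr 1
  ext ⟨i, j⟩
  simp only [Pi.smul_apply, smul_eq_mul]
  by_cases hi : i = 4 <;> by_cases hj : j = 4
  · subst hi hj; ring
  · subst hi; rw [h3 j hj, h4, hg j hj, hh j hj]; ring
  · subst hj; rw [h3 i hi, h4, hg i hi, hh i hi]; ring
  · rw [hg i hi, hg j hj, hh i hi, hh j hj]; ring

variable [IsUltrametricDist F]

variable (F) in
/-- The maximal compact subgroup of the middle `SO(2,1)`. -/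
def KM : Subgroup (SO32 F) where
  carrier := {k | k ∈ K F ∧ mv k (Pi.single 0 1) = Pi.single 0 1 ∧
    mv k (Pi.single 4 1) = Pi.single 4 1}
  one_mem' := ⟨one_mem _, mv_one _, mv_one _⟩
  mul_mem' := fun {a b} ha hb => ⟨mul_mem ha.1 hb.1, by rw [mv_mul, hb.2.1, ha.2.1],
    by rw [mv_mul, hb.2.2, ha.2.2]⟩
  inv_mem' := fun {a} ha => ⟨inv_mem ha.1, by
    conv_lhs => rw [← ha.2.1]
    exact mv_inv_mv _ _, by
    conv_lhs => rw [← ha.2.2]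
    exact mv_inv_mv _ _⟩

lemma KM_le : KM F ≤ K F := fun _ h => h.1

instance [LocallyCompactSpace F] : CompactSpace (KM F) := by
  refine isCompact_iff_compactSpace (s := (KM F : Set (SO32 F))).1 ?_
  refine isCompact_K.of_isClosed_subset ?_ KM_le
  exact (isOpen_K F |> (K F).isClosed_of_isOpen).inter
    ((isClosed_eq (continuous_mv _) continuous_const).inter
      (isClosed_eq (continuous_mv _) continuous_const))

lemma wM_mem_KM : wM F ∈ KM F := by
  refine ⟨wM_mem, ?_, ?_⟩ <;> rw [mv_wM] <;> ext i <;> fin_cases i <;> simp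

lemma nM_mem_KM {x : F} (hx : ‖x‖ ≤ 1) : nM x ∈ KM F := by
  refine ⟨nM_mem hx, ?_, ?_⟩ <;> rw [mv_nM] <;> ext i <;> fin_cases i <;> simp

lemma KM_col_zero {k : SO32 F} (hk : k ∈ KM F) (i : Fin 5) :
    entry k i 0 = if i = 0 then 1 else 0 := by
  rw [← mv_single, hk.2.1, Pi.single_apply]

lemma KM_row_four {k : SO32 F} (hk : k ∈ KM F) (j : Fin 5) :
    entry k 4 j = if j = 4 then 1 else 0 := by
  have h := KM_col_zero (inv_mem hk) j.rev
  rw [entry_inv, Fin.rev_rev] at h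
  change entry k 4 j = _ at h
  rw [h]
  congr 1
  rw [eq_iff_iff]
  exact ⟨fun hh => by rw [← Fin.rev_rev j, hh]; rfl, fun hh => by rw [hh]; rfl⟩

lemma entry_KM_mul_four {k : SO32 F} (hk : k ∈ KM F) (g : SO32 F) (j : Fin 5) :
    entry (k * g) 4 j = entry g 4 j := by
  rw [entry_mul, Finset.sum_eq_single 4]
  · rw [KM_row_four hk]; simp
  · intro b _ hb; rw [KM_row_four hk, if_neg hb, zero_mul]
  · simp

lemma wedgeNorm_pos (h2 : ringChar 𝓀[F] ≠ 2) (g : SO32 F) : 0 < wedgeNorm g := by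
  obtain ⟨n, hn, α, β, k, hk, rfl⟩ := exists_iwasawa h2 g
  rw [wedgeNorm_mul hk, ← mul_one (n * torus α β), wedgeNorm_unipotent_torus_mul hn, wedgeNorm_one]
  have ha : 0 < ‖(α : F)‖ := norm_pos_iff.2 α.ne_zero
  have hb : 0 < ‖(β : F)‖ := norm_pos_iff.2 β.ne_zero
  positivity

lemma continuous_wedgeNorm : Continuous (wedgeNorm : SO32 F → ℝ) := by
  refine continuous_norm.comp (continuous_pi fun p => ?_)
  exact ((continuous_entry _ _).mul (continuous_entry _ _)).sub
    ((continuous_entry _ _).mul (continuous_entry _ _))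

lemma continuous_wedgeNorm_inv (h2 : ringChar 𝓀[F] ≠ 2) :
    Continuous fun g : SO32 F => (wedgeNorm g)⁻¹ :=
  continuous_wedgeNorm.inv₀ fun g => (wedgeNorm_pos h2 g).ne'

/-- The behaviour of the norm of an isotropic vector under a diagonal element. -/
lemma norm_middle_torus {ϖ : Fˣ} (h2 : ringChar 𝓀[F] ≠ 2) (hϖ : IsUniformizer ϖ)
    (hϖ1 : ‖(ϖ : F)‖ < 1) {x y z : F} (hQ : 2 * x * z + y ^ 2 = 0) {N : ℝ} (hN : N = ‖![x, y, z]‖)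
    (hN0 : 0 < N) : ‖![(ϖ : F) * x, y, (ϖ : F)⁻¹ * z]‖ =
      if ‖z‖ = N then ‖(ϖ : F)‖⁻¹ * N else ‖(ϖ : F)‖ * N := by
  have hp : 0 < ‖(ϖ : F)‖ := norm_pos_iff.2 ϖ.ne_zero
  have hle : ∀ i, ‖(![x, y, z] : Fin 3 → F) i‖ ≤ N := fun i => hN ▸ norm_le_pi_norm _ i
  have hx : ‖x‖ ≤ N := hle 0
  have hy : ‖y‖ ≤ N := hle 1
  have hz : ‖z‖ ≤ N := hle 2
  have hpi : 1 ≤ ‖(ϖ : F)‖⁻¹ := (one_le_inv₀ hp).2 hϖ1.le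
  have hval : ∀ (C : ℝ), (∃ i, ‖(![(ϖ : F) * x, y, (ϖ : F)⁻¹ * z] : Fin 3 → F) i‖ = C) →
      ‖(ϖ : F) * x‖ ≤ C → ‖y‖ ≤ C → ‖(ϖ : F)⁻¹ * z‖ ≤ C →
      ‖![(ϖ : F) * x, y, (ϖ : F)⁻¹ * z]‖ = C := by
    rintro C ⟨i, hi⟩ h0 h1 h3
    apply le_antisymm
    · rw [pi_norm_le_iff_of_nonneg ((norm_nonneg _).trans h0)]
      intro j
      fin_cases j
      · exact h0
      · exact h1
      · exact h3
    · rw [← hi]; exact norm_le_pi_norm _ i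
  have hlt : ∀ w : F, ‖w‖ < N → ‖w‖ ≤ ‖(ϖ : F)‖ * N := by
    intro w hw
    obtain ⟨i, hi⟩ := (IsGreatest.pi_norm (![x, y, z] : Fin 3 → F)).1
    set e := (![x, y, z] : Fin 3 → F) i
    have hi' : ‖e‖ = N := by rw [hN]; exact hi
    have := norm_le_of_lt_one hϖ (x := w / e) (by rw [norm_div, hi', div_lt_one hN0]; exact hw)
    rwa [norm_div, hi', div_le_iff₀ hN0] at this
  split_ifs with h
  · refine hval _ ⟨2, ?_⟩ ?_ ?_ ?_
    · change ‖(ϖ : F)⁻¹ * z‖ = _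
      rw [norm_mul, norm_inv, h]
    · rw [norm_mul]
      exact mul_le_mul (hϖ1.le.trans hpi) hx (norm_nonneg _) (by positivity)
    · exact hy.trans (le_mul_of_one_le_left hN0.le hpi)
    · rw [norm_mul, norm_inv, h]
  -- By isotropy `‖y‖ ^ 2 = ‖x‖ * ‖z‖`. If `z` is not maximal then neither is `y`, so `x` is.
  -- Discreteness gives `‖y‖ ≤ ‖ϖ‖ N`, hence `‖z‖ ≤ ‖ϖ‖² N`, enough to absorb the factor `ϖ⁻¹`.
  · have hz' := lt_of_le_of_ne hz h
    have hy2 : ‖y‖ ^ 2 = ‖x‖ * ‖z‖ := by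
      have : y ^ 2 = -(2 * x * z) := by linear_combination hQ
      rw [← norm_pow, this, norm_neg, norm_mul, norm_mul, norm_two_eq_one h2, one_mul]
    have hy' : ‖y‖ < N := by
      by_contra hh
      push Not at hh
      have : ‖x‖ * ‖z‖ ≤ N * ‖z‖ := by gcongr
      nlinarith
    have hx' : ‖x‖ = N := by
      obtain ⟨i, hi⟩ := (IsGreatest.pi_norm (![x, y, z] : Fin 3 → F)).1
      rw [hN]
      fin_cases i
      · exact hi
      · rw [hN] at hy'; exact absurd hi hy'.ne
      · rw [hN] at hz'; exact absurd hi hz'.ne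
    have hy'' := hlt y hy'
    refine hval _ ⟨0, ?_⟩ ?_ hy'' ?_
    · change ‖(ϖ : F) * x‖ = _
      rw [norm_mul, hx']
    · rw [norm_mul, hx']
    · rw [norm_mul, norm_inv, inv_mul_le_iff₀ hp]
      rw [hx'] at hy2
      have : N * ‖z‖ ≤ N * (‖(ϖ : F)‖ * (‖(ϖ : F)‖ * N)) := by
        rw [← hy2]
        nlinarith [norm_nonneg y]
      exact le_of_mul_le_mul_left this hN0

/-- The middle part of the fourth row of an element fixing the first and the last basis vectors. -/
lemma wedgeNorm_eq_middle (h2char : ringChar 𝓀[F] ≠ 2) {g : SO32 F} (h4 : ∀ j, entry g 4 j = if j = 4 then 1 else 0)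
    (h30 : entry g 3 0 = 0) : wedgeNorm g = ‖![entry g 3 1, entry g 3 2, entry g 3 3]‖ := by
  have hle : ∀ i, ‖(![entry g 3 1, entry g 3 2, entry g 3 3] : Fin 3 → F) i‖ ≤
    ‖![entry g 3 1, entry g 3 2, entry g 3 3]‖ := fun i => norm_le_pi_norm _ i
  have h1 : ‖entry g 3 1‖ ≤ _ := hle 0
  have h2 : ‖entry g 3 2‖ ≤ _ := hle 1
  have h3 : ‖entry g 3 3‖ ≤ _ := hle 2
  have h0 : ‖entry g 3 0‖ ≤ ‖![entry g 3 1, entry g 3 2, entry g 3 3]‖ := by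
    rw [h30, norm_zero]; exact norm_nonneg _
  have hj : ∀ j, j ≠ 4 → ‖entry g 3 j‖ ≤ ‖![entry g 3 1, entry g 3 2, entry g 3 3]‖ := by
    intro j hj
    fin_cases j
    exacts [h0, h1, h2, h3, absurd rfl hj]
  apply le_antisymm
  · rw [wedgeNorm, pi_norm_le_iff_of_nonneg (norm_nonneg _)]
    rintro ⟨i, j⟩
    simp only [h4]
    by_cases hi : i = 4 <;> by_cases hj' : j = 4
    · subst hi hj'; simp
    · subst hi; simpa [hj'] using hj j hj'
    · subst hj'; simpa [hi] using hj i hi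
    · simp [hi, hj']
  · have key : ∀ j, j ≠ 4 → ‖entry g 3 j‖ ≤ wedgeNorm g := by
      intro j hj
      refine le_trans (le_of_eq ?_) (norm_le_pi_norm (fun p : Fin 5 × Fin 5 =>
        entry g 3 p.1 * entry g 4 p.2 - entry g 3 p.2 * entry g 4 p.1) (j, 4))
      simp [h4, hj]
    refine (pi_norm_le_iff_of_nonneg (wedgeNorm_pos h2char g).le).2 fun i => ?_
    fin_cases i
    exacts [key 1 (by decide), key 2 (by decide), key 3 (by decide)]

end Middle

end

end SO5

namespace SO5

noncomputable section

/-! ### Harmonicity on the tree of the middle `SO(2,1)` -/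

section Harmonic

variable {F : Type*} [NontriviallyNormedField F]

lemma entry_mul_nM (g : SO32 F) (t : F) (i : Fin 5) : entry (g * nM t) i 0 = entry g i 0 ∧
    entry (g * nM t) i 1 = entry g i 1 ∧ entry (g * nM t) i 2 = entry g i 2 - 2 * t * entry g i 1 ∧
    entry (g * nM t) i 3 = entry g i 3 + 2 * t * entry g i 2 - 2 * t ^ 2 * entry g i 1 ∧
    entry (g * nM t) i 4 = entry g i 4 := by
  refine ⟨?_, ?_, ?_, ?_, ?_⟩ <;> rw [entry_mul] <;> simp [entry, nM, Fin.sum_univ_five] <;> ring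

lemma entry_mul_wM (g : SO32 F) (i : Fin 5) : entry (g * wM F) i 0 = entry g i 0 ∧
    entry (g * wM F) i 1 = entry g i 3 ∧ entry (g * wM F) i 2 = -entry g i 2 ∧
    entry (g * wM F) i 3 = entry g i 1 ∧ entry (g * wM F) i 4 = entry g i 4 := by
  refine ⟨?_, ?_, ?_, ?_, ?_⟩ <;> rw [entry_mul] <;> simp [entry, wM, Fin.sum_univ_five]

lemma entry_mul_torus (g : SO32 F) (α β : Fˣ) (i j : Fin 5) : entry (g * torus α β) i j =
    entry g i j * (![(α : F), β, 1, (β : F)⁻¹, (α : F)⁻¹] : Fin 5 → F) j := by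
  rw [entry_mul, Finset.sum_eq_single j]
  · rw [entry_torus, if_pos rfl]
  · intro b _ hb; rw [entry_torus, if_neg hb, mul_zero]
  · simp

/-- The condition that the first column and the last row are those of the identity matrix. -/
def IsMiddle (g : SO32 F) : Prop :=
  (∀ i, entry g i 0 = if i = 0 then 1 else 0) ∧ ∀ j, entry g 4 j = if j = 4 then 1 else 0

lemma IsMiddle.mul {g h : SO32 F} (hg : IsMiddle g) (hh : IsMiddle h) : IsMiddle (g * h) := by
  constructor
  · intro i
    rw [entry_mul, Finset.sum_eq_single 0 (fun b _ hb => by rw [hh.1, if_neg hb, mul_zero])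
      (by simp), hh.1, hg.1]
    simp
  · intro j
    rw [entry_mul, Finset.sum_eq_single 4 (fun b _ hb => by rw [hg.2, if_neg hb, zero_mul])
      (by simp), hh.2, hg.2]
    simp

lemma isMiddle_torus (β : Fˣ) : IsMiddle (torus 1 β) := by
  constructor
  · intro i
    rw [entry_torus]
    split_ifs with h
    · subst h; simp
    · rfl
  · intro j
    rw [entry_torus]
    simp only [eq_comm (a := (4 : Fin 5))]
    split_ifs with h
    · simp
    · rfl

lemma isMiddle_nM (x : F) : IsMiddle (nM x) := by
  constructor
  · intro i
    fin_cases i <;> simp [entry, nM]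
  · intro j
    fin_cases j <;> simp [entry, nM]

/-- The fourth row of `g`, read backwards, is the isotropic vector `g⁻¹ e₁`; the product of its
outer coordinates vanishes because `entry g 3 0 = 0`. -/
lemma IsMiddle.isotropic {g : SO32 F} (hg : IsMiddle g) :
    2 * entry g 3 1 * entry g 3 3 + entry g 3 2 ^ 2 = 0 := by
  have h := Q_mv g⁻¹ (Pi.single 1 1)
  rw [Q_self, Q_self] at h
  simp only [mv_single, entry_inv] at h
  change 2 * entry g 3 4 * entry g 3 0 + 2 * entry g 3 3 * entry g 3 1 + entry g 3 2 ^ 2 = _ at h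
  rw [hg.1 3] at h
  simp at h
  linear_combination h

variable [IsUltrametricDist F]

lemma KM_isMiddle {k : SO32 F} (hk : k ∈ KM F) : IsMiddle k := ⟨KM_col_zero hk, KM_row_four hk⟩

lemma IsMiddle.wedgeNorm_eq (h2 : ringChar 𝓀[F] ≠ 2) {g : SO32 F} (hg : IsMiddle g) :
    wedgeNorm g = ‖![entry g 3 1, entry g 3 2, entry g 3 3]‖ :=
  wedgeNorm_eq_middle h2 hg.2 (by rw [hg.1]; rfl)

lemma IsMiddle.wedgeNorm_mul_torus {ϖ : Fˣ} (h2 : ringChar 𝓀[F] ≠ 2) (hϖ : IsUniformizer ϖ)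
    (hϖ1 : ‖(ϖ : F)‖ < 1) {g : SO32 F} (hg : IsMiddle g) : wedgeNorm (g * torus 1 ϖ) =
      if ‖entry g 3 3‖ = wedgeNorm g then ‖(ϖ : F)‖⁻¹ * wedgeNorm g else ‖(ϖ : F)‖ * wedgeNorm g := by
  rw [← norm_middle_torus h2 hϖ hϖ1 hg.isotropic (hg.wedgeNorm_eq h2) (wedgeNorm_pos h2 g),
    (hg.mul (isMiddle_torus ϖ)).wedgeNorm_eq h2]
  congr 1
  ext i
  simp only [entry_mul_torus]
  fin_cases i <;> simp [mul_comm]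

/-- The function `wedgeNorm⁻¹` is harmonic on the tree of the middle `SO(2,1)`. -/
lemma IsMiddle.harmonic [Fintype 𝓀[F]] {ϖ : Fˣ} (h2 : ringChar 𝓀[F] ≠ 2) (hϖ : IsUniformizer ϖ)
    (hnorm : ‖(ϖ : F)‖ = (q F : ℝ)⁻¹) {σ : 𝓀[F] → F} (hσ1 : ∀ x, ‖σ x‖ ≤ 1)
    (hσ : ∀ x, res (σ x) = x) {g : SO32 F} (hg : IsMiddle g) :
    (wedgeNorm (g * wM F * torus 1 ϖ))⁻¹ + ∑ x, (wedgeNorm (g * nM (σ x) * torus 1 ϖ))⁻¹ =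
      (q F + 1) * (wedgeNorm g)⁻¹ := by
  classical
  have hq : (1 : ℝ) < q F := by exact_mod_cast one_lt_q ϖ hnorm
  have hq0 : (q F : ℝ) ≠ 0 := by linarith
  have hcard : (Finset.univ : Finset 𝓀[F]).card = q F := by
    rw [Finset.card_univ, q, Nat.card_eq_fintype_card]
  have hϖ1 : ‖(ϖ : F)‖ < 1 := by rw [hnorm]; exact inv_lt_one_of_one_lt₀ hq
  have hN := wedgeNorm_pos h2 g
  have hNe := hg.wedgeNorm_eq h2
  have hiso := hg.isotropic
  have hw : wedgeNorm (g * wM F) = wedgeNorm g := wedgeNorm_mul wM_mem g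
  have hn : ∀ x, wedgeNorm (g * nM (σ x)) = wedgeNorm g := fun x => wedgeNorm_mul (nM_mem (hσ1 x)) g
  rw [(hg.mul (KM_isMiddle wM_mem_KM)).wedgeNorm_mul_torus h2 hϖ hϖ1, hw, (entry_mul_wM g 3).2.2.2.1]
  simp only [fun x => (hg.mul (isMiddle_nM (σ x))).wedgeNorm_mul_torus h2 hϖ hϖ1, hn,
    fun x => (entry_mul_nM g (σ x) 3).2.2.2.1]
  have hle : ∀ i, ‖(![entry g 3 1, entry g 3 2, entry g 3 3] : Fin 3 → F) i‖ ≤ wedgeNorm g :=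
    fun i => hNe ▸ norm_le_pi_norm _ i
  have hx : ‖entry g 3 1‖ ≤ _ := hle 0
  have hy : ‖entry g 3 2‖ ≤ _ := hle 1
  have hz : ‖entry g 3 3‖ ≤ _ := hle 2
  obtain ⟨i, hi⟩ := (IsGreatest.pi_norm (![entry g 3 1, entry g 3 2, entry g 3 3] : Fin 3 → F)).1
  rw [← hNe] at hi
  have hi' : ‖entry g 3 1‖ = wedgeNorm g ∨ ‖entry g 3 2‖ = wedgeNorm g ∨
      ‖entry g 3 3‖ = wedgeNorm g := by
    fin_cases i
    exacts [Or.inl hi, Or.inr (Or.inl hi), Or.inr (Or.inr hi)]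
  clear hi hle hNe
  generalize entry g 3 1 = x at *
  generalize entry g 3 2 = y at *
  generalize entry g 3 3 = z at *
  generalize wedgeNorm g = N at *
  have hy2 : ‖y‖ ^ 2 = ‖x‖ * ‖z‖ := by
    have : y ^ 2 = -(2 * x * z) := by linear_combination hiso
    rw [← norm_pow, this, norm_neg, norm_mul, norm_mul, norm_two_eq_one h2, one_mul]
  -- In both cases exactly one of the `q + 1` neighbours divides `wedgeNorm` by `q` and the other
  -- `q` multiply it by `q`; the inverses sum to `(q + q · q⁻¹) N⁻¹`. The exceptional neighbour is
  -- one of the unipotent ones if `‖x‖ = N`, and the Weyl one otherwise.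
  by_cases hxN : ‖x‖ = N
  · have hx0 : x ≠ 0 := by rw [← norm_pos_iff, hxN]; exact hN
    have h20 := two_ne_zero_of_ringChar h2
    have hyx : ‖y / (2 * x)‖ ≤ 1 := by
      rw [norm_div, norm_mul, norm_two_eq_one h2, one_mul, hxN]
      exact div_le_one_of_le₀ hy hN.le
    have hcond : ∀ t : 𝓀[F], ‖z + 2 * σ t * y - 2 * σ t ^ 2 * x‖ = N ↔ t ≠ res (y / (2 * x)) := by
      intro t
      -- By isotropy the quadratic polynomial in `σ t` has a double root, so exactly one residue
      -- class is exceptional.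
      have e : z + 2 * σ t * y - 2 * σ t ^ 2 * x = -(2 * x * (y / (2 * x) - σ t) ^ 2) := by
        field_simp
        linear_combination hiso
      have hs : ‖y / (2 * x) - σ t‖ ≤ 1 := norm_sub_le_of hyx (hσ1 t)
      have hr : ‖y / (2 * x) - σ t‖ = 1 ↔ res (y / (2 * x)) ≠ t := by
        rw [← res_ne_zero_iff hs, res_sub hyx (hσ1 t), hσ, sub_ne_zero]
      rw [e, norm_neg, norm_mul, norm_mul, norm_two_eq_one h2, one_mul, hxN, norm_pow, ne_comm,
        ← hr]
      constructor
      · intro h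
        have : ‖y / (2 * x) - σ t‖ ^ 2 = 1 := by
          apply mul_left_cancel₀ hN.ne'
          rw [h, mul_one]
        exact (pow_eq_one_iff_of_nonneg (norm_nonneg _) two_ne_zero).1 this
      · intro h; rw [h]; ring
    have hsum : ∑ t : 𝓀[F], (if ‖z + 2 * σ t * y - 2 * σ t ^ 2 * x‖ = N then ‖(ϖ : F)‖⁻¹ * N
        else ‖(ϖ : F)‖ * N)⁻¹ =
        ∑ t : 𝓀[F], ((q F * N)⁻¹ + if t = res (y / (2 * x)) then q F * N⁻¹ - (q F * N)⁻¹ else 0) := by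
      refine Finset.sum_congr rfl fun t _ => ?_
      rw [hnorm]
      by_cases ht : t = res (y / (2 * x))
      · rw [if_neg (fun h => (hcond t).1 h ht), if_pos ht]
        field_simp
        ring
      · rw [if_pos ((hcond t).2 ht), if_neg ht]
        field_simp
        ring
    rw [if_pos hxN, hsum, Finset.sum_add_distrib, Finset.sum_const, hcard, Finset.sum_ite_eq' ,
      if_pos (Finset.mem_univ _), hnorm]
    simp only [nsmul_eq_mul]
    field_simp
    ring
  · have hx' := lt_of_le_of_ne hx hxN
    have hy' : ‖y‖ < N := by
      by_contra hh
      push Not at hh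
      have : ‖x‖ * ‖z‖ ≤ ‖x‖ * N := by gcongr
      nlinarith
    have hz' : ‖z‖ = N := by
      rcases hi' with h | h | h
      exacts [absurd h hxN, absurd h hy'.ne, h]
    have hcond : ∀ t : 𝓀[F], ‖z + 2 * σ t * y - 2 * σ t ^ 2 * x‖ = N := by
      intro t
      have e : z + 2 * σ t * y - 2 * σ t ^ 2 * x = z + (2 * σ t * y + -(2 * σ t ^ 2) * x) := by ring
      have h1 : ‖2 * σ t * y‖ < N := by
        rw [norm_mul]
        exact (mul_le_of_le_one_left (norm_nonneg _)
          (norm_mul_le_one norm_two_le_one (hσ1 t))).trans_lt hy'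
      have h3 : ‖-(2 * σ t ^ 2) * x‖ < N := by
        rw [norm_mul, norm_neg]
        exact (mul_le_of_le_one_left (norm_nonneg _)
          (norm_mul_le_one norm_two_le_one (norm_sq_le_one (hσ1 t)))).trans_lt hx'
      have h4 := norm_add_lt_of h1 h3
      rw [e, IsUltrametricDist.norm_add_eq_max_of_norm_ne_norm (by rw [hz']; exact h4.ne'), hz']
      exact max_eq_left h4.le
    rw [if_neg hxN]
    simp only [hcond, if_true]
    rw [Finset.sum_const, hcard, hnorm]
    simp only [nsmul_eq_mul]
    field_simp

end Harmonic

/-! ### Averages over `KM` are constant on the tree -/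

section MiddleAverage

variable {F : Type*} [NontriviallyNormedField F] [IsUltrametricDist F] [LocallyCompactSpace F]

/-- The average of `wedgeNorm⁻¹` over `KM`. -/
def middleAverage (g : SO32 F) : ℝ := ∫ c : KM F, (wedgeNorm ((c : SO32 F) * g))⁻¹ ∂(haarC (KM F))

lemma middleAverage_right {k : SO32 F} (hk : k ∈ K F) (g : SO32 F) :
    middleAverage (g * k) = middleAverage g := by
  simp only [middleAverage, ← mul_assoc, wedgeNorm_mul hk]

lemma middleAverage_left {k : SO32 F} (hk : k ∈ KM F) (g : SO32 F) :
    middleAverage (k * g) = middleAverage g := by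
  have := integral_mul_right_eq_self (μ := haarC (KM F))
    (fun c : KM F => (wedgeNorm ((c : SO32 F) * g))⁻¹) ⟨k, hk⟩
  rw [middleAverage, middleAverage, ← this]
  simp only [Subgroup.coe_mul, mul_assoc]

lemma middleAverage_of_mem {k : SO32 F} (hk : k ∈ K F) : middleAverage k = 1 := by
  rw [← one_mul k, middleAverage_right hk, middleAverage]
  simp only [mul_one, fun c : KM F => wedgeNorm_of_mem c.2.1]
  simp

lemma integrable_wedgeNorm_inv (h2 : ringChar 𝓀[F] ≠ 2) (g : SO32 F) :
    Integrable (fun c : KM F => (wedgeNorm ((c : SO32 F) * g))⁻¹) (haarC (KM F)) := by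
  have : Continuous fun c : KM F => (wedgeNorm ((c : SO32 F) * g))⁻¹ :=
    (continuous_wedgeNorm_inv h2).comp (continuous_subtype_val.mul continuous_const)
  exact this.integrable_of_hasCompactSupport (HasCompactSupport.of_compactSpace _)

lemma middleAverage_torus_inv (β : Fˣ) :
    middleAverage (torus 1 β⁻¹) = middleAverage (torus 1 β) := by
  rw [← middleAverage_right wM_mem, ← wM_mul_torus, middleAverage_left wM_mem_KM]

/-- The average of `IsMiddle.harmonic` over `KM`. Left invariance under `KM` identifies the `q`
unipotent neighbours with `ϖ ^ (n + 1)`. The Weyl neighbour becomes `ϖ ^ (1 - n)`, which for `n ≥ 1`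
is the one nearer to the origin, up to inversion. -/
lemma middleAverage_torus_rec (h2 : ringChar 𝓀[F] ≠ 2) {ϖ : Fˣ} (hϖ : IsUniformizer ϖ)
    (hnorm : ‖(ϖ : F)‖ = (q F : ℝ)⁻¹) (n : ℕ) :
    middleAverage (torus 1 ((ϖ ^ n)⁻¹ * ϖ)) + q F * middleAverage (torus 1 (ϖ ^ (n + 1))) =
      (q F + 1) * middleAverage (torus 1 (ϖ ^ n)) := by
  have hfin := finite_residueField ϖ hnorm
  have := Fintype.ofFinite 𝓀[F]
  have hcard : (Finset.univ : Finset 𝓀[F]).card = q F := by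
    rw [Finset.card_univ, q, Nat.card_eq_fintype_card]
  have hϖ1 : ‖(ϖ : F)‖ < 1 := by
    rw [hnorm]; exact inv_lt_one_of_one_lt₀ (by exact_mod_cast one_lt_q ϖ hnorm)
  choose σ hσ1 hσ using exists_res_eq (F := F)
  have key : middleAverage (torus 1 (ϖ ^ n) * wM F * torus 1 ϖ) +
      ∑ x, middleAverage (torus 1 (ϖ ^ n) * nM (σ x) * torus 1 ϖ) =
      (q F + 1) * middleAverage (torus 1 (ϖ ^ n)) := by
    simp only [middleAverage]
    rw [← integral_const_mul, ← integral_finsetSum _ fun x _ => integrable_wedgeNorm_inv h2 _,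
      ← integral_add (integrable_wedgeNorm_inv h2 _)
      (integrable_finsetSum _ fun x _ => integrable_wedgeNorm_inv h2 _)]
    congr 1
    ext c
    rw [← ((KM_isMiddle c.2).mul (isMiddle_torus _)).harmonic h2 hϖ hnorm hσ1 hσ]
    simp only [mul_assoc]
  rw [← key]
  congr 1
  · have : torus 1 (ϖ ^ n) * wM F = wM F * torus 1 (ϖ ^ n)⁻¹ := by
      rw [wM_mul_torus, inv_inv]
    rw [this, mul_assoc, torus_mul, mul_one, middleAverage_left wM_mem_KM]
  · have : ∀ x, middleAverage (torus 1 (ϖ ^ n) * nM (σ x) * torus 1 ϖ) =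
        middleAverage (torus 1 (ϖ ^ (n + 1))) := by
      intro x
      have e : torus 1 (ϖ ^ n) * nM (σ x) = nM ((ϖ ^ n : Fˣ) * σ x) * torus 1 (ϖ ^ n) := by
        rw [nM_mul_torus, mul_div_cancel_left₀ _ (Units.ne_zero _)]
      rw [e, mul_assoc, torus_mul, mul_one, middleAverage_left, pow_succ]
      refine nM_mem_KM (norm_mul_le_one ?_ (hσ1 x))
      rw [Units.val_pow_eq_pow_val, norm_pow]
      exact pow_le_one₀ (norm_nonneg _) hϖ1.le
    rw [Finset.sum_congr rfl fun x _ => this x, Finset.sum_const, hcard, nsmul_eq_mul]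

/-- A radial harmonic function on a tree is constant: at the origin all `q + 1` neighbours carry the
same value, and the recurrence propagates the constant outwards. -/
lemma middleAverage_torus_pow (h2 : ringChar 𝓀[F] ≠ 2) {ϖ : Fˣ} (hϖ : IsUniformizer ϖ)
    (hnorm : ‖(ϖ : F)‖ = (q F : ℝ)⁻¹) (n : ℕ) : middleAverage (torus 1 (ϖ ^ n)) = 1 := by
  have hq : (1 : ℝ) < q F := by exact_mod_cast one_lt_q ϖ hnorm
  have h0 : middleAverage (torus 1 (ϖ ^ 0)) = 1 := middleAverage_of_mem (by
    rw [pow_zero]; exact torus_mem (by simp) (by simp))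
  have hboth : ∀ n : ℕ, middleAverage (torus 1 (ϖ ^ n)) = 1 ∧
      middleAverage (torus 1 (ϖ ^ (n + 1))) = 1 := by
    intro n
    induction n with
    | zero =>
      refine ⟨h0, ?_⟩
      have h := middleAverage_torus_rec h2 hϖ hnorm 0
      rw [h0, pow_zero, inv_one, one_mul, zero_add, pow_one] at h
      rw [zero_add, pow_one]
      have : (1 + (q F : ℝ)) * middleAverage (torus 1 ϖ) = (1 + (q F : ℝ)) * 1 := by
        linear_combination h
      exact mul_left_cancel₀ (by positivity) this
    | succ n ih =>
      refine ⟨ih.2, ?_⟩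
      have h := middleAverage_torus_rec h2 hϖ hnorm (n + 1)
      have e : (ϖ ^ (n + 1))⁻¹ * ϖ = (ϖ ^ n)⁻¹ := by rw [pow_succ]; group
      rw [e, middleAverage_torus_inv, ih.1, ih.2] at h
      have : (q F : ℝ) * middleAverage (torus 1 (ϖ ^ (n + 1 + 1))) = (q F : ℝ) * 1 := by
        linear_combination h
      exact mul_left_cancel₀ (by positivity) this
  exact (hboth n).1

lemma middleAverage_torus (h2 : ringChar 𝓀[F] ≠ 2) {ϖ : Fˣ} (hϖ : IsUniformizer ϖ)
    (hnorm : ‖(ϖ : F)‖ = (q F : ℝ)⁻¹) (β : Fˣ) : middleAverage (torus 1 β) = 1 := by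
  obtain ⟨n, hn⟩ := exists_norm_eq_zpow hϖ hnorm β.ne_zero
  have hq : (1 : ℝ) < q F := by exact_mod_cast one_lt_q ϖ hnorm
  have hu : ‖((ϖ ^ n * β : Fˣ) : F)‖ = 1 := by
    rw [Units.val_mul, Units.val_zpow_eq_zpow_val, norm_mul, norm_zpow, hnorm, hn, inv_zpow,
      inv_mul_cancel₀]
    positivity
  have e : torus 1 β = torus 1 (ϖ ^ n)⁻¹ * torus 1 (ϖ ^ n * β) := by
    rw [torus_mul]; congr 1 <;> simp
  rw [e, middleAverage_right (torus_mem (by simp) hu), middleAverage_torus_inv]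
  obtain ⟨m, rfl | rfl⟩ := n.eq_nat_or_neg
  · rw [zpow_natCast]; exact middleAverage_torus_pow h2 hϖ hnorm m
  · rw [zpow_neg, middleAverage_torus_inv, zpow_natCast]
    exact middleAverage_torus_pow h2 hϖ hnorm m

/-- If `‖x‖ ≤ 1` the unipotent is absorbed by `KM` on the left. If `‖x‖ ≤ ‖β‖` it passes the torus
and is absorbed by `K` on the right. Otherwise `nM_eq` applies, and its outer factors are absorbed
in the same way. -/
lemma middleAverage_nM_mul_torus (h2 : ringChar 𝓀[F] ≠ 2) {ϖ : Fˣ} (hϖ : IsUniformizer ϖ)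
    (hnorm : ‖(ϖ : F)‖ = (q F : ℝ)⁻¹) (x : F) (β : Fˣ) : middleAverage (nM x * torus 1 β) = 1 := by
  by_cases h1 : ‖x‖ ≤ 1
  · rw [middleAverage_left (nM_mem_KM h1), middleAverage_torus h2 hϖ hnorm]
  by_cases h3 : ‖x‖ ≤ ‖(β : F)‖
  · rw [nM_mul_torus, middleAverage_right, middleAverage_torus h2 hϖ hnorm]
    apply nM_mem
    rw [norm_div]
    exact div_le_one_of_le₀ h3 (norm_nonneg _)
  push Not at h1 h3
  have h20 := two_ne_zero_of_ringChar h2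
  have hx0 : x ≠ 0 := by rw [← norm_pos_iff]; linarith
  have hτ0 : -(2 * x ^ 2) ≠ 0 := by simp [h20, hx0]
  have hnx : ‖1 / (2 * x)‖ = ‖x‖⁻¹ := by
    rw [norm_div, norm_mul, norm_two_eq_one h2, norm_one, one_mul, one_div]
  set y := 1 / (2 * x) with hy
  have e : nM x * torus 1 β = (wM F * nM y) * (torus 1 ((Units.mk0 _ hτ0)⁻¹ * β) *
      (wM F * nM (y * β) * wM F)) := by
    have hw : wM F * torus 1 β = torus 1 β⁻¹ * wM F := wM_mul_torus β
    have hw' : wM F * torus 1 β⁻¹ = torus 1 β * wM F := by rw [wM_mul_torus, inv_inv]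
    have hn : nM y * torus 1 β⁻¹ = torus 1 β⁻¹ * nM (y * β) := by
      rw [nM_mul_torus]; congr 2; simp
    have h0 : nM x = wM F * nM y * torus 1 (Units.mk0 _ hτ0)⁻¹ * wM F * nM y * wM F :=
      nM_eq h20 (Units.mk0 x hx0) (Units.mk0 _ hτ0) rfl
    calc nM x * torus 1 β = wM F * nM y * torus 1 (Units.mk0 _ hτ0)⁻¹ * (wM F * (nM y *
          (wM F * torus 1 β))) := by rw [h0]; simp only [mul_assoc]
      _ = wM F * nM y * torus 1 (Units.mk0 _ hτ0)⁻¹ * (wM F * ((nM y * torus 1 β⁻¹) * wM F)) := by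
          rw [hw]; simp only [mul_assoc]
      _ = wM F * nM y * torus 1 (Units.mk0 _ hτ0)⁻¹ * ((wM F * torus 1 β⁻¹) * nM (y * β) * wM F) := by
          rw [hn]; simp only [mul_assoc]
      _ = wM F * nM y * ((torus 1 (Units.mk0 _ hτ0)⁻¹ * torus 1 β) * (wM F * nM (y * β) * wM F)) := by
          rw [hw']; simp only [mul_assoc]
      _ = _ := by rw [torus_mul, mul_one]
  rw [e, middleAverage_left, middleAverage_right, middleAverage_torus h2 hϖ hnorm]
  · refine mul_mem (mul_mem wM_mem (nM_mem ?_)) wM_mem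
    rw [norm_mul, hnx, inv_mul_le_iff₀ (by linarith)]
    linarith
  · refine mul_mem wM_mem_KM (nM_mem_KM ?_)
    rw [hnx]
    exact inv_le_one_of_one_le₀ h1.le

end MiddleAverage

end

end SO5

namespace SO5

noncomputable section

/-! ### The Satake transform as an integral over the last row -/

section Reflection

variable {F : Type*} [NontriviallyNormedField F] [IsUltrametricDist F] [LocallyCompactSpace F]

/-- An upper triangular element of `G` has the same middle block as an element `nM x * torus 1 β`. -/
lemma wedgeNorm_KM_mul_upper (h2 : ringChar 𝓀[F] ≠ 2) {n : SO32 F} (hn : n ∈ N₀ F) (α β : Fˣ) :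
    ∃ x : F, ∀ c ∈ KM F, wedgeNorm (c * (n * torus α β)) =
      ‖(α : F)⁻¹‖ * wedgeNorm (c * (nM x * torus 1 β)) := by
  have h20 := two_ne_zero_of_ringChar h2
  have hβ := β.ne_zero
  set b := n * torus α β with hb
  have hent : ∀ i j, entry b i j =
      entry n i j * (![(α : F), β, 1, (β : F)⁻¹, (α : F)⁻¹] : Fin 5 → F) j :=
    fun i j => entry_mul_torus n α β i j
  have hu : ∀ i j, j < i → entry b i j = 0 := fun i j hij => by rw [hent, hn.2 i j hij, zero_mul]
  have h11 : entry b 1 1 = β := by rw [hent, hn.1]; simp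
  have h22 : entry b 2 2 = 1 := by rw [hent, hn.1]; simp
  have h33 : entry b 3 3 = (β : F)⁻¹ := by rw [hent, hn.1]; simp
  have h44 : entry b 4 4 = (α : F)⁻¹ := by rw [hent, hn.1]; simp
  have e1 := orthogonality b 2 3
  have e2 := orthogonality b 1 3
  rw [Fin.sum_univ_five] at e1 e2
  change entry b 4 2 * entry b 0 3 + entry b 3 2 * entry b 1 3 + entry b 2 2 * entry b 2 3 +
    entry b 1 2 * entry b 3 3 + entry b 0 2 * entry b 4 3 = 0 at e1
  change entry b 4 3 * entry b 0 3 + entry b 3 3 * entry b 1 3 + entry b 2 3 * entry b 2 3 +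
    entry b 1 3 * entry b 3 3 + entry b 0 3 * entry b 4 3 = 0 at e2
  rw [hu 4 2 (by decide), hu 3 2 (by decide), hu 4 3 (by decide), h22, h33] at e1
  rw [hu 4 3 (by decide), h33] at e2
  -- Orthogonality expresses the middle block through `β` and the entry `(2, 3)`. The parameter `x`
  -- is chosen to match that entry, which for `nM x * torus 1 β` equals `2x / β`.
  have h12 : entry b 1 2 = -(β * entry b 2 3) := by
    field_simp at e1
    linear_combination e1
  have h13 : entry b 1 3 = -(β * entry b 2 3 ^ 2 / 2) := by
    field_simp at e2 ⊢
    linear_combination e2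
  refine ⟨entry b 2 3 * β / 2, fun c hc => ?_⟩
  set m := nM (entry b 2 3 * β / 2) * torus 1 β with hm
  have hmm : IsMiddle m := (isMiddle_nM _).mul (isMiddle_torus β)
  have hment : ∀ i j, entry m i j = entry (nM (entry b 2 3 * β / 2)) i j *
      (![((1 : Fˣ) : F), β, 1, (β : F)⁻¹, ((1 : Fˣ) : F)⁻¹] : Fin 5 → F) j :=
    fun i j => entry_mul_torus _ 1 β i j
  have hmid : ∀ j, j ≠ 4 → entry b 1 j = entry m 1 j ∧ entry b 2 j = entry m 2 j ∧
      entry b 3 j = entry m 3 j := by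
    intro j hj
    simp only [hment]
    fin_cases j
    · refine ⟨?_, ?_, ?_⟩ <;> rw [hu _ _ (by decide)] <;> simp [entry, nM]
    · refine ⟨h11.trans ?_, (hu _ _ (by decide)).trans ?_, (hu _ _ (by decide)).trans ?_⟩ <;>
        simp [entry, nM]
    · refine ⟨h12.trans ?_, h22.trans ?_, (hu _ _ (by decide)).trans ?_⟩ <;> simp [entry, nM]
      field_simp
    · refine ⟨h13.trans ?_, Eq.trans (b := entry b 2 3) rfl ?_, h33.trans ?_⟩
      · simp only [entry, nM]
        simp
        field_simp
      · generalize entry b 2 3 = y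
        simp only [entry, nM]
        simp
        field_simp
      · simp [entry, nM]
    · exact absurd rfl hj
  have hb4 : ∀ j, j ≠ 4 → entry b 4 j = 0 := fun j hj => hu 4 j (lt_of_le_of_ne (Fin.le_last j) hj)
  refine wedgeNorm_congr (fun j hj => ?_) (fun j hj => ?_) (fun j hj => ?_) ?_
  · rw [entry_KM_mul_four hc, hb4 j hj]
  · rw [entry_KM_mul_four hc, hmm.2, if_neg hj]
  · rw [entry_mul, entry_mul, Fin.sum_univ_five, Fin.sum_univ_five, KM_col_zero hc, hb4 j hj,
      hmm.2 j, if_neg hj, (hmid j hj).1, (hmid j hj).2.1, (hmid j hj).2.2]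
    simp
  · rw [entry_KM_mul_four hc, entry_KM_mul_four hc, h44, hmm.2]
    simp

/-- Both factors are right `K`-invariant. On an upper triangular element the first is `|α|⁻¹`, and
the second is `|α|` times a middle average equal to `1`. -/
lemma rowNorm_mul_middleAverage (h2 : ringChar 𝓀[F] ≠ 2) {ϖ : Fˣ} (hϖ : IsUniformizer ϖ)
    (hnorm : ‖(ϖ : F)‖ = (q F : ℝ)⁻¹) (g : SO32 F) : rowNorm g * middleAverage g = 1 := by
  obtain ⟨n, hn, α, β, k, hk, rfl⟩ := exists_iwasawa h2 g
  rw [rowNorm_mul hk, middleAverage_right hk]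
  obtain ⟨x, hx⟩ := wedgeNorm_KM_mul_upper h2 hn α β
  have h1 : middleAverage (n * torus α β) = ‖(α : F)‖ * middleAverage (nM x * torus 1 β) := by
    rw [middleAverage, middleAverage, ← integral_const_mul]
    congr 1
    ext c
    rw [hx c c.2, norm_inv, mul_inv, inv_inv]
  rw [h1, middleAverage_nM_mul_torus h2 hϖ hnorm, ← mul_one (n * torus α β),
    rowNorm_unipotent_torus_mul hn, rowNorm_one]
  have ha : ‖(α : F)‖ ≠ 0 := norm_ne_zero_iff.2 α.ne_zero
  field_simp

lemma rowNorm_KM_mul {c : SO32 F} (hc : c ∈ KM F) (g : SO32 F) : rowNorm (c * g) = rowNorm g := by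
  simp only [rowNorm, entry_KM_mul_four hc]

/-- The Satake transform at `π_ζ` in terms of a function of the last row alone. -/
lemma satake_eq_integral_phiP (h2 : ringChar 𝓀[F] ≠ 2) {ϖ : Fˣ} (hϖ : IsUniformizer ϖ)
    (hnorm : ‖(ϖ : F)‖ = (q F : ℝ)⁻¹) (μ : Measure (SO32 F)) [μ.IsHaarMeasure] (ζ : ℂ)
    (f : sphericalHecke F) : satake μ ζ (1 / 2 + ζ) f = ∫ g, f.1 g * phiP ζ g ∂μ := by
  rw [satake_eq h2, integral_hecke_average_left KM_le μ f (isLocallyConstant_phiB ζ).continuous]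
  congr 1
  ext g
  congr 1
  have h1 : ∀ c : KM F, phiB ζ ((c : SO32 F) * g) =
      (rowNorm g : ℂ) ^ (-(1 / 2 + ζ)) * (((wedgeNorm ((c : SO32 F) * g))⁻¹ : ℝ) : ℂ) := by
    intro c
    rw [phiB, rowNorm_KM_mul c.2, Complex.ofReal_inv, div_eq_mul_inv]
  have hr := rowNorm_mul_middleAverage h2 hϖ hnorm g
  have hr0 : (rowNorm g : ℂ) ≠ 0 := by exact_mod_cast (rowNorm_pos g).ne'
  simp only [h1]
  rw [integral_const_mul, integral_complex_ofReal]
  change _ * ((middleAverage g : ℝ) : ℂ) = _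
  rw [eq_inv_of_mul_eq_one_right hr, phiP, Complex.ofReal_inv, ← Complex.cpow_neg_one,
    ← Complex.cpow_add _ _ hr0]
  congr 1
  ring

end Reflection

end

end SO5

namespace SO5

noncomputable section

/-! ### Counting points on quadrics over the residue field -/

section Counting

variable {k : Type*} [Field k]

/-- The quadratic form over the residue field. -/
def Qres (y : Fin 5 → k) : k := 2 * y 0 * y 4 + 2 * y 1 * y 3 + y 2 ^ 2

open scoped Classical in
/-- A function on `k⁵` depending only on the relative position to the standard flag. -/
def flagValue (A B C : ℂ) (y : Fin 5 → k) : ℂ :=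
  if y 4 ≠ 0 then A else if y 1 = 0 ∧ y 2 = 0 ∧ y 3 = 0 then C else B

/-- This and the next four equivalences stratify the quadric by its last nonzero coordinates. Where
such a coordinate belongs to a hyperbolic pair and its partner is not yet determined to vanish, the
equation is linear in the partner. -/
def equivLastNeZero (h2 : (2 : k) ≠ 0) (a : k) :
    {y : Fin 5 → k // y 4 ≠ 0 ∧ Qres y = a} ≃ {z : k // z ≠ 0} × k × k × k where
  toFun y := (⟨y.1 4, y.2.1⟩, y.1 1, y.1 2, y.1 3)
  invFun p := ⟨![(a - 2 * p.2.1 * p.2.2.2 - p.2.2.1 ^ 2) / (2 * p.1.1), p.2.1, p.2.2.1, p.2.2.2,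
    p.1.1], p.1.2, by
      have := p.1.2
      simp [Qres]
      field_simp
      ring⟩
  left_inv y := by
    obtain ⟨y, h4, rfl⟩ := y
    ext i
    fin_cases i <;> simp [Qres]
    field_simp
    ring
  right_inv p := rfl

def equivFourthNeZero (h2 : (2 : k) ≠ 0) (a : k) :
    {y : Fin 5 → k // y 4 = 0 ∧ y 3 ≠ 0 ∧ Qres y = a} ≃ {z : k // z ≠ 0} × k × k where
  toFun y := (⟨y.1 3, y.2.2.1⟩, y.1 0, y.1 2)
  invFun p := ⟨![p.2.1, (a - p.2.2 ^ 2) / (2 * p.1.1), p.2.2, p.1.1, 0], rfl, p.1.2, by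
      have := p.1.2
      simp [Qres]
      field_simp
      ring⟩
  left_inv y := by
    obtain ⟨y, h4, h3, rfl⟩ := y
    ext i
    fin_cases i <;> simp [Qres, h4]
    field_simp
  right_inv p := rfl

def equivSquareRoots (a : k) :
    {y : Fin 5 → k // y 4 = 0 ∧ y 3 = 0 ∧ Qres y = a} ≃ {z : k // z ^ 2 = a} × k × k where
  toFun y := (⟨y.1 2, by
    obtain ⟨y, h4, h3, rfl⟩ := y
    simp [Qres, h4, h3]⟩, y.1 0, y.1 1)
  invFun p := ⟨![p.2.1, p.2.2, p.1.1, 0, 0], rfl, rfl, by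
      have := p.1.2
      simp [Qres, this]⟩
  left_inv y := by
    obtain ⟨y, h4, h3, rfl⟩ := y
    ext i
    fin_cases i <;> simp [h4, h3]
  right_inv p := rfl

def equivSecondNeZero :
    {y : Fin 5 → k // y 4 = 0 ∧ y 3 = 0 ∧ y 1 ≠ 0 ∧ Qres y = 0} ≃ {z : k // z ≠ 0} × k where
  toFun y := (⟨y.1 1, y.2.2.2.1⟩, y.1 0)
  invFun p := ⟨![p.2, p.1.1, 0, 0, 0], rfl, rfl, p.1.2, by simp [Qres]⟩
  left_inv y := by
    obtain ⟨y, h4, h3, h1, h0⟩ := y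
    simp [Qres, h4, h3] at h0
    ext i
    fin_cases i <;> simp [h4, h3, h0]
  right_inv p := rfl

def equivFirstNeZero :
    {y : Fin 5 → k // y 4 = 0 ∧ y 3 = 0 ∧ y 1 = 0 ∧ y 0 ≠ 0 ∧ Qres y = 0} ≃ {z : k // z ≠ 0} where
  toFun y := ⟨y.1 0, y.2.2.2.2.1⟩
  invFun p := ⟨![p.1, 0, 0, 0, 0], rfl, rfl, rfl, p.2, by simp [Qres]⟩
  left_inv y := by
    obtain ⟨y, h4, h3, h1, h00, h0⟩ := y
    simp [Qres, h4, h3] at h0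
    ext i
    fin_cases i <;> simp [h4, h3, h0, h1]
  right_inv p := rfl

variable [Fintype k]

open scoped Classical in
/-- The nonzero vectors on which the quadratic form takes the value `a`. -/
def quadric (a : k) : Finset (Fin 5 → k) := {y | y ≠ 0 ∧ Qres y = a}

lemma mem_quadric {a : k} {y : Fin 5 → k} : y ∈ quadric a ↔ y ≠ 0 ∧ Qres y = a := by
  simp [quadric]

lemma card_ne_zero' : Nat.card {z : k // z ≠ 0} = Nat.card k - 1 := by
  classical
  rw [Nat.card_eq_fintype_card, Fintype.card_subtype_compl, Fintype.card_subtype_eq,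
    Nat.card_eq_fintype_card]

lemma cast_card_ne_zero : (Nat.card {z : k // z ≠ 0} : ℂ) = Nat.card k - 1 := by
  rw [card_ne_zero', Nat.cast_sub Nat.card_pos, Nat.cast_one]

lemma sum_filter_const {Y : Type*} [Fintype Y] (p : Y → Prop) [DecidablePred p] (A : ℂ) :
    ∑ y, (if p y then A else 0) = Nat.card {y // p y} * A := by
  rw [← Finset.sum_filter, Finset.sum_const, nsmul_eq_mul, Nat.card_eq_fintype_card,
    Fintype.card_subtype]

/-- The strata have `(q-1)q³`, `(q-1)q²`, `(q-1)q` and `q-1` points. An isotropic vector with `y 3 =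
y 4 = 0` also has `y 2 = 0`, so there is no further stratum. -/
lemma sum_flagValue_zero (h2 : (2 : k) ≠ 0) (A B C : ℂ) :
    ∑ y ∈ quadric (0 : k), flagValue A B C y =
      ((Nat.card k : ℂ) - 1) * (Nat.card k ^ 3 * A + (Nat.card k ^ 2 + Nat.card k) * B + C) := by
  classical
  have key : ∑ y ∈ quadric (0 : k), flagValue A B C y = ∑ y : Fin 5 → k,
      ((if y 4 ≠ 0 ∧ Qres y = 0 then A else 0) +
      (if y 4 = 0 ∧ y 3 ≠ 0 ∧ Qres y = 0 then B else 0) +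
      (if y 4 = 0 ∧ y 3 = 0 ∧ y 1 ≠ 0 ∧ Qres y = 0 then B else 0) +
      (if y 4 = 0 ∧ y 3 = 0 ∧ y 1 = 0 ∧ y 0 ≠ 0 ∧ Qres y = 0 then C else 0)) := by
    rw [quadric, Finset.sum_filter]
    refine Finset.sum_congr rfl fun y _ => ?_
    rw [flagValue]
    by_cases hQ : Qres y = 0
    · by_cases h4 : y 4 = 0
      · by_cases h3 : y 3 = 0
        · have hy2 : y 2 = 0 := by simpa [Qres, h4, h3] using hQ
          by_cases h1 : y 1 = 0
          · by_cases h0 : y 0 = 0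
            · have : y = 0 := by
                ext i; fin_cases i <;> simp [*]
              simp [this]
            · have : y ≠ 0 := fun h => h0 (by rw [h]; rfl)
              simp [*]
          · have : y ≠ 0 := fun h => h1 (by rw [h]; rfl)
            simp [*]
        · have : y ≠ 0 := fun h => h3 (by rw [h]; rfl)
          simp [*]
      · have : y ≠ 0 := fun h => h4 (by rw [h]; rfl)
        simp [*]
    · simp [hQ]
  rw [key]
  simp only [Finset.sum_add_distrib, sum_filter_const]
  rw [Nat.card_congr (equivLastNeZero h2 0), Nat.card_congr (equivFourthNeZero h2 0),
    Nat.card_congr equivSecondNeZero, Nat.card_congr equivFirstNeZero]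
  simp only [Nat.card_prod, Nat.cast_mul, cast_card_ne_zero]
  ring

/-- The value `C` does not occur, since vectors on the line of the first basis vector are isotropic.
The stratum `y 3 = y 4 = 0` requires a square root of `a`. -/
lemma sum_flagValue_ne_zero (h2 : (2 : k) ≠ 0) {a : k} (ha : a ≠ 0) (A B C : ℂ) :
    ∑ y ∈ quadric a, flagValue A B C y = (Nat.card k : ℂ) ^ 2 *
      (Nat.card k * (Nat.card k - 1) * A + (Nat.card k - 1 + Nat.card {z : k // z ^ 2 = a}) * B) := by
  classical
  have key : ∑ y ∈ quadric a, flagValue A B C y = ∑ y : Fin 5 → k,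
      ((if y 4 ≠ 0 ∧ Qres y = a then A else 0) +
      (if y 4 = 0 ∧ y 3 ≠ 0 ∧ Qres y = a then B else 0) +
      (if y 4 = 0 ∧ y 3 = 0 ∧ Qres y = a then B else 0)) := by
    rw [quadric, Finset.sum_filter]
    refine Finset.sum_congr rfl fun y _ => ?_
    rw [flagValue]
    by_cases hQ : Qres y = a
    · have : y ≠ 0 := by
        rintro rfl
        apply ha
        rw [← hQ]
        simp [Qres]
      by_cases h4 : y 4 = 0
      · by_cases h3 : y 3 = 0
        · have hy2 : y 2 ≠ 0 := by
            intro h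
            apply ha
            rw [← hQ]
            simp [Qres, *]
          simp [*]
        · simp [*]
      · simp [*]
    · simp [hQ]
  rw [key]
  simp only [Finset.sum_add_distrib, sum_filter_const]
  rw [Nat.card_congr (equivLastNeZero h2 a), Nat.card_congr (equivFourthNeZero h2 a),
    Nat.card_congr (equivSquareRoots a)]
  simp only [Nat.card_prod, Nat.cast_mul, cast_card_ne_zero]
  ring

lemma card_quadric_zero (h2 : (2 : k) ≠ 0) : ((quadric (0 : k)).card : ℂ) =
    ((Nat.card k : ℂ) - 1) * (Nat.card k ^ 3 + Nat.card k ^ 2 + Nat.card k + 1) := by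
  have := sum_flagValue_zero h2 1 1 1
  simp only [flagValue, ite_self] at this
  rw [Finset.sum_const, nsmul_eq_mul, mul_one] at this
  rw [this]; ring

lemma card_quadric_ne_zero (h2 : (2 : k) ≠ 0) {a : k} (ha : a ≠ 0) : ((quadric a).card : ℂ) =
    (Nat.card k : ℂ) ^ 2 *
      (Nat.card k * (Nat.card k - 1) + (Nat.card k - 1 + Nat.card {z : k // z ^ 2 = a})) := by
  have := sum_flagValue_ne_zero h2 ha 1 1 1
  simp only [flagValue, ite_self] at this
  rw [Finset.sum_const, nsmul_eq_mul, mul_one] at this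
  rw [this]; ring

end Counting

/-! ### Equidistribution of the reductions of the translates of a primitive vector -/

section Equidistribution

variable {F : Type*} [NontriviallyNormedField F] [IsUltrametricDist F]

/-- The reduction of an integral vector. -/
def red (v : Fin 5 → F) : Fin 5 → 𝓀[F] := fun i => res (v i)

lemma Qres_red {v : Fin 5 → F} (hv : ‖v‖ ≤ 1) : Qres (red v) = res (Q v v) := by
  have h : ∀ i, ‖v i‖ ≤ 1 := fun i => (norm_le_pi_norm v i).trans hv
  have h2 := fun i => norm_mul_le_one norm_two_le_one (h i)
  have h3 := fun i j => norm_mul_le_one (h2 i) (h j)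
  rw [Q_self, res_add (norm_add_le_of (h3 _ _) (h3 _ _)) (norm_sq_le_one (h 2)),
    res_add (h3 _ _) (h3 _ _), res_mul (h2 _) (h _), res_mul (h2 _) (h _),
    res_mul norm_two_le_one (h _), res_mul norm_two_le_one (h _), res_two, sq (v 2),
    res_mul (h 2) (h 2)]
  simp only [Qres, red]
  ring

lemma red_mv {k : SO32 F} (hk : k ∈ K F) {v : Fin 5 → F} (hv : ‖v‖ ≤ 1) (i : Fin 5) :
    red (mv k v) i = ∑ j, res (entry k i j) * red v j := by
  have h : ∀ i, ‖v i‖ ≤ 1 := fun i => (norm_le_pi_norm v i).trans hv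
  rw [red, mv_apply, res_sum _ _ fun j _ => norm_mul_le_one (norm_entry_le hk i j) (h j)]
  exact Finset.sum_congr rfl fun j _ => res_mul (norm_entry_le hk i j) (h j)

lemma red_mv_congr {k : SO32 F} (hk : k ∈ K F) {v w : Fin 5 → F} (hv : ‖v‖ ≤ 1) (hw : ‖w‖ ≤ 1)
    (h : red v = red w) : red (mv k v) = red (mv k w) := by
  ext i
  rw [red_mv hk hv, red_mv hk hw, h]

lemma red_ne_zero {v : Fin 5 → F} (hv : ‖v‖ = 1) : red v ≠ 0 := by
  intro h
  obtain ⟨i, hi⟩ := exists_norm_eq v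
  rw [hv] at hi
  exact (res_ne_zero_iff hi.le).2 hi (congrFun h i)

lemma exists_red_eq (y : Fin 5 → 𝓀[F]) (hy : y ≠ 0) : ∃ v : Fin 5 → F, ‖v‖ = 1 ∧ red v = y := by
  choose σ hσ1 hσ using exists_res_eq (F := F)
  have hr : red (fun i => σ (y i)) = y := funext fun i => hσ _
  refine ⟨fun i => σ (y i), le_antisymm ?_ ?_, hr⟩
  · rw [pi_norm_le_iff_of_nonneg zero_le_one]
    exact fun i => hσ1 _
  · obtain ⟨i, hi⟩ := Function.ne_iff.1 hy
    have : ‖σ (y i)‖ = 1 := by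
      rw [← res_ne_zero_iff (hσ1 _), hσ]; exact hi
    rw [← this]
    exact norm_le_pi_norm (fun i => σ (y i)) i

/-- `K` acts transitively on the reductions of primitive vectors with given value of `Q`. -/
lemma exists_red_mv_eq (h2 : ringChar 𝓀[F] ≠ 2) {v w : Fin 5 → F} (hv : ‖v‖ = 1) (hw : ‖w‖ = 1)
    (h : res (Q v v) = res (Q w w)) : ∃ k ∈ K F, red (mv k v) = red w := by
  obtain ⟨k₁, hk₁, e₁⟩ := exists_mv_eq_normalForm h2 hv
  obtain ⟨k₂, hk₂, e₂⟩ := exists_mv_eq_normalForm h2 hw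
  have hQ : ∀ u : Fin 5 → F, ‖u‖ = 1 → ‖Q u u‖ ≤ 1 := fun u hu => by
    simpa using norm_Q_le u (C := 1) fun i => hu ▸ norm_le_pi_norm u i
  -- The two values of `Q` are only congruent, but the normal forms then have the same reduction.
  have hr : red (mv k₁ v) = red (mv k₂ w) := by
    rw [e₁, e₂]
    have h3 : res (Q v v / 2) = res (Q w w / 2) := by
      rw [div_eq_mul_inv, div_eq_mul_inv, res_mul (hQ v hv), res_mul (hQ w hw), h] <;>
      · rw [norm_inv, norm_two_eq_one h2, inv_one]
    ext i
    fin_cases i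
    · exact h3
    all_goals rfl
  refine ⟨k₂⁻¹ * k₁, mul_mem (inv_mem hk₂) hk₁, ?_⟩
  rw [mv_mul, red_mv_congr (inv_mem hk₂) (by rw [norm_mv hk₁, hv]) (by rw [norm_mv hk₂, hw]) hr,
    mv_inv_mv]

lemma isLocallyConstant_red_mv {v : Fin 5 → F} (hv : ‖v‖ = 1) :
    IsLocallyConstant fun k : K F => red (mv (k : SO32 F) v) := by
  rw [IsLocallyConstant.iff_eventually_eq]
  intro k
  have hc : Continuous fun k : K F => mv (k : SO32 F) v := (continuous_mv v).comp continuous_subtype_val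
  filter_upwards [Metric.continuousAt_iff'.1 hc.continuousAt 1 one_pos] with k' hk'
  rw [dist_eq_norm] at hk'
  ext i
  have h1 : ∀ κ : K F, ‖mv (κ : SO32 F) v i‖ ≤ 1 := fun κ => by
    rw [← hv, ← norm_mv κ.2 v]; exact norm_le_pi_norm _ i
  have h2 : ‖mv (k' : SO32 F) v i - mv (k : SO32 F) v i‖ < 1 :=
    (norm_le_pi_norm (mv (k' : SO32 F) v - mv (k : SO32 F) v) i).trans_lt hk'
  have := (res_eq_zero_iff h2.le).2 h2
  rw [res_sub (h1 k') (h1 k), sub_eq_zero] at this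
  exact this

variable [LocallyCompactSpace F]

/-- Equidistribution: `K` acts transitively on the points of the quadric (`exists_red_mv_eq`), so by
invariance of Haar measure all points are hit with equal probability. -/
lemma integral_red_mv (h2 : ringChar 𝓀[F] ≠ 2) [Fintype 𝓀[F]] {v : Fin 5 → F} (hv : ‖v‖ = 1)
    (h : (Fin 5 → 𝓀[F]) → ℂ) : ∫ k : K F, h (red (mv (k : SO32 F) v)) ∂(haarC (K F)) =
      (∑ y ∈ quadric (res (Q v v)), h y) / (quadric (res (Q v v))).card := by
  classical
  set X := quadric (res (Q v v)) with hX
  have hmem : ∀ k : K F, red (mv (k : SO32 F) v) ∈ X := fun k => by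
    rw [hX, mem_quadric, Qres_red (by rw [norm_mv k.2, hv]), Q_mv]
    exact ⟨red_ne_zero (by rw [norm_mv k.2, hv]), rfl⟩
  set I : (Fin 5 → 𝓀[F]) → ℂ := fun y =>
    ∫ k : K F, (if red (mv (k : SO32 F) v) = y then (1 : ℂ) else 0) ∂(haarC (K F)) with hI
  have hint : ∀ y, Integrable (fun k : K F => if red (mv (k : SO32 F) v) = y then (1 : ℂ) else 0)
      (haarC (K F)) := fun y =>
    ((isLocallyConstant_red_mv hv).comp fun x => if x = y then (1 : ℂ) else 0).continuous
      |>.integrable_of_hasCompactSupport (HasCompactSupport.of_compactSpace _)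
  have hsum : ∀ h : (Fin 5 → 𝓀[F]) → ℂ,
      ∫ k : K F, h (red (mv (k : SO32 F) v)) ∂(haarC (K F)) = ∑ y ∈ X, h y * I y := by
    intro h
    simp only [hI, ← integral_const_mul]
    rw [← integral_finsetSum _ fun y _ => (hint y).const_mul _]
    congr 1
    ext k
    simp [hmem k]
  have hconst : ∀ y ∈ X, ∀ y' ∈ X, I y = I y' := by
    intro y hy y' hy'
    rw [hX, mem_quadric] at hy hy'
    obtain ⟨w, hw, rfl⟩ := exists_red_eq y hy.1
    obtain ⟨w', hw', rfl⟩ := exists_red_eq y' hy'.1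
    rw [Qres_red hw.le] at hy
    rw [Qres_red hw'.le] at hy'
    obtain ⟨κ, hκ, e⟩ := exists_red_mv_eq h2 hw hw' (hy.2.trans hy'.2.symm)
    simp only [hI]
    rw [← integral_mul_left_eq_self (μ := haarC (K F))
      (fun k : K F => if red (mv (k : SO32 F) v) = red w' then (1 : ℂ) else 0) ⟨κ, hκ⟩]
    congr 1
    ext k
    congr 1
    rw [Subgroup.coe_mul, mv_mul, ← e, eq_iff_iff]
    have hkv : ‖mv (k : SO32 F) v‖ ≤ 1 := by rw [norm_mv k.2, hv]
    refine ⟨fun hh => red_mv_congr hκ hkv hw.le hh, fun hh => ?_⟩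
    have := red_mv_congr (inv_mem hκ) (by rw [norm_mv hκ]; exact hkv)
      (by rw [norm_mv hκ, hw]) hh
    rwa [mv_inv_mv, mv_inv_mv] at this
  obtain ⟨y₀, hy₀⟩ : X.Nonempty := ⟨_, hmem 1⟩
  have h1 := hsum fun _ => 1
  have hI' : ∀ y ∈ X, I y = I y₀ := fun y hy => hconst y hy y₀ hy₀
  rw [Finset.sum_congr rfl fun y hy => by rw [hI' y hy]] at h1
  simp only [one_mul, Finset.sum_const, nsmul_eq_mul, integral_const, probReal_univ, one_smul] at h1
  have hc : (X.card : ℂ) ≠ 0 := by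
    intro h0; rw [h0] at h1; simp at h1
  rw [hsum h, Finset.sum_congr rfl fun y hy => by rw [hI' y hy], ← Finset.sum_mul,
    eq_div_iff hc, mul_assoc, mul_comm (I y₀), ← h1, mul_one]

lemma integral_red_mv_inv (h2 : ringChar 𝓀[F] ≠ 2) [Fintype 𝓀[F]] {v : Fin 5 → F} (hv : ‖v‖ = 1)
    (h : (Fin 5 → 𝓀[F]) → ℂ) : ∫ k : K F, h (red (mv (k : SO32 F)⁻¹ v)) ∂(haarC (K F)) =
      (∑ y ∈ quadric (res (Q v v)), h y) / (quadric (res (Q v v))).card := by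
  rw [← integral_red_mv h2 hv h]
  exact integral_inv_eq_self (fun k : K F => h (red (mv (k : SO32 F) v))) (haarC (K F))

end Equidistribution

end

end SO5

namespace SO5

noncomputable section

/-! ### The orbits of `K` on the sphere -/

section Orbits

variable {F : Type*} [NontriviallyNormedField F] [IsUltrametricDist F]

/-- Dividing both vectors by the same coordinate of maximal norm makes them primitive with the same
value of `Q`, so they share a normal form. -/
lemma exists_smul_eq_of_norm_eq (h2 : ringChar 𝓀[F] ≠ 2) {c : QuadricCase F} {s s' : Sphere c}
    (h : ‖s.1‖ = ‖s'.1‖) : ∃ k ∈ K F, k • s = s' := by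
  obtain ⟨i, hi⟩ := exists_norm_eq s.1
  by_cases h0 : s.1 i = 0
  · rw [h0, norm_zero] at hi
    have e1 := norm_eq_zero.1 hi.symm
    have e2 := norm_eq_zero.1 (hi.trans h).symm
    exact ⟨1, one_mem _, Subtype.ext (by rw [smul_val, mv_one, e1, e2])⟩
  have hn : ∀ u : Sphere c, ‖u.1‖ = ‖s.1 i‖ → ‖(s.1 i)⁻¹ • u.1‖ = 1 := fun u hu => by
    rw [norm_smul, norm_inv, hu, inv_mul_cancel₀ (norm_ne_zero_iff.2 h0)]
  obtain ⟨k, hk, e⟩ := exists_mv_eq_normalForm h2 (hn s hi.symm)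
  obtain ⟨k', hk', e'⟩ := exists_mv_eq_normalForm h2 (hn s' (hi.trans h).symm)
  rw [Q_smul, s.2, mv_smul] at e
  rw [Q_smul, s'.2, mv_smul, ← e] at e'
  have e'' : mv k' s'.1 = mv k s.1 := smul_right_injective _ (inv_ne_zero h0) e'
  refine ⟨k'⁻¹ * k, mul_mem (inv_mem hk') hk, Subtype.ext ?_⟩
  rw [smul_val, mv_mul, ← e'', mv_inv_mv]

lemma norm_value (h2 : ringChar 𝓀[F] ≠ 2) (c : QuadricCase F) : ‖c.value‖ = 1 := by
  cases c with
  | split => exact norm_one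
  | nonsplit θ h1 _ =>
    change ‖4 * θ‖ = 1
    have : (4 : F) = 2 * 2 := by norm_num
    rw [norm_mul, h1, this, norm_mul, norm_two_eq_one h2]; norm_num

lemma one_le_norm (h2 : ringChar 𝓀[F] ≠ 2) {c : QuadricCase F} (s : Sphere c) : 1 ≤ ‖s.1‖ := by
  have h := norm_Q_le s.1 (C := ‖s.1‖) fun i => norm_le_pi_norm _ i
  rw [s.2, norm_value h2] at h
  exact (one_le_sq_iff₀ (norm_nonneg _)).1 h

lemma exists_norm_eq_pow (h2 : ringChar 𝓀[F] ≠ 2) {ϖ : Fˣ} (hϖ : IsUniformizer ϖ)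
    (hnorm : ‖(ϖ : F)‖ = (q F : ℝ)⁻¹) {c : QuadricCase F} (s : Sphere c) :
    ∃ r : ℕ, ‖s.1‖ = (q F : ℝ) ^ r := by
  have hq : (1 : ℝ) < q F := by exact_mod_cast one_lt_q ϖ hnorm
  have h1 := one_le_norm h2 s
  obtain ⟨i, hi⟩ := exists_norm_eq s.1
  have h0 : s.1 i ≠ 0 := by rw [← norm_pos_iff, hi]; linarith
  obtain ⟨n, hn⟩ := exists_norm_eq_zpow hϖ hnorm h0
  rw [← hi, hn] at h1
  have hn0 : 0 ≤ n := by
    by_contra hneg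
    push Not at hneg
    exact absurd h1 (not_le.2 (zpow_lt_one_of_neg₀ hq hneg))
  lift n to ℕ using hn0
  exact ⟨n, by rw [← hi, hn, zpow_natCast]⟩

/-- The points `d_r v₁`. -/
def orbitPoint (h2 : ringChar 𝓀[F] ≠ 2) (ϖ : Fˣ) (c : QuadricCase F) (r : ℕ) : Sphere c :=
  torus (ϖ ^ r) 1 • basePoint h2 c

lemma orbitPoint_zero (h2 : ringChar 𝓀[F] ≠ 2) (ϖ : Fˣ) (c : QuadricCase F) :
    orbitPoint h2 ϖ c 0 = basePoint h2 c := by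
  apply Subtype.ext
  rw [orbitPoint, smul_val, mv_torus]
  ext i
  fin_cases i <;> simp

lemma norm_orbitPoint (h2 : ringChar 𝓀[F] ≠ 2) {ϖ : Fˣ} (hnorm : ‖(ϖ : F)‖ = (q F : ℝ)⁻¹)
    (c : QuadricCase F) (r : ℕ) : ‖(orbitPoint h2 ϖ c r).1‖ = (q F : ℝ) ^ r := by
  have hq : (1 : ℝ) < q F := by exact_mod_cast one_lt_q ϖ hnorm
  have hr : 1 ≤ (q F : ℝ) ^ r := one_le_pow₀ hq.le
  have hϖr : ‖((ϖ ^ r : Fˣ) : F)‖ = ((q F : ℝ) ^ r)⁻¹ := by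
    rw [Units.val_pow_eq_pow_val, norm_pow, hnorm, inv_pow]
  have h4 : (basePoint h2 c).1 4 = 1 := by cases c <;> rfl
  have hle : ∀ i, ‖(basePoint h2 c).1 i‖ ≤ 1 := by
    intro i
    cases c with
    | split =>
      change ‖(![1 / 2, 0, 0, 0, 1] : Fin 5 → F) i‖ ≤ 1
      fin_cases i
      · exact (norm_half_eq_one h2).le
      all_goals simp
    | nonsplit θ h1 h3 =>
      change ‖(![2 * θ, 0, 0, 1, 1] : Fin 5 → F) i‖ ≤ 1
      fin_cases i
      · exact norm_mul_le_one norm_two_le_one h1.le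
      all_goals simp
  rw [orbitPoint, smul_val, mv_torus]
  generalize basePoint h2 c = s at *
  apply le_antisymm
  · rw [pi_norm_le_iff_of_nonneg (by positivity)]
    intro i
    fin_cases i
    · change ‖((ϖ ^ r : Fˣ) : F) * s.1 0‖ ≤ _
      rw [norm_mul, hϖr]
      exact (mul_le_one₀ (inv_le_one_of_one_le₀ hr) (norm_nonneg _) (hle 0)).trans hr
    · simpa using (hle 1).trans hr
    · simpa using (hle 2).trans hr
    · simpa using (hle 3).trans hr
    · change ‖((ϖ ^ r : Fˣ) : F)⁻¹ * s.1 4‖ ≤ _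
      rw [norm_mul, norm_inv, hϖr, inv_inv, h4, norm_one, mul_one]
  · refine le_trans (le_of_eq ?_) (norm_le_pi_norm _ 4)
    change _ = ‖((ϖ ^ r : Fˣ) : F)⁻¹ * s.1 4‖
    rw [norm_mul, norm_inv, hϖr, inv_inv, h4, norm_one, mul_one]

lemma eq_of_norm_eq (h2 : ringChar 𝓀[F] ≠ 2) {c : QuadricCase F} {T : Sphere c → ℂ}
    (hT : ∀ k ∈ K F, ∀ s, T (k • s) = T s) {s s' : Sphere c} (h : ‖s.1‖ = ‖s'.1‖) : T s = T s' := by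
  obtain ⟨k, hk, rfl⟩ := exists_smul_eq_of_norm_eq h2 h
  rw [hT k hk]

/-! ### The action of `diag(ϖ, 1, 1, 1, ϖ⁻¹)` on primitive vectors -/

/-- The torus element divides the last coordinate by `ϖ` and multiplies the first by `ϖ`, so the new
norm is read off from the position of the reduction. If only the first coordinate is a unit, `hQ` is
needed: it forces `‖y 4‖ ≤ ‖ϖ‖ ^ 2`, so that the last coordinate stays small after division. -/
lemma norm_mv_torus_eq {ϖ : Fˣ} (hϖ1 : ‖(ϖ : F)‖ < 1) (h2 : ringChar 𝓀[F] ≠ 2)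
    (hϖ : IsUniformizer ϖ) {y : Fin 5 → F} (hy : ‖y‖ = 1)
    (hQ : red y 4 = 0 → red y 1 = 0 ∧ red y 2 = 0 ∧ red y 3 = 0 → ‖Q y y‖ ≤ ‖(ϖ : F)‖ ^ 2)
    (t : ℝ → ℂ) : t ‖mv (torus ϖ 1) y‖ =
      flagValue (t ‖(ϖ : F)‖⁻¹) (t 1) (t ‖(ϖ : F)‖) (red y) := by
  have hp : 0 < ‖(ϖ : F)‖ := norm_pos_iff.2 ϖ.ne_zero
  have hpi : 1 ≤ ‖(ϖ : F)‖⁻¹ := (one_le_inv₀ hp).2 hϖ1.le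
  have hle : ∀ i, ‖y i‖ ≤ 1 := fun i => hy ▸ norm_le_pi_norm y i
  have hval : ∀ (C : ℝ) (i : Fin 5), ‖mv (torus ϖ 1) y i‖ = C → ‖(ϖ : F)‖ * ‖y 0‖ ≤ C →
      ‖y 1‖ ≤ C → ‖y 2‖ ≤ C → ‖y 3‖ ≤ C → ‖(ϖ : F)‖⁻¹ * ‖y 4‖ ≤ C →
      ‖mv (torus ϖ 1) y‖ = C := by
    intro C i hi h0 h1 h2 h3 h4
    apply le_antisymm
    · rw [pi_norm_le_iff_of_nonneg ((norm_nonneg _).trans h1), mv_torus]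
      intro j
      fin_cases j <;> simp [h0, h1, h2, h3, h4]
    · rw [← hi]; exact norm_le_pi_norm _ i
  have hlt : ∀ i, red y i = 0 → ‖y i‖ ≤ ‖(ϖ : F)‖ := fun i hi =>
    norm_le_of_lt_one hϖ ((res_eq_zero_iff (hle i)).1 hi)
  have h0' : ‖(ϖ : F)‖ * ‖y 0‖ ≤ ‖(ϖ : F)‖ := mul_le_of_le_one_right hp.le (hle 0)
  have hmv : ∀ i : Fin 5, i ≠ 0 → i ≠ 4 → mv (torus ϖ 1) y i = y i := by
    intro i hi0 hi4
    rw [mv_torus]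
    fin_cases i <;> simp_all
  rw [flagValue]
  split_ifs with h4 hmid
  · have h4' : ‖y 4‖ = 1 := (res_ne_zero_iff (hle 4)).1 h4
    congr 1
    refine hval _ 4 ?_ (h0'.trans (hϖ1.le.trans hpi)) ((hle 1).trans hpi) ((hle 2).trans hpi)
      ((hle 3).trans hpi) (by rw [h4', mul_one])
    rw [mv_torus]
    change ‖(ϖ : F)⁻¹ * y 4‖ = _
    rw [norm_mul, norm_inv, h4', mul_one]
  · push Not at h4
    have hQ' := hQ h4 hmid
    have h0 : ‖y 0‖ = 1 := by
      obtain ⟨i, hi⟩ := exists_norm_eq y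
      rw [hy] at hi
      have hi' := (res_ne_zero_iff hi.le).2 hi
      fin_cases i
      exacts [hi, absurd hmid.1 hi', absurd hmid.2.1 hi', absurd hmid.2.2 hi', absurd h4 hi']
    congr 1
    refine hval _ 0 ?_ h0' (hlt 1 hmid.1) (hlt 2 hmid.2.1) (hlt 3 hmid.2.2) ?_
    · rw [mv_torus]
      change ‖(ϖ : F) * y 0‖ = _
      rw [norm_mul, h0, mul_one]
    · rw [inv_mul_le_iff₀ hp, ← sq]
      have e : 2 * y 0 * y 4 = Q y y - (2 * y 1 * y 3 + y 2 ^ 2) := by rw [Q_self]; ring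
      have h3 : ‖2 * y 0 * y 4‖ = ‖y 4‖ := by
        rw [norm_mul, norm_mul, norm_two_eq_one h2, h0, one_mul, one_mul]
      rw [← h3, e]
      refine norm_sub_le_of hQ' (norm_add_le_of ?_ ?_)
      · rw [norm_mul, norm_mul, norm_two_eq_one h2, one_mul, sq]
        exact mul_le_mul (hlt 1 hmid.1) (hlt 3 hmid.2.2) (norm_nonneg _) hp.le
      · rw [norm_pow]
        exact pow_le_pow_left₀ (norm_nonneg _) (hlt 2 hmid.2.1) 2
  · push Not at h4
    have h4' : ‖(ϖ : F)‖⁻¹ * ‖y 4‖ ≤ 1 := by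
      rw [inv_mul_le_iff₀ hp, mul_one]; exact hlt 4 h4
    have key : ∀ i : Fin 5, i ≠ 0 → i ≠ 4 → red y i ≠ 0 → ‖mv (torus ϖ 1) y‖ = 1 := by
      intro i hi0 hi4 hi
      refine hval 1 i ?_ (h0'.trans hϖ1.le) (hle 1) (hle 2) (hle 3) h4'
      rw [hmv i hi0 hi4]
      exact (res_ne_zero_iff (hle i)).1 hi
    congr 1
    by_cases h1 : red y 1 = 0
    · by_cases h22 : red y 2 = 0
      · by_cases h3 : red y 3 = 0
        · exact absurd ⟨h1, h22, h3⟩ hmid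
        · exact key 3 (by decide) (by decide) h3
      · exact key 2 (by decide) (by decide) h22
    · exact key 1 (by decide) (by decide) h1

end Orbits

/-! ### Square roots -/

section SquareRoots

variable {F : Type*} [NontriviallyNormedField F] [IsUltrametricDist F] [LocallyCompactSpace F]

/-- Hensel's lemma for square roots of units. -/
lemma isSquare_of_norm_sub_lt_one (h2 : ringChar 𝓀[F] ≠ 2) {θ u : F} (hu : ‖u‖ = 1)
    (h : ‖u ^ 2 - θ‖ < 1) : IsSquare θ := by
  have : ProperSpace F := .of_locallyCompactSpace F
  -- Newton's iteration squares the error, since `2w` is a unit. The limit is then extracted from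
  -- compactness: the squares of elements of the closed unit ball form a closed set.
  have happrox : ∀ n : ℕ, ∃ w : F, ‖w‖ = 1 ∧ ‖w ^ 2 - θ‖ ≤ ‖u ^ 2 - θ‖ ^ (n + 1) := by
    intro n
    induction n with
    | zero => exact ⟨u, hu, by rw [zero_add, pow_one]⟩
    | succ n ih =>
      obtain ⟨w, hw, hwθ⟩ := ih
      have hw0 : w ≠ 0 := by rw [← norm_pos_iff, hw]; exact one_pos
      have h20 := two_ne_zero_of_ringChar h2
      have hδ : ‖(w ^ 2 - θ) / (2 * w)‖ = ‖w ^ 2 - θ‖ := by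
        rw [norm_div, norm_mul, norm_two_eq_one h2, hw, one_mul, div_one]
      have hδ1 : ‖(w ^ 2 - θ) / (2 * w)‖ < 1 := by
        rw [hδ]
        exact hwθ.trans_lt (pow_lt_one₀ (norm_nonneg _) h (Nat.succ_ne_zero n))
      refine ⟨w + -((w ^ 2 - θ) / (2 * w)), ?_, ?_⟩
      · rw [IsUltrametricDist.norm_add_eq_max_of_norm_ne_norm (by rw [norm_neg, hw]; exact hδ1.ne'),
          norm_neg, hw]
        exact max_eq_left hδ1.le
      · have e : (w + -((w ^ 2 - θ) / (2 * w))) ^ 2 - θ = ((w ^ 2 - θ) / (2 * w)) ^ 2 := by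
          field_simp
          ring
        rw [e, norm_pow, hδ]
        calc ‖w ^ 2 - θ‖ ^ 2 ≤ (‖u ^ 2 - θ‖ ^ (n + 1)) ^ 2 := by gcongr
          _ = ‖u ^ 2 - θ‖ ^ ((n + 1) * 2) := by rw [pow_mul]
          _ ≤ ‖u ^ 2 - θ‖ ^ (n + 1 + 1) :=
            pow_le_pow_of_le_one (norm_nonneg _) h.le (by omega)
  have hcl : IsClosed ((fun w : F => w ^ 2) '' Metric.closedBall 0 1) :=
    ((isCompact_closedBall _ _).image (by fun_prop)).isClosed
  have hmem : θ ∈ closure ((fun w : F => w ^ 2) '' Metric.closedBall 0 1) := by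
    rw [Metric.mem_closure_iff]
    intro ε hε
    obtain ⟨n, hn⟩ := exists_pow_lt_of_lt_one hε h
    obtain ⟨w, hw, hwθ⟩ := happrox n
    refine ⟨w ^ 2, ⟨w, mem_closedBall_zero_iff.2 hw.le, rfl⟩, ?_⟩
    rw [dist_comm, dist_eq_norm]
    exact hwθ.trans_lt ((pow_le_pow_of_le_one (norm_nonneg _) h.le n.le_succ).trans_lt hn)
  rw [hcl.closure_eq] at hmem
  obtain ⟨w, -, hw⟩ := hmem
  exact ⟨w, by rw [← hw]; exact sq w⟩

/-- The number of square roots of the value of the form in the residue field. -/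
lemma card_sqrt_value (h2 : ringChar 𝓀[F] ≠ 2) (c : QuadricCase F) :
    (Nat.card {z : 𝓀[F] // z ^ 2 = res c.value} : ℂ) = 1 - c.sign := by
  have h2' : (2 : 𝓀[F]) ≠ 0 := Ring.two_ne_zero h2
  cases c with
  | split =>
    have h : {z : 𝓀[F] | z ^ 2 = res (QuadricCase.split : QuadricCase F).value} = {1, -1} := by
      ext z
      change z ^ 2 = res (1 : F) ↔ _
      rw [res_one, sq_eq_one_iff]
      rfl
    have h' : Nat.card {z : 𝓀[F] // z ^ 2 = res (QuadricCase.split : QuadricCase F).value} = 2 := by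
      change Nat.card ({z : 𝓀[F] | z ^ 2 = res (QuadricCase.split : QuadricCase F).value} : Set _) = 2
      rw [h, Nat.card_coe_set_eq, Set.ncard_pair]
      intro hh
      apply h2'
      rw [eq_neg_iff_add_eq_zero] at hh
      rw [← hh]; norm_num
    rw [h']
    simp [QuadricCase.sign]
    norm_num
  | nonsplit θ h1 h3 =>
    have : IsEmpty {z : 𝓀[F] // z ^ 2 = res (QuadricCase.nonsplit θ h1 h3).value} := by
      constructor
      rintro ⟨z, hz⟩
      apply h3
      change z ^ 2 = res (4 * θ) at hz
      obtain ⟨w, hw, rfl⟩ := exists_res_eq z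
      have h4 : (4 : F) = 2 * 2 := by norm_num
      have h41 : ‖4 * θ‖ = 1 := by
        rw [norm_mul, h1, h4, norm_mul, norm_two_eq_one h2]; norm_num
      have hlt : ‖w ^ 2 - 4 * θ‖ < 1 := by
        rw [← res_eq_zero_iff (norm_sub_le_of (norm_sq_le_one hw) h41.le),
          res_sub (norm_sq_le_one hw) h41.le, ← hz, sq, res_mul hw hw, sq, sub_self]
      have hw1 : ‖w‖ = 1 := by
        rw [← res_ne_zero_iff hw]
        intro h0
        rw [h0, eq_comm, zero_pow two_ne_zero] at hz
        exact (res_ne_zero_iff h41.le).2 h41 hz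
      -- A square root of `4θ` in the residue field lifts to `F`; half of it would be a square root
      -- of `θ`.
      obtain ⟨x, hx⟩ := isSquare_of_norm_sub_lt_one h2 hw1 hlt
      have h20 := two_ne_zero_of_ringChar h2
      refine ⟨x / 2, ?_⟩
      field_simp
      linear_combination hx
    rw [Nat.card_of_isEmpty]
    simp [QuadricCase.sign]

end SquareRoots

end

end SO5

namespace SO5

noncomputable section

/-! ### The Hecke operator of the double coset of `diag(ϖ, 1, 1, 1, ϖ⁻¹)` -/

section HeckeOperator

variable {F : Type*} [NontriviallyNormedField F] [IsUltrametricDist F]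

/-- The double coset of `diag(ϖ, 1, 1, 1, ϖ⁻¹)`. -/
def doubleCoset (ϖ : Fˣ) : Set (SO32 F) := {g | ∃ k₁ ∈ K F, ∃ k₂ ∈ K F, k₁ * torus ϖ 1 * k₂ = g}

lemma mul_mem_doubleCoset_iff {ϖ : Fˣ} {k₁ k₂ : SO32 F} (h₁ : k₁ ∈ K F) (h₂ : k₂ ∈ K F)
    (g : SO32 F) : k₁ * g * k₂ ∈ doubleCoset ϖ ↔ g ∈ doubleCoset ϖ := by
  constructor
  · rintro ⟨a, ha, b, hb, e⟩
    refine ⟨k₁⁻¹ * a, mul_mem (inv_mem h₁) ha, b * k₂⁻¹, mul_mem hb (inv_mem h₂), ?_⟩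
    calc k₁⁻¹ * a * torus ϖ 1 * (b * k₂⁻¹) = k₁⁻¹ * (a * torus ϖ 1 * b) * k₂⁻¹ := by group
      _ = g := by rw [e]; group
  · rintro ⟨a, ha, b, hb, rfl⟩
    exact ⟨k₁ * a, mul_mem h₁ ha, b * k₂, mul_mem hb h₂, by group⟩

lemma rowNorm_eq_norm_mv_inv (g : SO32 F) : rowNorm g = ‖mv g⁻¹ (Pi.single 0 1)‖ := by
  have h : ∀ i, mv g⁻¹ (Pi.single 0 1) i = entry g 4 i.rev := fun i => by
    rw [mv_single, entry_inv]; rfl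
  apply le_antisymm
  · rw [rowNorm, pi_norm_le_iff_of_nonneg (norm_nonneg _)]
    intro j
    rw [← Fin.rev_rev j, ← h]
    exact norm_le_pi_norm _ _
  · rw [pi_norm_le_iff_of_nonneg (rowNorm_pos g).le]
    intro i
    rw [h]
    exact norm_le_pi_norm (fun j => entry g 4 j) i.rev

lemma norm_single_zero : ‖(Pi.single 0 1 : Fin 5 → F)‖ = 1 := by
  have h := rowNorm_eq_norm_mv_inv (1 : SO32 F)
  rw [inv_one, mv_one, rowNorm_one] at h
  exact h.symm

/-- Hence `d_1` and its inverse lie in the same double coset, and a biinvariant function may be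
evaluated at either. -/
lemma wU_mul_torus_mul_wU (ϖ : Fˣ) : wU F * torus ϖ 1 * wU F = (torus ϖ 1)⁻¹ := by
  rw [eq_inv_iff_mul_eq_one]
  apply ext_mv
  intro v
  simp only [mv_mul, mv_torus, mv_wU, mv_one]
  ext i
  fin_cases i <;> simp

variable [LocallyCompactSpace F]

lemma isCompact_doubleCoset (ϖ : Fˣ) : IsCompact (doubleCoset ϖ : Set (SO32 F)) := by
  have : doubleCoset ϖ = (fun p : SO32 F × SO32 F => p.1 * torus ϖ 1 * p.2) ''
      ((K F : Set (SO32 F)) ×ˢ (K F : Set (SO32 F))) := by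
    ext g
    constructor
    · rintro ⟨a, ha, b, hb, rfl⟩
      exact ⟨(a, b), ⟨ha, hb⟩, rfl⟩
    · rintro ⟨⟨a, b⟩, ⟨ha, hb⟩, rfl⟩
      exact ⟨a, ha, b, hb, rfl⟩
  rw [this]
  exact (isCompact_K.prod isCompact_K).image (by fun_prop)

/-- The characteristic function of the double coset of `diag(ϖ, 1, 1, 1, ϖ⁻¹)`. -/
def heckeD (ϖ : Fˣ) : sphericalHecke F :=
  ⟨(doubleCoset ϖ).indicator fun _ => 1, fun k₁ h₁ k₂ h₂ g => by
      have := mul_mem_doubleCoset_iff (ϖ := ϖ) h₁ h₂ g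
      by_cases hg : g ∈ doubleCoset ϖ
      · rw [Set.indicator_of_mem hg, Set.indicator_of_mem (this.2 hg)]
      · rw [Set.indicator_of_notMem hg, Set.indicator_of_notMem (mt this.1 hg)],
    HasCompactSupport.intro (isCompact_doubleCoset ϖ) fun _ hx => Set.indicator_of_notMem hx _⟩

lemma heckeD_mul (ϖ : Fˣ) {Φ : SO32 F → ℂ} (hl : ∀ k ∈ K F, ∀ g, Φ (k * g) = Φ g)
    (hr : ∀ k ∈ K F, ∀ g, Φ (g * k) = Φ g) (g : SO32 F) :
    (heckeD ϖ).1 g * Φ g = (heckeD ϖ).1 g * Φ (torus ϖ 1) := by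
  by_cases hg : g ∈ doubleCoset ϖ
  · obtain ⟨a, ha, b, hb, rfl⟩ := hg
    rw [hr b hb, hl a ha]
  · have : (heckeD ϖ).1 g = 0 := by
      change (doubleCoset ϖ).indicator (fun _ => (1 : ℂ)) g = 0
      exact Set.indicator_of_notMem hg _
    rw [this, zero_mul, zero_mul]

lemma integral_heckeD_mul (ϖ : Fˣ) (μ : Measure (SO32 F)) {Φ : SO32 F → ℂ}
    (hl : ∀ k ∈ K F, ∀ g, Φ (k * g) = Φ g) (hr : ∀ k ∈ K F, ∀ g, Φ (g * k) = Φ g) :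
    ∫ g, (heckeD ϖ).1 g * Φ g ∂μ = (∫ g, (heckeD ϖ).1 g ∂μ) * Φ (torus ϖ 1) := by
  simp only [heckeD_mul ϖ hl hr]
  rw [integral_mul_const]

lemma integral_heckeD_ne_zero (ϖ : Fˣ) (μ : Measure (SO32 F)) [μ.IsHaarMeasure] :
    ∫ g, (heckeD ϖ).1 g ∂μ ≠ 0 := by
  have hlc : IsLocallyConstant (heckeD (F := F) ϖ).1 :=
    isLocallyConstant_of_right_invariant fun k hk g => hecke_right _ hk g
  have hopen : IsOpen (doubleCoset ϖ : Set (SO32 F)) := by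
    convert hlc.isOpen_fiber 1 using 1
    ext g
    change _ ↔ (doubleCoset ϖ).indicator (fun _ => (1 : ℂ)) g = 1
    by_cases hg : g ∈ doubleCoset ϖ <;> simp [hg]
  change ∫ g, (doubleCoset ϖ).indicator (fun _ => (1 : ℂ)) g ∂μ ≠ 0
  rw [integral_indicator_const _ hopen.measurableSet]
  have hpos : 0 < μ (doubleCoset ϖ) := hopen.measure_pos μ ⟨torus ϖ 1, 1, one_mem _, 1, one_mem _,
    by simp⟩
  have hfin := (isCompact_doubleCoset (F := F) ϖ).measure_lt_top (μ := μ)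
  simp only [Complex.real_smul, mul_one, ne_eq, Complex.ofReal_eq_zero]
  exact (ENNReal.toReal_pos hpos.ne' hfin.ne).ne'

variable (F) in
/-- The normalized eigenvalue of the Hecke operator. -/
def eigD (ζ : ℂ) : ℂ :=
  ((q F : ℂ) ^ (3 / 2 - ζ) + (q F : ℂ) ^ (3 / 2 + ζ) + (q F : ℂ) ^ 2 + q F) /
    ((q F : ℂ) ^ 3 + (q F : ℂ) ^ 2 + q F + 1)

/-- The left `K`-average of `phiP` is biinvariant, so the integral is a volume times its value at
`(torus ϖ 1)⁻¹`. That value is a mean over the reductions of the vectors `c⁻¹ e₀`, equidistributed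
on the nonzero isotropic vectors of the residue space. -/
lemma satake_heckeD (h2 : ringChar 𝓀[F] ≠ 2) {ϖ : Fˣ} (hϖ : IsUniformizer ϖ)
    (hnorm : ‖(ϖ : F)‖ = (q F : ℝ)⁻¹) (μ : Measure (SO32 F)) [μ.IsHaarMeasure] (ζ : ℂ) :
    satake μ ζ (1 / 2 + ζ) (heckeD ϖ) = (∫ g, (heckeD ϖ).1 g ∂μ) * eigD F ζ := by
  have := finite_residueField ϖ hnorm
  have := Fintype.ofFinite 𝓀[F]
  have hq : (1 : ℝ) < q F := by exact_mod_cast one_lt_q ϖ hnorm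
  have hq0 : (q F : ℂ) ≠ 0 := by
    have : (q F : ℝ) ≠ 0 := by linarith
    exact_mod_cast this
  have hq1 : (q F : ℂ) - 1 ≠ 0 := by
    rw [sub_ne_zero]
    exact_mod_cast (one_lt_q ϖ hnorm).ne'
  have hϖ1 : ‖(ϖ : F)‖ < 1 := by rw [hnorm]; exact inv_lt_one_of_one_lt₀ hq
  have hlc : IsLocallyConstant (phiP ζ : SO32 F → ℂ) :=
    isLocallyConstant_of_right_invariant fun _ hk g => phiP_right ζ hk g
  rw [satake_eq_integral_phiP h2 hϖ hnorm, integral_hecke_average_left le_rfl μ _ hlc.continuous]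
  set Φ : SO32 F → ℂ := fun g => ∫ c : K F, phiP ζ ((c : SO32 F) * g) ∂(haarC (K F)) with hΦ
  have hl : ∀ k ∈ K F, ∀ g, Φ (k * g) = Φ g := by
    intro k hk g
    have := integral_mul_right_eq_self (μ := haarC (K F))
      (fun c : K F => phiP ζ ((c : SO32 F) * g)) ⟨k, hk⟩
    simp only [hΦ]
    rw [← this]
    simp only [Subgroup.coe_mul, mul_assoc]
  have hr : ∀ k ∈ K F, ∀ g, Φ (g * k) = Φ g := by
    intro k hk g
    simp only [hΦ, ← mul_assoc, phiP_right ζ hk]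
  rw [integral_heckeD_mul ϖ μ hl hr]
  congr 1
  rw [← hr _ wU_mem, ← hl _ wU_mem, ← mul_assoc, wU_mul_torus_mul_wU]
  have hphi : ∀ c : K F, phiP ζ ((c : SO32 F) * (torus ϖ 1)⁻¹) =
      flagValue (((‖(ϖ : F)‖⁻¹ : ℝ) : ℂ) ^ (-(3 / 2 + ζ))) (((1 : ℝ) : ℂ) ^ (-(3 / 2 + ζ)))
        ((‖(ϖ : F)‖ : ℂ) ^ (-(3 / 2 + ζ))) (red (mv (c : SO32 F)⁻¹ (Pi.single 0 1))) := by
    intro c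
    have hn : ‖mv (c : SO32 F)⁻¹ (Pi.single 0 1)‖ = 1 := by
      rw [norm_mv (inv_mem c.2), norm_single_zero]
    rw [← norm_mv_torus_eq hϖ1 h2 hϖ hn (fun _ _ => by rw [Q_mv, Q_self]; simp)
      (fun N => (N : ℂ) ^ (-(3 / 2 + ζ))), phiP, rowNorm_eq_norm_mv_inv, mul_inv_rev, inv_inv,
      mv_mul]
  simp only [hΦ, hphi]
  rw [integral_red_mv_inv h2 norm_single_zero]
  have hQ0 : res (Q (Pi.single 0 1 : Fin 5 → F) (Pi.single 0 1)) = 0 := by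
    rw [Q_self]; simp [res_zero]
  have h2' : (2 : 𝓀[F]) ≠ 0 := Ring.two_ne_zero h2
  rw [hQ0, sum_flagValue_zero h2', card_quadric_zero h2', hnorm, inv_inv, eigD]
  change ((q F : ℂ) - 1) * ((q F : ℂ) ^ 3 * _ + ((q F : ℂ) ^ 2 + (q F : ℂ)) * _ + _) /
    (((q F : ℂ) - 1) * ((q F : ℂ) ^ 3 + (q F : ℂ) ^ 2 + (q F : ℂ) + 1)) = _
  rw [mul_div_mul_left _ _ hq1]
  congr 1
  have e1 : (q F : ℂ) ^ 3 * ((q F : ℝ) : ℂ) ^ (-(3 / 2 + ζ)) = (q F : ℂ) ^ (3 / 2 - ζ) := by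
    rw [Complex.ofReal_natCast, ← Complex.cpow_natCast, ← Complex.cpow_add _ _ hq0]
    congr 1
    push_cast
    ring
  have e2 : (((q F : ℝ)⁻¹ : ℝ) : ℂ) ^ (-(3 / 2 + ζ)) = (q F : ℂ) ^ (3 / 2 + ζ) := by
    obtain ⟨A, hA⟩ : ∃ A, Real.exp A = (q F : ℝ) := ⟨_, Real.exp_log (by linarith)⟩
    rw [← Complex.ofReal_natCast, ← hA, ← Real.exp_neg, cpow_ofReal_exp, cpow_ofReal_exp]
    congr 1
    push_cast
    ring
  rw [e1, e2, Complex.ofReal_one, Complex.one_cpow]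
  ring

/-- The Hecke operator on `K`-invariant functions on the sphere. -/
lemma integral_heckeD_smul (ϖ : Fˣ) (μ : Measure (SO32 F)) [μ.IsHaarMeasure] {c : QuadricCase F}
    {T : Sphere c → ℂ} (hT : ∀ k ∈ K F, ∀ s, T (k • s) = T s) (s : Sphere c) :
    ∫ g, (heckeD ϖ).1 g * T (g • s) ∂μ = (∫ g, (heckeD ϖ).1 g ∂μ) *
      ∫ k : K F, T (torus ϖ 1 • (k : SO32 F) • s) ∂(haarC (K F)) := by
  have hlc : IsLocallyConstant fun g : SO32 F => T (g • s) :=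
    isLocallyConstant_of_left_invariant fun k hk g => by rw [mul_smul, hT k hk]
  rw [integral_hecke_average_right le_rfl μ _ hlc.continuous]
  simp only [← mul_smul]
  refine integral_heckeD_mul ϖ μ (Φ := fun g => ∫ k : K F, T ((g * k) • s) ∂(haarC (K F))) ?_ ?_
  · intro k hk g
    simp only [mul_assoc, mul_smul, hT k hk]
  · intro k hk g
    have := integral_mul_left_eq_self (μ := haarC (K F))
      (fun c : K F => T ((g * (c : SO32 F)) • s)) ⟨k, hk⟩
    simp only [← this, Subgroup.coe_mul, mul_assoc]

lemma exists_factor_norm (h2 : ringChar 𝓀[F] ≠ 2) {c : QuadricCase F} {T : Sphere c → ℂ}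
    (hT : ∀ k ∈ K F, ∀ s, T (k • s) = T s) : ∃ τ : ℝ → ℂ, ∀ s, T s = τ ‖s.1‖ := by
  have hf : Function.FactorsThrough T (fun s : Sphere c => ‖s.1‖) := fun s s' h =>
    eq_of_norm_eq h2 hT h
  exact ⟨Function.extend (fun s : Sphere c => ‖s.1‖) T 0, fun s => (hf.extend_apply 0 s).symm⟩

/-- Multiplication by `ϖ ^ r` makes the point primitive, with form value of norm `‖ϖ‖ ^ (2r)`. The
smallness condition of `norm_mv_torus_eq` thus holds as soon as `r ≥ 1`. For `r = 0` the hypothesis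
says that the third stratum is not met, so the value of `τ` at `q⁻¹` plays no role. -/
lemma apply_torus_smul (h2 : ringChar 𝓀[F] ≠ 2) {ϖ : Fˣ} (hϖ : IsUniformizer ϖ)
    (hnorm : ‖(ϖ : F)‖ = (q F : ℝ)⁻¹) {c : QuadricCase F} {T : Sphere c → ℂ} {τ : ℝ → ℂ}
    (hτ : ∀ s, T s = τ ‖s.1‖) (r : ℕ) (k : K F)
    (hQ : red (mv (k : SO32 F) ((ϖ : F) ^ r • (orbitPoint h2 ϖ c r).1)) 4 = 0 →
      red (mv (k : SO32 F) ((ϖ : F) ^ r • (orbitPoint h2 ϖ c r).1)) 1 = 0 ∧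
      red (mv (k : SO32 F) ((ϖ : F) ^ r • (orbitPoint h2 ϖ c r).1)) 2 = 0 ∧
      red (mv (k : SO32 F) ((ϖ : F) ^ r • (orbitPoint h2 ϖ c r).1)) 3 = 0 → 1 ≤ r) :
    T (torus ϖ 1 • (k : SO32 F) • orbitPoint h2 ϖ c r) =
      flagValue (τ ((q F : ℝ) ^ (r + 1))) (τ ((q F : ℝ) ^ r)) (τ ((q F : ℝ) ^ r * (q F : ℝ)⁻¹))
        (red (mv (k : SO32 F) ((ϖ : F) ^ r • (orbitPoint h2 ϖ c r).1))) := by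
  have hq : (1 : ℝ) < q F := by exact_mod_cast one_lt_q ϖ hnorm
  have hϖ1 : ‖(ϖ : F)‖ < 1 := by rw [hnorm]; exact inv_lt_one_of_one_lt₀ hq
  set s := orbitPoint h2 ϖ c r with hs
  have hsn : ‖s.1‖ = (q F : ℝ) ^ r := norm_orbitPoint h2 hnorm c r
  have hϖr : ‖(ϖ : F) ^ r‖ = ((q F : ℝ) ^ r)⁻¹ := by rw [norm_pow, hnorm, inv_pow]
  have hy : ‖(ϖ : F) ^ r • s.1‖ = 1 := by
    rw [norm_smul, hϖr, hsn, inv_mul_cancel₀ (by positivity)]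
  have h := norm_mv_torus_eq hϖ1 h2 hϖ (y := mv (k : SO32 F) ((ϖ : F) ^ r • s.1))
    (by rw [norm_mv k.2, hy]) (fun h4 hmid => by
      have hr := hQ h4 hmid
      rw [Q_mv, Q_smul, s.2, norm_mul, norm_value h2, mul_one, norm_pow, norm_pow, ← pow_mul]
      exact pow_le_pow_of_le_one (norm_nonneg _) hϖ1.le (by omega))
    (fun N => τ ((q F : ℝ) ^ r * N))
  rw [hτ, smul_val, smul_val]
  have e : (q F : ℝ) ^ r * ‖mv (torus ϖ 1) (mv (k : SO32 F) ((ϖ : F) ^ r • s.1))‖ =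
      ‖mv (torus ϖ 1) (mv (k : SO32 F) s.1)‖ := by
    rw [mv_smul, mv_smul, norm_smul, hϖr, mul_inv_cancel_left₀ (by positivity)]
  rw [e, mul_one, hnorm, inv_inv, ← pow_succ] at h
  exact h

/-- The radial recurrence of the Hecke operator. -/
lemma integral_torus_smul_succ (h2 : ringChar 𝓀[F] ≠ 2) {ϖ : Fˣ} (hϖ : IsUniformizer ϖ)
    (hnorm : ‖(ϖ : F)‖ = (q F : ℝ)⁻¹) {c : QuadricCase F} {T : Sphere c → ℂ}
    (hT : ∀ k ∈ K F, ∀ s, T (k • s) = T s) (r : ℕ) :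
    ∫ k : K F, T (torus ϖ 1 • (k : SO32 F) • orbitPoint h2 ϖ c (r + 1)) ∂(haarC (K F)) =
      ((q F : ℂ) ^ 3 * T (orbitPoint h2 ϖ c (r + 2)) +
        ((q F : ℂ) ^ 2 + q F) * T (orbitPoint h2 ϖ c (r + 1)) + T (orbitPoint h2 ϖ c r)) /
      ((q F : ℂ) ^ 3 + (q F : ℂ) ^ 2 + q F + 1) := by
  have := finite_residueField ϖ hnorm
  have := Fintype.ofFinite 𝓀[F]
  have hq : (1 : ℝ) < q F := by exact_mod_cast one_lt_q ϖ hnorm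
  have hq1 : (q F : ℂ) - 1 ≠ 0 := by
    rw [sub_ne_zero]
    exact_mod_cast (one_lt_q ϖ hnorm).ne'
  have hϖ1 : ‖(ϖ : F)‖ < 1 := by rw [hnorm]; exact inv_lt_one_of_one_lt₀ hq
  have h2' : (2 : 𝓀[F]) ≠ 0 := Ring.two_ne_zero h2
  obtain ⟨τ, hτ⟩ := exists_factor_norm h2 hT
  simp only [fun k : K F => apply_torus_smul h2 hϖ hnorm hτ (r + 1) k
    (fun _ _ => Nat.le_add_left 1 r)]
  have hϖr : ‖(ϖ : F) ^ (r + 1)‖ = ((q F : ℝ) ^ (r + 1))⁻¹ := by rw [norm_pow, hnorm, inv_pow]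
  rw [integral_red_mv h2 (by
    rw [norm_smul, hϖr, norm_orbitPoint h2 hnorm, inv_mul_cancel₀ (by positivity)])]
  have hres : res (Q ((ϖ : F) ^ (r + 1) • (orbitPoint h2 ϖ c (r + 1)).1)
      ((ϖ : F) ^ (r + 1) • (orbitPoint h2 ϖ c (r + 1)).1)) = 0 := by
    have hlt : ‖Q ((ϖ : F) ^ (r + 1) • (orbitPoint h2 ϖ c (r + 1)).1)
        ((ϖ : F) ^ (r + 1) • (orbitPoint h2 ϖ c (r + 1)).1)‖ < 1 := by
      rw [Q_smul, (orbitPoint h2 ϖ c (r + 1)).2, norm_mul, norm_value h2, mul_one, norm_pow,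
        norm_pow, ← pow_mul]
      exact pow_lt_one₀ (norm_nonneg _) hϖ1 (by omega)
    exact (res_eq_zero_iff hlt.le).2 hlt
  rw [hres, sum_flagValue_zero h2', card_quadric_zero h2']
  change ((q F : ℂ) - 1) * ((q F : ℂ) ^ 3 * _ + ((q F : ℂ) ^ 2 + (q F : ℂ)) * _ + _) /
    (((q F : ℂ) - 1) * ((q F : ℂ) ^ 3 + (q F : ℂ) ^ 2 + (q F : ℂ) + 1)) = _
  have e : (q F : ℝ) ^ (r + 1) * (q F : ℝ)⁻¹ = (q F : ℝ) ^ r := by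
    rw [pow_succ, mul_inv_cancel_right₀ (by linarith)]
  rw [mul_div_mul_left _ _ hq1, hτ, hτ, hτ, norm_orbitPoint h2 hnorm, norm_orbitPoint h2 hnorm,
    norm_orbitPoint h2 hnorm, e]

lemma sq_sub_sign_ne_zero {ϖ : Fˣ} (hnorm : ‖(ϖ : F)‖ = (q F : ℝ)⁻¹) (c : QuadricCase F) :
    (q F : ℂ) ^ 2 - c.sign ≠ 0 := by
  have hq : (1 : ℝ) < q F := by exact_mod_cast one_lt_q ϖ hnorm
  cases c with
  | split =>
    have : (q F : ℝ) ^ 2 - (-1) ≠ 0 := by nlinarith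
    change (q F : ℂ) ^ 2 - (-1) ≠ 0
    exact_mod_cast this
  | nonsplit θ h1 h3 =>
    have : (q F : ℝ) ^ 2 - 1 ≠ 0 := by nlinarith
    change (q F : ℂ) ^ 2 - 1 ≠ 0
    exact_mod_cast this

/-- At the base point the reductions lie on an anisotropic level set of the form, which misses the
line of the first basis vector. Its point count involves the square roots of the value, the only
place where the two cases differ. -/
lemma integral_torus_smul_zero (h2 : ringChar 𝓀[F] ≠ 2) {ϖ : Fˣ} (hϖ : IsUniformizer ϖ)
    (hnorm : ‖(ϖ : F)‖ = (q F : ℝ)⁻¹) {c : QuadricCase F} {T : Sphere c → ℂ}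
    (hT : ∀ k ∈ K F, ∀ s, T (k • s) = T s) :
    ∫ k : K F, T (torus ϖ 1 • (k : SO32 F) • orbitPoint h2 ϖ c 0) ∂(haarC (K F)) =
      ((q F : ℂ) * (q F - 1) * T (orbitPoint h2 ϖ c 1) +
        ((q F : ℂ) - c.sign) * T (orbitPoint h2 ϖ c 0)) / ((q F : ℂ) ^ 2 - c.sign) := by
  have := finite_residueField ϖ hnorm
  have := Fintype.ofFinite 𝓀[F]
  have hq : (1 : ℝ) < q F := by exact_mod_cast one_lt_q ϖ hnorm
  have hq0 : (q F : ℂ) ≠ 0 := by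
    have : (q F : ℝ) ≠ 0 := by linarith
    exact_mod_cast this
  have h2' : (2 : 𝓀[F]) ≠ 0 := Ring.two_ne_zero h2
  obtain ⟨τ, hτ⟩ := exists_factor_norm h2 hT
  have hv1 : ‖(ϖ : F) ^ 0 • (orbitPoint h2 ϖ c 0).1‖ = 1 := by
    rw [pow_zero, one_smul, norm_orbitPoint h2 hnorm, pow_zero]
  have hQv : Q ((ϖ : F) ^ 0 • (orbitPoint h2 ϖ c 0).1) ((ϖ : F) ^ 0 • (orbitPoint h2 ϖ c 0).1) =
      c.value := by rw [pow_zero, one_smul, (orbitPoint h2 ϖ c 0).2]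
  have ha : res c.value ≠ 0 :=
    (res_ne_zero_iff (norm_value h2 c).le).2 (norm_value h2 c)
  have hno : ∀ k : K F, red (mv (k : SO32 F) ((ϖ : F) ^ 0 • (orbitPoint h2 ϖ c 0).1)) 4 = 0 →
      red (mv (k : SO32 F) ((ϖ : F) ^ 0 • (orbitPoint h2 ϖ c 0).1)) 1 = 0 ∧
      red (mv (k : SO32 F) ((ϖ : F) ^ 0 • (orbitPoint h2 ϖ c 0).1)) 2 = 0 ∧
      red (mv (k : SO32 F) ((ϖ : F) ^ 0 • (orbitPoint h2 ϖ c 0).1)) 3 = 0 → 1 ≤ 0 := by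
    intro k h4 hmid
    exfalso
    apply ha
    rw [← hQv, ← Q_mv k, ← Qres_red (by rw [norm_mv k.2, hv1]), Qres, h4, hmid.1, hmid.2.1]
    simp
  simp only [fun k : K F => apply_torus_smul h2 hϖ hnorm hτ 0 k (hno k)]
  rw [integral_red_mv h2 hv1, hQv, sum_flagValue_ne_zero h2' ha, card_quadric_ne_zero h2' ha,
    card_sqrt_value h2]
  change (q F : ℂ) ^ 2 * ((q F : ℂ) * ((q F : ℂ) - 1) * _ + ((q F : ℂ) - 1 + (1 - c.sign)) * _) /
    ((q F : ℂ) ^ 2 * ((q F : ℂ) * ((q F : ℂ) - 1) + ((q F : ℂ) - 1 + (1 - c.sign)))) = _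
  rw [mul_div_mul_left _ _ (pow_ne_zero 2 hq0), hτ, hτ, norm_orbitPoint h2 hnorm,
    norm_orbitPoint h2 hnorm]
  congr 1 <;> ring

end HeckeOperator

end

end SO5

namespace SO5

noncomputable section

/-! ### The radial values -/

section Radial

variable (F : Type*) [NontriviallyNormedField F] [IsUltrametricDist F]

/-- The solution of the radial recurrence with initial value `1`. -/
def radial (ε ζ : ℂ) : ℕ → ℂ
  | 0 => 1
  | 1 => (((q F : ℂ) ^ 2 - ε) * eigD F ζ - (q F - ε)) / (q F * (q F - 1))
  | r + 2 => ((((q F : ℂ) ^ 3 + (q F : ℂ) ^ 2 + q F + 1) * eigD F ζ - ((q F : ℂ) ^ 2 + q F)) *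
      radial ε ζ (r + 1) - radial ε ζ r) / (q F : ℂ) ^ 3

variable {F}

lemma denominator_ne_zero : (q F : ℂ) ^ 3 + (q F : ℂ) ^ 2 + q F + 1 ≠ 0 := by
  have : (q F) ^ 3 + (q F) ^ 2 + q F + 1 ≠ 0 := by positivity
  exact_mod_cast this

lemma continuous_eigD (hq : (q F : ℂ) ≠ 0) : Continuous (eigD F) := by
  unfold eigD
  refine Continuous.div_const ?_ _
  have h1 : Continuous fun ζ : ℂ => (q F : ℂ) ^ (3 / 2 - ζ) :=
    Continuous.const_cpow (by fun_prop) (Or.inl hq)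
  have h2 : Continuous fun ζ : ℂ => (q F : ℂ) ^ (3 / 2 + ζ) :=
    Continuous.const_cpow (by fun_prop) (Or.inl hq)
  fun_prop

lemma continuous_radial (hq : (q F : ℂ) ≠ 0) (ε : ℂ) (r : ℕ) :
    Continuous fun ζ => radial F ε ζ r := by
  have := continuous_eigD hq
  induction r using Nat.strong_induction_on with
  | _ r ih =>
    match r with
    | 0 => exact continuous_const
    | 1 => simp only [radial]; fun_prop
    | r + 2 =>
      have h1 := ih r (by omega)
      have h2 := ih (r + 1) (by omega)
      simp only [radial]
      fun_prop

/-- The coefficients `q (q - 1)` and `q ^ 3` of the outermost values are nonzero, so each value is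
determined by the preceding ones. -/
lemma radial_eq_of_recurrence (hq : 1 < q F) {ε ζ : ℂ} (hε : (q F : ℂ) ^ 2 - ε ≠ 0) {t : ℕ → ℂ}
    (h0 : t 0 = 1)
    (h1 : ((q F : ℂ) * (q F - 1) * t 1 + (q F - ε) * t 0) / ((q F : ℂ) ^ 2 - ε) =
      eigD F ζ * t 0)
    (hs : ∀ r, ((q F : ℂ) ^ 3 * t (r + 2) + ((q F : ℂ) ^ 2 + q F) * t (r + 1) + t r) /
      ((q F : ℂ) ^ 3 + (q F : ℂ) ^ 2 + q F + 1) = eigD F ζ * t (r + 1)) (r : ℕ) :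
    t r = radial F ε ζ r := by
  have hq0 : (q F : ℂ) ≠ 0 := by
    have : q F ≠ 0 := by omega
    exact_mod_cast this
  have hq1 : (q F : ℂ) - 1 ≠ 0 := by
    rw [sub_ne_zero]
    exact_mod_cast hq.ne'
  induction r using Nat.strong_induction_on with
  | _ r ih =>
    match r with
    | 0 => exact h0
    | 1 =>
      rw [div_eq_iff hε, h0] at h1
      rw [radial, eq_div_iff (mul_ne_zero hq0 hq1)]
      linear_combination h1
    | r + 2 =>
      have h := hs r
      rw [div_eq_iff denominator_ne_zero] at h
      rw [radial, ← ih r (by omega), ← ih (r + 1) (by omega), eq_div_iff (pow_ne_zero 3 hq0)]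
      linear_combination h

variable (F) in
/-- The positive square root of `q`. -/
def sqrtQ : ℂ := (q F : ℂ) ^ (1 / 2 : ℂ)

lemma sqrtQ_sq : sqrtQ F ^ 2 = q F := by
  rw [sqrtQ, ← Complex.cpow_nat_mul]
  norm_num

lemma cpow_three_halves : (q F : ℂ) ^ (3 / 2 : ℂ) = sqrtQ F ^ 3 := by
  rw [sqrtQ, ← Complex.cpow_nat_mul]
  norm_num

/-- In terms of `√q` and `q ^ ζ` all exponents become integral, and the recurrence turns into an
identity of rational functions. -/
lemma term_eq (hq : (q F : ℂ) ≠ 0) (ε ξ : ℂ) (r : ℕ) : term (q F) ε ξ r =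
    ((sqrtQ F ^ 3 * (q F : ℂ) ^ ξ - 1) * (1 + ε * ((sqrtQ F)⁻¹ * ((q F : ℂ) ^ ξ)⁻¹))) /
      (((q F : ℂ) ^ ξ - ((q F : ℂ) ^ ξ)⁻¹) * (sqrtQ F ^ 3 + ε * (sqrtQ F)⁻¹)) *
      ((sqrtQ F ^ 3)⁻¹ * (q F : ℂ) ^ ξ) ^ r := by
  have e1 : (q F : ℂ) ^ (-1 / 2 : ℂ) = (sqrtQ F)⁻¹ := by
    rw [sqrtQ, ← Complex.cpow_neg]
    congr 1
    norm_num
  have er : (q F : ℂ) ^ (-(r : ℂ) * (3 / 2 - ξ)) = ((sqrtQ F ^ 3)⁻¹ * (q F : ℂ) ^ ξ) ^ r := by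
    rw [show -(r : ℂ) * (3 / 2 - ξ) = (r : ℂ) * (-(3 / 2) + ξ) by ring, Complex.cpow_nat_mul,
      Complex.cpow_add _ _ hq, Complex.cpow_neg, cpow_three_halves]
  rw [term, er, Complex.cpow_add _ _ hq, Complex.cpow_sub _ _ hq, Complex.cpow_neg, cpow_three_halves, e1,
    div_eq_mul_inv (sqrtQ F)⁻¹]

lemma eigD_eq (hq : (q F : ℂ) ≠ 0) (ζ : ℂ) : eigD F ζ =
    (sqrtQ F ^ 3 * ((q F : ℂ) ^ ζ)⁻¹ + sqrtQ F ^ 3 * (q F : ℂ) ^ ζ + (q F : ℂ) ^ 2 + q F) /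
      ((q F : ℂ) ^ 3 + (q F : ℂ) ^ 2 + q F + 1) := by
  rw [eigD, Complex.cpow_add _ _ hq, Complex.cpow_sub _ _ hq, cpow_three_halves,
    div_eq_mul_inv (sqrtQ F ^ 3)]

/-- The explicit solution of the radial recurrence. -/
lemma term_add_term_eq_radial (hq : 1 < q F) {ε ζ : ℂ} (hsq : ε ^ 2 = 1) (hε : (q F : ℂ) ^ 2 - ε ≠ 0)
    (hε' : (q F : ℂ) ^ 2 + ε ≠ 0)
    (hζ : (q F : ℂ) ^ ζ ≠ (q F : ℂ) ^ (-ζ)) (r : ℕ) :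
    term (q F) ε ζ r + term (q F) ε (-ζ) r = radial F ε ζ r := by
  have hq0 : (q F : ℂ) ≠ 0 := by
    have : q F ≠ 0 := by omega
    exact_mod_cast this
  have hx : (q F : ℂ) ^ ζ ≠ 0 := by simp [Complex.cpow_eq_zero_iff, hq0]
  have hD : (q F : ℂ) ^ 3 + (q F : ℂ) ^ 2 + q F + 1 ≠ 0 := denominator_ne_zero
  have hh : sqrtQ F ≠ 0 := fun h => hq0 (by rw [← sqrtQ_sq, h]; ring)
  rw [Complex.cpow_neg] at hζ
  have hx2 : ((q F : ℂ) ^ ζ) ^ 2 - 1 ≠ 0 := fun h => hζ (by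
    rw [eq_comm, inv_eq_iff_eq_inv, eq_comm, inv_eq_of_mul_eq_one_left]; linear_combination h)
  have hA := term_eq hq0 ε ζ
  have hB := term_eq hq0 ε (-ζ)
  have hE := eigD_eq hq0 ζ
  rw [Complex.cpow_neg] at hB
  rw [← sqrtQ_sq] at hD hε' hε
  simp only [← pow_mul, Nat.reduceMul] at hD hε' hε
  set x := (q F : ℂ) ^ ζ with hxdef
  set h := sqrtQ F with hdef
  have hA' : ∀ r, term (q F) ε ζ r = (h ^ 3 * x - 1) * (h * x + ε) /
      ((x ^ 2 - 1) * (h ^ 4 + ε)) * ((h ^ 3)⁻¹ * x) ^ r := by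
    intro r
    rw [hA]
    congr 1
    rw [show (x - x⁻¹) * (h ^ 3 + ε * h⁻¹) = (x ^ 2 - 1) * (h ^ 4 + ε) / (h * x) by
      field_simp, div_div_eq_mul_div]
    congr 1
    field_simp
  have hB' : ∀ r, term (q F) ε (-ζ) r = -((h ^ 3 - x) * (h + ε * x)) /
      ((x ^ 2 - 1) * (h ^ 4 + ε)) * ((h ^ 3)⁻¹ * x⁻¹) ^ r := by
    intro r
    rw [hB]
    congr 1
    rw [inv_inv, show (x⁻¹ - x) * (h ^ 3 + ε * h⁻¹) =
      (x ^ 2 - 1) * (h ^ 4 + ε) / (-(h * x)) by field_simp; ring, div_div_eq_mul_div]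
    congr 1
    field_simp
  have hqh : (q F : ℂ) = h ^ 2 := sqrtQ_sq.symm
  refine radial_eq_of_recurrence (t := fun r => term (q F) ε ζ r + term (q F) ε (-ζ) r) hq
    (by rw [hqh, ← pow_mul]; exact hε) ?_ ?_ ?_ r
  · simp only [hA', hB', pow_zero, mul_one]
    field_simp
    ring
  · simp only [hA', hB', hE, hqh, pow_zero, pow_one, mul_one, ← pow_mul, Nat.reduceMul]
    -- The denominator of the eigenvalue is kept as one symbol while fractions are cleared. The
    -- remaining identity holds modulo `ε ^ 2 = 1`.
    obtain ⟨D, hDD⟩ : ∃ D, D = h ^ 6 + h ^ 4 + h ^ 2 + 1 := ⟨_, rfl⟩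
    rw [← hDD] at hD ⊢
    field_simp
    rw [hDD]
    linear_combination (h * x - h * x ^ 3 + h ^ 4 * x ^ 4 - h ^ 4 + h ^ 7 * x - h ^ 7 * x ^ 3) * hsq
  -- The ratios `x / h ^ 3` and `1 / (x * h ^ 3)` are the roots of `q ^ 3 λ ^ 2 - h ^ 3 (x + x⁻¹) λ
  -- + 1`, so each geometric sequence satisfies the recurrence separately.
  · intro r
    simp only [hA', hB', hE, hqh, pow_add, ← pow_mul, Nat.reduceMul]
    field_simp
    ring

end Radial

end

end SO5

namespace SO5

noncomputable section

/-! ### Eigenfunctions are determined by the radial recurrence -/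

section Eigenfunctions

variable {F : Type*} [NontriviallyNormedField F] [IsUltrametricDist F] [LocallyCompactSpace F]

lemma sign_sq (c : QuadricCase F) : c.sign ^ 2 = 1 := by
  cases c <;> simp [QuadricCase.sign]

lemma sq_add_sign_ne_zero {ϖ : Fˣ} (hnorm : ‖(ϖ : F)‖ = (q F : ℝ)⁻¹) (c : QuadricCase F) :
    (q F : ℂ) ^ 2 + c.sign ≠ 0 := by
  have hq : (1 : ℝ) < q F := by exact_mod_cast one_lt_q ϖ hnorm
  cases c with
  | split =>
    have : (q F : ℝ) ^ 2 + (-1) ≠ 0 := by nlinarith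
    change (q F : ℂ) ^ 2 + (-1) ≠ 0
    exact_mod_cast this
  | nonsplit θ h1 h3 =>
    have : (q F : ℝ) ^ 2 + 1 ≠ 0 := by nlinarith
    change (q F : ℂ) ^ 2 + 1 ≠ 0
    exact_mod_cast this

/-- Only the operator of the double coset of `d_1` is used; its nonzero volume cancels from the
eigenvalue equation. -/
lemma apply_orbitPoint_eq_radial (h2 : ringChar 𝓀[F] ≠ 2) {ϖ : Fˣ} (hϖ : IsUniformizer ϖ)
    (hnorm : ‖(ϖ : F)‖ = (q F : ℝ)⁻¹) (μ : Measure (SO32 F)) [μ.IsHaarMeasure] {c : QuadricCase F}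
    {ζ : ℂ} {T : Sphere c → ℂ} (hT : IsNormalizedEigenfunction h2 μ c ζ T) (r : ℕ) :
    T (orbitPoint h2 ϖ c r) = radial F c.sign ζ r := by
  have he : ∀ s, ∫ k : K F, T (torus ϖ 1 • (k : SO32 F) • s) ∂(haarC (K F)) =
      eigD F ζ * T s := by
    intro s
    have h := hT.eigen (heckeD ϖ) s
    rw [integral_heckeD_smul ϖ μ hT.invariant, satake_heckeD h2 hϖ hnorm, mul_assoc] at h
    exact mul_left_cancel₀ (integral_heckeD_ne_zero ϖ μ) h
  refine radial_eq_of_recurrence (t := fun r => T (orbitPoint h2 ϖ c r)) (one_lt_q ϖ hnorm)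
    (sq_sub_sign_ne_zero hnorm c) ?_ ?_ ?_ r
  · rw [orbitPoint_zero]
    exact hT.normalized
  · rw [← integral_torus_smul_zero h2 hϖ hnorm hT.invariant, he]
  · intro r
    rw [← integral_torus_smul_succ h2 hϖ hnorm hT.invariant, he]

lemma apply_eq_radial (h2 : ringChar 𝓀[F] ≠ 2) {ϖ : Fˣ} (hϖ : IsUniformizer ϖ)
    (hnorm : ‖(ϖ : F)‖ = (q F : ℝ)⁻¹) (μ : Measure (SO32 F)) [μ.IsHaarMeasure] {c : QuadricCase F}
    {ζ : ℂ} {T : Sphere c → ℂ} (hT : IsNormalizedEigenfunction h2 μ c ζ T) {s : Sphere c} {r : ℕ}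
    (hs : ‖s.1‖ = (q F : ℝ) ^ r) : T s = radial F c.sign ζ r := by
  rw [← apply_orbitPoint_eq_radial h2 hϖ hnorm μ hT]
  exact eq_of_norm_eq h2 hT.invariant (by rw [hs, norm_orbitPoint h2 hnorm])

/-- The formula agrees with the continuous function `radial` wherever `q^z ≠ q^(-z)`. This holds
near `ζ` apart from `ζ` itself, because `q^z - q^(-z)` has there the nonzero derivative `2 q^ζ log
q`. -/
lemma tendsto_term_add_term {ϖ : Fˣ} (hnorm : ‖(ϖ : F)‖ = (q F : ℝ)⁻¹) (c : QuadricCase F) {ζ : ℂ}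
    (hζ : (q F : ℂ) ^ ζ = (q F : ℂ) ^ (-ζ)) (r : ℕ) :
    Filter.Tendsto (fun z : ℂ => term (q F) c.sign z r + term (q F) c.sign (-z) r)
      (nhdsWithin ζ {ζ}ᶜ) (nhds (radial F c.sign ζ r)) := by
  have hq := one_lt_q ϖ hnorm
  have hqr : (1 : ℝ) < q F := by exact_mod_cast hq
  have hq0 : (q F : ℂ) ≠ 0 := by
    have : q F ≠ 0 := by omega
    exact_mod_cast this
  have hx : (q F : ℂ) ^ ζ ≠ 0 := by simp [Complex.cpow_eq_zero_iff, hq0]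
  have hlog : Complex.log (q F : ℂ) ≠ 0 := by
    rw [← Complex.ofReal_natCast, ← Complex.ofReal_log (by positivity)]
    exact_mod_cast (Real.log_pos hqr).ne'
  have hd : HasDerivAt (fun z : ℂ => (q F : ℂ) ^ z - (q F : ℂ) ^ (-z))
      ((q F : ℂ) ^ ζ * Complex.log (q F) * 1 - (q F : ℂ) ^ (-ζ) * Complex.log (q F) * (-1)) ζ :=
    ((hasDerivAt_id ζ).const_cpow (Or.inl hq0)).sub
      ((hasDerivAt_id ζ).neg.const_cpow (Or.inl hq0))
  have hne := hd.eventually_ne (c := 0) (by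
    rw [← hζ, show ∀ a b : ℂ, a * b * 1 - a * b * (-1) = 2 * (a * b) from fun a b => by ring]
    exact mul_ne_zero two_ne_zero (mul_ne_zero hx hlog))
  refine Filter.Tendsto.congr' (f₁ := fun z => radial F c.sign z r) ?_
    ((continuous_radial hq0 c.sign r).continuousAt.tendsto.mono_left nhdsWithin_le_nhds)
  filter_upwards [hne] with z hz
  exact (term_add_term_eq_radial hq (sign_sq c) (sq_sub_sign_ne_zero hnorm c)
    (sq_add_sign_ne_zero hnorm c) (sub_ne_zero.1 hz) r).symm

end Eigenfunctions

/-! ### Eigenfunctions as averages of powers of the last coordinate -/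

section Poisson

variable {F : Type*} [NontriviallyNormedField F] [IsUltrametricDist F] [LocallyCompactSpace F]

/-- The average over `K` of the `m`-th power of the absolute value of the last coordinate. -/
def poisson (m : ℕ) {c : QuadricCase F} (s : Sphere c) : ℂ :=
  ∫ k : K F, (‖mv (k : SO32 F) s.1 4‖ : ℂ) ^ m ∂(haarC (K F))

lemma poisson_smul (m : ℕ) {c : QuadricCase F} {k : SO32 F} (hk : k ∈ K F) (s : Sphere c) :
    poisson m (k • s) = poisson m s := by
  have := integral_mul_right_eq_self (μ := haarC (K F))
    (fun c : K F => (‖mv (c : SO32 F) s.1 4‖ : ℂ) ^ m) ⟨k, hk⟩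
  simp only [poisson, smul_val, ← mv_mul, ← this, Subgroup.coe_mul]

lemma poisson_basePoint_ne_zero (h2 : ringChar 𝓀[F] ≠ 2) (m : ℕ) (c : QuadricCase F) :
    poisson m (basePoint h2 c) ≠ 0 := by
  have h4 : (basePoint h2 c).1 4 = 1 := by cases c <;> rfl
  have hc : Continuous fun k : K F => ‖mv (k : SO32 F) (basePoint h2 c).1 4‖ ^ m :=
    (((continuous_apply 4).comp ((continuous_mv _).comp continuous_subtype_val)).norm).pow m
  have hpos : 0 < ∫ k : K F, ‖mv (k : SO32 F) (basePoint h2 c).1 4‖ ^ m ∂(haarC (K F)) := by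
    refine hc.integral_pos_of_hasCompactSupport_nonneg_nonzero (x := 1)
      (HasCompactSupport.of_compactSpace _) (fun k => by positivity) ?_
    simp [mv_one, h4]
  have e : poisson m (basePoint h2 c) =
      ((∫ k : K F, ‖mv (k : SO32 F) (basePoint h2 c).1 4‖ ^ m ∂(haarC (K F)) : ℝ) : ℂ) := by
    rw [← integral_complex_ofReal]
    simp only [poisson, Complex.ofReal_pow]
  rw [e]
  exact_mod_cast hpos.ne'

lemma mv_unipotent_torus_mul_four {n : SO32 F} (hn : n ∈ N₀ F) (α β : Fˣ) (g : SO32 F)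
    (v : Fin 5 → F) : mv (n * torus α β * g) v 4 = (α : F)⁻¹ * mv g v 4 := by
  rw [mv_apply, mv_apply, Finset.mul_sum]
  exact Finset.sum_congr rfl fun j _ => by
    rw [entry_unipotent_torus_mul_four hn, mul_assoc]

/-- At this parameter `phiP` is `rowNorm ^ m`. In an Iwasawa decomposition of `g` the compact part
is absorbed by the average, and the triangular part scales the last coordinate by `α⁻¹`. -/
lemma integral_norm_mv_mul_pow (h2 : ringChar 𝓀[F] ≠ 2) (m : ℕ) {c : QuadricCase F} (g : SO32 F)
    (s : Sphere c) : ∫ k : K F, (‖mv (g * (k : SO32 F)) s.1 4‖ : ℂ) ^ m ∂(haarC (K F)) =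
      phiP (-(3 / 2) - m) g * poisson m s := by
  obtain ⟨n, hn, α, β, κ, hκ, rfl⟩ := exists_iwasawa h2 g
  have e : phiP (-(3 / 2) - m) (n * torus α β * κ) = ((‖(α : F)‖⁻¹ : ℝ) : ℂ) ^ m := by
    rw [phiP, rowNorm_unipotent_torus_mul hn, rowNorm_of_mem hκ, mul_one,
      show -(3 / 2 + (-(3 / 2) - (m : ℂ))) = m by ring, Complex.cpow_natCast]
  have := integral_mul_left_eq_self (μ := haarC (K F))
    (fun c : K F => (‖mv (c : SO32 F) s.1 4‖ : ℂ) ^ m) ⟨κ, hκ⟩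
  simp only [mul_assoc _ κ, mv_unipotent_torus_mul_four hn, norm_mul, norm_inv, e,
    Complex.ofReal_mul, mul_pow]
  rw [integral_const_mul, poisson, ← this]
  simp only [Subgroup.coe_mul]

/-- The integral of `f` against the `m`-th power of the norm of the last coordinate of `g s` is
averaged over `K` in two ways. On the left this gives `poisson m (g • s)`; on the right it gives
`phiP` times `poisson m s`. As `m ≥ 0` is an integer, the power is continuous and no convergence
question arises. -/
lemma integral_mul_poisson (h2 : ringChar 𝓀[F] ≠ 2) {ϖ : Fˣ} (hϖ : IsUniformizer ϖ)
    (hnorm : ‖(ϖ : F)‖ = (q F : ℝ)⁻¹) (μ : Measure (SO32 F)) [μ.IsHaarMeasure] (m : ℕ)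
    {c : QuadricCase F} (f : sphericalHecke F) (s : Sphere c) :
    ∫ g, f.1 g * poisson m (g • s) ∂μ =
      satake μ (-(3 / 2) - m) (1 / 2 + (-(3 / 2) - m)) f * poisson m s := by
  have hc : Continuous fun g : SO32 F => (‖mv g s.1 4‖ : ℂ) ^ m :=
    (Complex.continuous_ofReal.comp
      ((continuous_apply 4).comp (continuous_mv s.1)).norm).pow m
  have h1 := integral_hecke_average_left (le_refl (K F)) μ f hc
  have h3 := integral_hecke_average_right (le_refl (K F)) μ f hc
  simp only [poisson, smul_val, ← mv_mul]
  rw [← h1, h3]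
  simp only [integral_norm_mv_mul_pow h2, ← mul_assoc]
  rw [integral_mul_const, satake_eq_integral_phiP h2 hϖ hnorm]
  rfl

/-- The normalized eigenfunction at `ζ = -3/2 - m`. -/
lemma isNormalizedEigenfunction_poisson (h2 : ringChar 𝓀[F] ≠ 2) {ϖ : Fˣ} (hϖ : IsUniformizer ϖ)
    (hnorm : ‖(ϖ : F)‖ = (q F : ℝ)⁻¹) (μ : Measure (SO32 F)) [μ.IsHaarMeasure] (m : ℕ)
    (c : QuadricCase F) : IsNormalizedEigenfunction h2 μ c (-(3 / 2) - m)
      fun s => poisson m s / poisson m (basePoint h2 c) where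
  invariant k hk s := by rw [poisson_smul m hk]
  normalized := div_self (poisson_basePoint_ne_zero h2 m c)
  eigen f s := by
    simp only [← mul_div_assoc]
    rw [integral_div, integral_mul_poisson h2 hϖ hnorm]

end Poisson

end

end SO5

namespace SO5

noncomputable section

/-! ### Laurent polynomials in `q^ζ` -/

section Laurent

/-- `h` is a Laurent polynomial in `q^ζ`. -/
def IsLaurent (q : ℕ) (h : ℂ → ℂ) : Prop :=
  ∃ (N : ℕ) (p : Polynomial ℂ), ∀ ζ : ℂ, ((q : ℂ) ^ ζ) ^ N * h ζ = p.eval ((q : ℂ) ^ ζ)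

namespace IsLaurent

variable {q : ℕ} {h h' : ℂ → ℂ}

lemma const (a : ℂ) : IsLaurent q fun _ => a := ⟨0, Polynomial.C a, by simp⟩

lemma add (hh : IsLaurent q h) (hh' : IsLaurent q h') : IsLaurent q fun ζ => h ζ + h' ζ := by
  obtain ⟨N, p, hp⟩ := hh
  obtain ⟨N', p', hp'⟩ := hh'
  refine ⟨N + N', Polynomial.X ^ N' * p + Polynomial.X ^ N * p', fun ζ => ?_⟩
  simp only [Polynomial.eval_add, Polynomial.eval_mul, Polynomial.eval_pow, Polynomial.eval_X,
    ← hp, ← hp']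
  ring

lemma mul (hh : IsLaurent q h) (hh' : IsLaurent q h') : IsLaurent q fun ζ => h ζ * h' ζ := by
  obtain ⟨N, p, hp⟩ := hh
  obtain ⟨N', p', hp'⟩ := hh'
  refine ⟨N + N', p * p', fun ζ => ?_⟩
  simp only [Polynomial.eval_mul, ← hp, ← hp']
  ring

lemma sub (hh : IsLaurent q h) (hh' : IsLaurent q h') : IsLaurent q fun ζ => h ζ - h' ζ := by
  simpa [sub_eq_add_neg] using hh.add ((const (-1)).mul hh')

lemma div_const (hh : IsLaurent q h) (a : ℂ) : IsLaurent q fun ζ => h ζ / a := by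
  simpa [div_eq_mul_inv] using hh.mul (const a⁻¹)

lemma pow (hh : IsLaurent q h) (n : ℕ) : IsLaurent q fun ζ => h ζ ^ n := by
  induction n with
  | zero => simpa using const 1
  | succ n ih => simpa [pow_succ] using ih.mul hh

lemma sum {ι : Type*} {s : Finset ι} {H : ι → ℂ → ℂ} (hH : ∀ i ∈ s, IsLaurent q (H i)) :
    IsLaurent q fun ζ => ∑ i ∈ s, H i ζ := by
  classical
  induction s using Finset.induction_on with
  | empty => simpa using const 0
  | insert a s ha ih =>
    simp only [Finset.sum_insert ha]
    exact (hH a (Finset.mem_insert_self a s)).add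
      (ih fun i hi => hH i (Finset.mem_insert_of_mem hi))

lemma cpow_add (hq : (q : ℂ) ≠ 0) (a : ℂ) : IsLaurent q fun ζ => (q : ℂ) ^ (a + ζ) :=
  ⟨0, Polynomial.C ((q : ℂ) ^ a) * Polynomial.X, fun ζ => by simp [Complex.cpow_add _ _ hq]⟩

lemma cpow_sub (hq : (q : ℂ) ≠ 0) (a : ℂ) : IsLaurent q fun ζ => (q : ℂ) ^ (a - ζ) :=
  ⟨1, Polynomial.C ((q : ℂ) ^ a), fun ζ => by
    have : (q : ℂ) ^ ζ ≠ 0 := by simp [Complex.cpow_eq_zero_iff, hq]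
    simp only [Complex.cpow_sub _ _ hq, Polynomial.eval_C]
    field_simp⟩

/-- A Laurent polynomial in `q^ζ` that vanishes on a left progression vanishes identically. -/
lemma eq_zero (hh : IsLaurent q h) (hq : 1 < q) (a : ℂ) (h0 : ∀ m : ℕ, h (a - m) = 0) (ζ : ℂ) :
    h ζ = 0 := by
  obtain ⟨N, p, hp⟩ := hh
  have hqr : (1 : ℝ) < q := by exact_mod_cast hq
  have hq0 : (q : ℂ) ≠ 0 := by
    have : q ≠ 0 := by omega
    exact_mod_cast this
  -- The numbers `q^(a-m)` have distinct absolute values, so `p` has infinitely many roots.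
  have hinj : Function.Injective fun m : ℕ => (q : ℂ) ^ (a - m) := by
    intro m m' e
    have e' := congrArg (‖·‖) e
    simp only [Complex.norm_natCast_cpow_of_pos (show 0 < q by omega), Complex.sub_re,
      Complex.natCast_re] at e'
    have := (Real.strictMono_rpow_of_base_gt_one hqr).injective e'
    have h3 : (m : ℝ) = m' := by linarith
    exact_mod_cast h3
  have hp0 : p = 0 := by
    refine Polynomial.eq_zero_of_infinite_isRoot p ((Set.infinite_range_of_injective hinj).mono ?_)
    rintro _ ⟨m, rfl⟩
    change p.eval _ = 0
    rw [← hp, h0, mul_zero]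
  have hx : (q : ℂ) ^ ζ ≠ 0 := by simp [Complex.cpow_eq_zero_iff, hq0]
  have := hp ζ
  rw [hp0, Polynomial.eval_zero] at this
  exact (mul_eq_zero.1 this).resolve_left (pow_ne_zero _ hx)

/-- A continuous map to a discrete space takes finitely many values on the support of `f`, so the
integral is a finite combination of the functions `H i` with constant coefficients. -/
lemma integral {X ι : Type*} [TopologicalSpace X] [MeasurableSpace X] [BorelSpace X]
    [TopologicalSpace ι] [DiscreteTopology ι] (μ : Measure X) [IsFiniteMeasureOnCompacts μ]
    {f : X → ℂ} (hf : Continuous f) (hfc : HasCompactSupport f) {j : X → ι} (hj : Continuous j)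
    {H : ι → ℂ → ℂ} (hH : ∀ i, IsLaurent q (H i)) :
    IsLaurent q fun ζ => ∫ x, f x * H (j x) ζ ∂μ := by
  classical
  have hfin : (j '' tsupport f).Finite := (hfc.isCompact.image hj).finite_of_discrete
  have hmeas : ∀ i, MeasurableSet (j ⁻¹' {i}) := fun i =>
    ((isOpen_discrete {i}).preimage hj).measurableSet
  have hint : Integrable f μ := hf.integrable_of_hasCompactSupport hfc
  have e : ∀ ζ, ∫ x, f x * H (j x) ζ ∂μ =
      ∑ i ∈ hfin.toFinset, (∫ x, (j ⁻¹' {i}).indicator f x ∂μ) * H i ζ := by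
    intro ζ
    simp only [← integral_mul_const]
    rw [← integral_finsetSum _ fun i _ => (hint.indicator (hmeas i)).mul_const _]
    congr 1
    ext x
    by_cases hx : x ∈ tsupport f
    · rw [Finset.sum_eq_single (j x)]
      · rw [Set.indicator_of_mem (by simp)]
      · intro i _ hi
        rw [Set.indicator_of_notMem (by simpa using hi.symm), zero_mul]
      · intro hn
        exact absurd (hfin.mem_toFinset.2 ⟨x, hx, rfl⟩) hn
    · have h0 : f x = 0 := image_eq_zero_of_notMem_tsupport hx
      rw [h0, zero_mul, eq_comm]
      refine Finset.sum_eq_zero fun i _ => ?_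
      rw [Set.indicator_apply, h0, ite_self, zero_mul]
  simp only [e]
  exact sum fun i _ => (const _).mul (hH i)

end IsLaurent

end Laurent

/-! ### Existence of the eigenfunctions -/

section Existence

variable {F : Type*} [NontriviallyNormedField F] [IsUltrametricDist F]

lemma isLaurent_eigD (hq : (q F : ℂ) ≠ 0) : IsLaurent (q F) (eigD F) :=
  (((IsLaurent.cpow_sub hq _).add (IsLaurent.cpow_add hq _)).add (IsLaurent.const _)).add
    (IsLaurent.const _) |>.div_const _

lemma isLaurent_radial (hq : (q F : ℂ) ≠ 0) (ε : ℂ) (r : ℕ) :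
    IsLaurent (q F) fun ζ => radial F ε ζ r := by
  have hE := isLaurent_eigD hq
  induction r using Nat.strong_induction_on with
  | _ r ih =>
    match r with
    | 0 => exact IsLaurent.const 1
    | 1 =>
      simp only [radial]
      exact (((IsLaurent.const _).mul hE).sub (IsLaurent.const _)).div_const _
    | r + 2 =>
      simp only [radial]
      exact (((((IsLaurent.const _).mul hE).sub (IsLaurent.const _)).mul
        (ih (r + 1) (by omega))).sub (ih r (by omega))).div_const _

lemma isLaurent_zpow_cpow (hq : 0 < q F) (n : ℤ) :
    IsLaurent (q F) fun ζ => (((q F : ℝ) ^ n : ℝ) : ℂ) ^ (-(3 / 2 + ζ)) := by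
  have hq0 : (q F : ℂ) ≠ 0 := by exact_mod_cast hq.ne'
  obtain ⟨A, hA⟩ : ∃ A, Real.exp A = (q F : ℝ) := ⟨_, Real.exp_log (by exact_mod_cast hq)⟩
  have hA' : ∀ z : ℂ, (q F : ℂ) ^ z = Complex.exp (A * z) := fun z => by
    rw [← cpow_ofReal_exp, hA, Complex.ofReal_natCast]
  obtain ⟨k, rfl | rfl⟩ := n.eq_nat_or_neg
  · convert (IsLaurent.cpow_sub hq0 (-(3 / 2))).pow k using 2 with ζ
    rw [zpow_natCast, ← hA, ← Real.exp_nat_mul, cpow_ofReal_exp, hA', ← Complex.exp_nat_mul]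
    congr 1
    push_cast
    ring
  · convert (IsLaurent.cpow_add hq0 (3 / 2)).pow k using 2 with ζ
    rw [zpow_neg, zpow_natCast, ← hA, ← Real.exp_nat_mul, ← Real.exp_neg, cpow_ofReal_exp, hA', ← Complex.exp_nat_mul]
    congr 1
    push_cast
    ring

variable [LocallyCompactSpace F]

lemma exists_isNormalizedEigenfunction (h2 : ringChar 𝓀[F] ≠ 2) {ϖ : Fˣ} (hϖ : IsUniformizer ϖ)
    (hnorm : ‖(ϖ : F)‖ = (q F : ℝ)⁻¹) (μ : Measure (SO32 F)) [μ.IsHaarMeasure]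
    (c : QuadricCase F) (ζ : ℂ) :
    ∃ T : Sphere c → ℂ, IsNormalizedEigenfunction h2 μ c ζ T := by
  have hq := one_lt_q ϖ hnorm
  have hqr : (1 : ℝ) < q F := by exact_mod_cast hq
  have hq0 : (q F : ℂ) ≠ 0 := by
    have : q F ≠ 0 := by omega
    exact_mod_cast this
  choose ρ hρ using fun s : Sphere c => exists_norm_eq_pow h2 hϖ hnorm s
  have hρK : ∀ k ∈ K F, ∀ s, ρ (k • s) = ρ s := fun k hk s => by
    have : (q F : ℝ) ^ ρ (k • s) = (q F : ℝ) ^ ρ s := by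
      rw [← hρ, ← hρ, smul_val, norm_mv hk]
    exact pow_right_injective₀ (by linarith) hqr.ne' this
  -- The criteria for local constancy concern complex-valued functions; composing with the injection
  -- into `ℂ` transfers them to integer-valued ones.
  have hρc : ∀ s, Continuous fun g : SO32 F => ρ (g • s) := fun s =>
    (IsLocallyConstant.desc (fun g : SO32 F => ρ (g • s)) (fun n : ℕ => (n : ℂ))
      (isLocallyConstant_of_left_invariant fun k hk g => by
        simp only [Function.comp_apply, mul_smul, hρK k hk]) Nat.cast_injective).continuous
  choose ν hν using fun g : SO32 F => show ∃ n : ℤ, rowNorm g = (q F : ℝ) ^ n by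
    obtain ⟨i, hi⟩ := exists_norm_eq fun j => entry g 4 j
    have h0 : entry g 4 i ≠ 0 := by
      rw [← norm_pos_iff]
      change 0 < ‖(fun j => entry g 4 j) i‖
      rw [hi]
      exact rowNorm_pos g
    obtain ⟨n, hn⟩ := exists_norm_eq_zpow hϖ hnorm h0
    exact ⟨n, by rw [← hn]; exact hi.symm⟩
  have hνc : Continuous ν :=
    (IsLocallyConstant.desc ν (fun n : ℤ => (n : ℂ))
      (isLocallyConstant_of_right_invariant fun k hk g => by
        have : (q F : ℝ) ^ ν (g * k) = (q F : ℝ) ^ ν g := by rw [← hν, ← hν, rowNorm_mul hk]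
        simp only [Function.comp_apply, zpow_right_injective₀ (by linarith) hqr.ne' this])
      Int.cast_injective).continuous
  have hbase : ρ (basePoint h2 c) = 0 := by
    have h := norm_orbitPoint h2 hnorm c 0
    rw [orbitPoint_zero, hρ] at h
    exact pow_right_injective₀ (by linarith) hqr.ne' h
  refine ⟨fun s => radial F c.sign ζ (ρ s), fun k hk s => by rw [hρK k hk], by rw [hbase]; rfl,
    fun f s => ?_⟩
  -- The defect of the eigenvalue equation for `radial`, with the Satake transform written as an
  -- integral of powers of `q`. It vanishes at `z = -3/2 - m`, where uniqueness identifies `radial`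
  -- with the Poisson averages.
  have hL : IsLaurent (q F) fun z => (∫ g, f.1 g * radial F c.sign z (ρ (g • s)) ∂μ) -
      (∫ g, f.1 g * (((q F : ℝ) ^ ν g : ℝ) : ℂ) ^ (-(3 / 2 + z)) ∂μ) *
        radial F c.sign z (ρ s) :=
    (IsLaurent.integral μ (hecke_continuous f) f.2.2 (hρc s)
      (fun r => isLaurent_radial hq0 c.sign r)).sub
    ((IsLaurent.integral μ (hecke_continuous f) f.2.2 hνc
      (fun n => isLaurent_zpow_cpow (by omega) n)).mul (isLaurent_radial hq0 c.sign _))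
  have hsat : ∀ z, ∫ g, f.1 g * (((q F : ℝ) ^ ν g : ℝ) : ℂ) ^ (-(3 / 2 + z)) ∂μ =
      satake μ z (1 / 2 + z) f := fun z => by
    rw [satake_eq_integral_phiP h2 hϖ hnorm]
    simp only [phiP, hν]
  have := hL.eq_zero hq (-(3 / 2)) (fun m => by
    have hT := isNormalizedEigenfunction_poisson h2 hϖ hnorm μ m c
    have he := hT.eigen f s
    simp only [fun s => apply_eq_radial h2 hϖ hnorm μ hT (hρ s)] at he
    rw [hsat, he, sub_self]) ζ
  rw [hsat] at this
  exact sub_eq_zero.1 this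

end Existence

end

end SO5

/-! ### The proposition -/

theorem proposition2p2 {F : Type*} [NontriviallyNormedField F] [IsUltrametricDist F]
    [LocallyCompactSpace F]
    (h2 : ringChar 𝓀[F] ≠ 2)
    (ϖ : Fˣ) (hϖ : SO5.IsUniformizer ϖ)
    (hnorm : ‖(ϖ : F)‖ = (SO5.q F : ℝ)⁻¹)
    (μ : Measure (SO5.SO32 F)) [μ.IsHaarMeasure] (hμ : μ (SO5.K F : Set (SO5.SO32 F)) = 1)
    (c : SO5.QuadricCase F) (ζ : ℂ) :
    (∃! T : SO5.Sphere c → ℂ, SO5.IsNormalizedEigenfunction h2 μ c ζ T) ∧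
    ∀ T : SO5.Sphere c → ℂ, SO5.IsNormalizedEigenfunction h2 μ c ζ T → ∀ r : ℕ, 1 ≤ r →
      ((SO5.q F : ℂ) ^ ζ ≠ (SO5.q F : ℂ) ^ (-ζ) →
        T (SO5.torus (ϖ ^ r) 1 • SO5.basePoint h2 c) =
          SO5.term (SO5.q F) c.sign ζ r + SO5.term (SO5.q F) c.sign (-ζ) r) ∧
      ((SO5.q F : ℂ) ^ ζ = (SO5.q F : ℂ) ^ (-ζ) →
        Filter.Tendsto
          (fun z : ℂ => SO5.term (SO5.q F) c.sign z r + SO5.term (SO5.q F) c.sign (-z) r)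
          (nhdsWithin ζ {ζ}ᶜ)
          (nhds (T (SO5.torus (ϖ ^ r) 1 • SO5.basePoint h2 c)))) := by
  refine ⟨?_, fun T hT r _ => ?_⟩
  · obtain ⟨T, hT⟩ := SO5.exists_isNormalizedEigenfunction h2 hϖ hnorm μ c ζ
    refine ⟨T, hT, fun T' hT' => funext fun s => ?_⟩
    obtain ⟨r, hr⟩ := SO5.exists_norm_eq_pow h2 hϖ hnorm s
    rw [SO5.apply_eq_radial h2 hϖ hnorm μ hT hr, SO5.apply_eq_radial h2 hϖ hnorm μ hT' hr]
  · change (_ → T (SO5.orbitPoint h2 ϖ c r) = _) ∧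
      (_ → Filter.Tendsto _ _ (nhds (T (SO5.orbitPoint h2 ϖ c r))))
    rw [SO5.apply_orbitPoint_eq_radial h2 hϖ hnorm μ hT]
    exact ⟨fun hζ => (SO5.term_add_term_eq_radial (SO5.one_lt_q ϖ hnorm) (SO5.sign_sq c)
      (SO5.sq_sub_sign_ne_zero hnorm c) (SO5.sq_add_sign_ne_zero hnorm c) hζ r).symm,
      fun hζ => SO5.tendsto_term_add_term hnorm c hζ r⟩
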